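/- **Setting.** Let $X\subseteq\mathbb R^d$ ($d\ge 1$) be closed and convex, let $f:\mathbb R^d\to\mathbb R$ be convex and $G$-Lipschitz with respect to $\|\cdot\|_2$ ($G>0$), let $x^\star\in X$ minimize $f$ over $X$, let $R>0$ satisfy $\|x-x^\star\|_2\le R$ for all $x\in X$, and let $x_1\in X$, $\varepsilon>0$. Write $\Pi_X$ for the Euclidean projection onto $X$. For a function $\tilde f$ with values in $m$-bit fixed-point numbers with $p$ fractional bits, the binary oracle is the unitary $|x\rangle|y\rangle\mapsto|x\rangle|y\oplus\tilde f(x)\rangle$, where $x$ ranges over a hypergrid whose corner and spacing are chosen by the algorithm; it is $\theta$-approximate for $f$ if $|\tilde f(x)-f(x)|<\theta$ for all $x$ with $\ell_\infty$-distance at most $2r_1$ from some point of $X$, where $r_1=\varepsilon/(6G\sqrt d)$. The gate count of an algorithm is the number of two-qubit gates, single-qubit measurements, initializations, oracle calls and elementary operations on real numbers (loading a constant, $+$, $-$, $\times$, selection by a comparison), plus $\mathcal T_\Pi$ for every evaluation of $\Pi_X$. **Theorem (Quantum projected subgradient method).** There are absolute constants $A,c_0>0$ and $k\in\mathbb N$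 such that for every $c\in(0,c_0]$ there is a constant $C>0$ (depending only on $c$) with the following property. For all $d,G,R,\varepsilon,m,p$ there are $T\ge1$ and a quantum subroutine $E$, which do not depend on $X,f,x_1,\tilde f,\mathcal T_\Pi$, such that, whenever the oracle is $\theta$-approximate for $f$ with $$\theta=c\,\frac{\varepsilon^5}{G^4R^4d^{4.5}},$$ the following hold. 1. With $\rho=1/(3T)$: for every $x\in X$, $E$ computes on input $x$, with probability at least $1-\rho$, an approximate subgradient $\tilde g\in\mathbb R^d$ at $x$, i.e. for all $q\in\mathbb R^d$ $$f(q)\ \ge\ f(x)+\langle\tilde g,q-x\rangle-A\,d^2\sqrt{\frac{\theta G}{\rho r_1}}\,\|q-x\|_2-2G\sqrt d\,r_1 .$$ 2. The quantum projected subgradient method $x_{t+1}=\Pi_X(x_t-\eta\tilde g_t)$, started at $x_1$, run for $T$ iterations with $\eta=R/(G\sqrt T)$, with $\tilde g_t$ computed by $E$ at $x_t$ in each iteration, outputs the average $\bar x=\frac1T\sum_{t=1}^Tx_t$; with probability at least $2/3$ one has $\bar x\in X$ and $f(\bar x)-\min_{x\in X}f(x)\le\varepsilon$. 3. With $\Lambda=\log^k(2+d+GR/\varepsilon)$,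 the whole method uses at most $C\max\{1,(GR/\varepsilon)^2\}\,\Lambda=\widetilde{\mathcal O}((GR/\varepsilon)^2)$ oracle queries and at most $C\,(d+\mathcal T_\Pi)\max\{1,(GR/\varepsilon)^2\}\,\Lambda=\widetilde{\mathcal O}((d+\mathcal T_\Pi)(GR/\varepsilon)^2)$ gates. -/

import Mathlib

noncomputable section

namespace QPSM

/-! ### The computational model

A program is a straight-line hybrid circuit.  It acts on a classical memory of real registers
(indexed by `ℕ`) and on `n` qubits.  The objective is reachable only through the binary oracle, the
feasible set only through the Euclidean projection. -/

/-- Classical memory. -/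
abbrev Mem := ℕ → ℝ

/-- Computational basis states of `n` qubits. -/
abbrev Bits (n : ℕ) := Fin n → Bool

/-- Pure states of `n` qubits, not necessarily normalized: the squared norm of the state in a branch
of a computation is the probability of that branch. -/
abbrev QState (n : ℕ) := Bits n → ℂ

/-- Squared norm of a state. -/
def normSq {n : ℕ} (ψ : QState n) : ℝ := ∑ s, ‖ψ s‖ ^ 2

/-- The state `|0…0⟩`. -/
def zeroState (n : ℕ) : QState n := fun s => if s = (fun _ => false) then 1 else 0

/-- The vector of `ℝ^d` stored in the registers `base, …, base + d - 1`. -/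
def readVec (d : ℕ) (μ : Mem) (base : ℕ) : EuclideanSpace ℝ (Fin d) :=
  WithLp.toLp 2 fun i => μ (base + i)

/-- Store a vector of `ℝ^d` in the registers `base, …, base + d - 1`. -/
def writeVec {d : ℕ} (μ : Mem) (base : ℕ) (v : EuclideanSpace ℝ (Fin d)) : Mem := fun j =>
  if h : base ≤ j ∧ j < base + d then v ⟨j - base, by omega⟩ else μ j

/-- Instructions for problems in dimension `d`, for an oracle with `m` output qubits, on `n` qubits
in total. -/
inductive Instr (d m n : ℕ) : Type
  /-- Load a real constant. -/
  | const (dst : ℕ) (a : ℝ)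
  /-- Arithmetic on registers. -/
  | add (dst a b : ℕ)
  | sub (dst a b : ℕ)
  | mul (dst a b : ℕ)
  /-- If register `a` is smaller than register `b`, copy register `s`, otherwise register `t`. -/
  | select (dst a b s t : ℕ)
  /-- Replace the vector stored from register `base` on by its projection onto the feasible set. -/
  | project (base : ℕ)
  /-- Discard all qubits and continue with fresh ones, in the state `|0…0⟩`. -/
  | fresh
  /-- An arbitrary two-qubit gate (one-qubit gates are the special case `U ⊗ 1`). -/
  | gate (U : Matrix.unitaryGroup (Bool × Bool) ℂ) (q₁ q₂ : Fin n) (hq : q₁ ≠ q₂)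
  /-- Measure a qubit in the computational basis; the outcome, `0` or `1`, goes to register `dst`. -/
  | measure (q : Fin n) (dst : ℕ)
  /-- Query the binary oracle over a hypergrid with `2 ^ b` points per coordinate, whose corner is
  the vector stored from register `base` on and whose spacing is stored in register `sp`.  The qubits
  `idx i 0, …, idx i (b - 1)` hold the `i`-th coordinate of the grid point in binary, the qubits
  `out` receive the value. -/
  | query (b : ℕ) (idx : Fin d → Fin b → Fin n) (out : Fin m → Fin n) (base sp : ℕ)
      (hout : Function.Injective out) (hdisj : ∀ i k j, idx i k ≠ out j)

/-- Straight-line programs. -/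
abbrev Program (d m n : ℕ) := List (Instr d m n)

/-- A classical memory together with the (unnormalized) state of the qubits. -/
structure Config (n : ℕ) where
  mem : Mem
  st : QState n

/-- Apply a two-qubit gate to the qubits `q₁, q₂`. -/
def applyGate {n : ℕ} (U : Matrix (Bool × Bool) (Bool × Bool) ℂ) (q₁ q₂ : Fin n) (ψ : QState n) :
    QState n := fun s =>
  ∑ a : Bool × Bool, U (s q₁, s q₂) a * ψ (Function.update (Function.update s q₁ a.1) q₂ a.2)

/-- The part of the state in which qubit `q` has the value `v`. -/
def collapse {n : ℕ} (q : Fin n) (v : Bool) (ψ : QState n) : QState n := fun s =>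
  if s q = v then ψ s else 0

/-- The point of the hypergrid with the given corner and spacing that the index qubits encode. -/
def gridPoint {d b n : ℕ} (idx : Fin d → Fin b → Fin n) (corner : EuclideanSpace ℝ (Fin d)) (h : ℝ)
    (s : Bits n) : EuclideanSpace ℝ (Fin d) :=
  WithLp.toLp 2 fun i => corner i + h * ∑ k : Fin b, if s (idx i k) then (2 : ℝ) ^ (k : ℕ) else 0

open Classical in
/-- The map `(x, y) ↦ (x, y ⊕ F x)` on basis states, with `x` read from the index qubits and `y` the
content of the output qubits. -/
def oracleMap {d b m n : ℕ} (F : EuclideanSpace ℝ (Fin d) → BitVec m)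
    (idx : Fin d → Fin b → Fin n) (out : Fin m → Fin n) (corner : EuclideanSpace ℝ (Fin d)) (h : ℝ)
    (s : Bits n) : Bits n := fun q =>
  if hq : ∃ j, out j = q then
    xor (s q) ((F (gridPoint idx corner h s)).getLsbD (Classical.choose hq : Fin m))
  else s q

/-- The Euclidean projection onto `X`: the point of `X` closest to `z`. -/
def proj {d : ℕ} (X : Set (EuclideanSpace ℝ (Fin d))) (z : EuclideanSpace ℝ (Fin d)) :
    EuclideanSpace ℝ (Fin d) :=
  Classical.epsilon fun p => p ∈ X ∧ ∀ y ∈ X, ‖z - p‖ ≤ ‖z - y‖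

open Classical in
/-- One instruction, for the oracle `F` and the feasible set `X`: the list of possible branches.  The
basis permutation of a query is an involution, so that it acts on amplitudes by composition. -/
def step {d m n : ℕ} (F : EuclideanSpace ℝ (Fin d) → BitVec m)
    (X : Set (EuclideanSpace ℝ (Fin d))) : Instr d m n → Config n → List (Config n)
  | .const dst a, c => [⟨Function.update c.mem dst a, c.st⟩]
  | .add dst a b, c => [⟨Function.update c.mem dst (c.mem a + c.mem b), c.st⟩]
  | .sub dst a b, c => [⟨Function.update c.mem dst (c.mem a - c.mem b), c.st⟩]
  | .mul dst a b, c => [⟨Function.update c.mem dst (c.mem a * c.mem b), c.st⟩]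
  | .select dst a b s t, c =>
      [⟨Function.update c.mem dst (if c.mem a < c.mem b then c.mem s else c.mem t), c.st⟩]
  | .project base, c => [⟨writeVec c.mem base (proj X (readVec d c.mem base)), c.st⟩]
  | .fresh, c => [⟨c.mem, fun s => (√(normSq c.st) : ℝ) * zeroState n s⟩]
  | .gate U q₁ q₂ _, c => [⟨c.mem, applyGate U q₁ q₂ c.st⟩]
  | .measure q dst, c =>
      [⟨Function.update c.mem dst 0, collapse q false c.st⟩,
       ⟨Function.update c.mem dst 1, collapse q true c.st⟩]
  | .query _ idx out base sp _ _, c =>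
      [⟨c.mem, fun s => c.st (oracleMap F idx out (readVec d c.mem base) (c.mem sp) s)⟩]

/-- All branches of a program. -/
def run {d m n : ℕ} (F : EuclideanSpace ℝ (Fin d) → BitVec m)
    (X : Set (EuclideanSpace ℝ (Fin d))) : Program d m n → Config n → List (Config n)
  | [], c => [c]
  | i :: P, c => (step F X i c).flatMap (run F X P)

open Classical in
/-- The probability that the program, started in `c`, ends with a memory in `S` (times `normSq c.st`
if the initial state is not normalized). -/
def prob {d m n : ℕ} (F : EuclideanSpace ℝ (Fin d) → BitVec m)
    (X : Set (EuclideanSpace ℝ (Fin d))) (P : Program d m n) (c : Config n) (S : Set Mem) : ℝ :=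
  ((run F X P c).map fun c' => if c'.mem ∈ S then normSq c'.st else 0).sum

/-- Number of oracle queries. -/
def Instr.queryCost {d m n : ℕ} : Instr d m n → ℕ
  | .query .. => 1
  | _ => 0

/-- Number of gates, if a projection onto the feasible set costs `τ`; every other instruction
counts one. -/
def Instr.gateCost {d m n : ℕ} (τ : ℕ) : Instr d m n → ℕ
  | .project _ => τ
  | _ => 1

def queries {d m n : ℕ} (P : Program d m n) : ℕ := (P.map Instr.queryCost).sum

def gates {d m n : ℕ} (τ : ℕ) (P : Program d m n) : ℕ := (P.map (Instr.gateCost τ)).sum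

/-- Initial configuration on input `x`. -/
def initConfig {d : ℕ} (n : ℕ) (x : EuclideanSpace ℝ (Fin d)) : Config n :=
  ⟨writeVec (fun _ => 0) 0 x, zeroState n⟩

/-! ### The approximate binary oracle -/

/-- The real number that an output string stands for: two's complement with `p` fractional bits. -/
def fixedPoint {m : ℕ} (p : ℕ) (v : BitVec m) : ℝ := (v.toInt : ℝ) / 2 ^ p

/-- `F` is a `θ`-approximate binary oracle for `f` on the set `D`. -/
def IsApproxOracle {d m : ℕ} (p : ℕ) (f : EuclideanSpace ℝ (Fin d) → ℝ)
    (D : Set (EuclideanSpace ℝ (Fin d))) (θ : ℝ) (F : EuclideanSpace ℝ (Fin d) → BitVec m) : Prop :=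
  ∀ x ∈ D, |fixedPoint p (F x) - f x| < θ

/-- The points whose `ℓ_∞`-distance from some point of `X` is at most `r`. -/
def boxNhd {d : ℕ} (X : Set (EuclideanSpace ℝ (Fin d))) (r : ℝ) : Set (EuclideanSpace ℝ (Fin d)) :=
  {y | ∃ x ∈ X, ∀ i, |y i - x i| ≤ r}

/-! ### The quantum projected subgradient method

Registers: `0, …, d - 1` hold the iterate, `d, …, 2d - 1` the subgradient estimate,
`2d, …, 3d - 1` the sum of the iterates, `3d` the step size. -/

/-- The program `E` is a subgradient estimator for `f` on `X` with failure probability `ρ`: whatever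
else the memory and the qubits contain, if the iterate is `x ∈ X`, then with probability at least
`1 - ρ` it writes a vector `g` with
`f q ≥ f x + ⟪g, q - x⟫ - δ ‖q - x‖ - γ` for all `q`, and leaves the iterate, the sum and the step
size alone. -/
def IsSubgradientEstimator {d m n : ℕ} (F : EuclideanSpace ℝ (Fin d) → BitVec m)
    (X : Set (EuclideanSpace ℝ (Fin d))) (f : EuclideanSpace ℝ (Fin d) → ℝ) (ρ δ γ : ℝ)
    (E : Program d m n) : Prop :=
  ∀ c : Config n, readVec d c.mem 0 ∈ X →
    (1 - ρ) * normSq c.st ≤ prob F X E c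
      {μ | (∀ j, j < d ∨ (2 * d ≤ j ∧ j ≤ 3 * d) → μ j = c.mem j) ∧
        ∀ q, f (readVec d c.mem 0) + inner ℝ (readVec d μ d) (q - readVec d c.mem 0)
          - δ * ‖q - readVec d c.mem 0‖ - γ ≤ f q}

/-- One iteration: add `x` to the sum, estimate a subgradient `g`, replace `x` by the projection of
`x - η g`. -/
def iteration {d m n : ℕ} (E : Program d m n) : Program d m n :=
  (List.range d).map (fun i => .add (2 * d + i) (2 * d + i) i)
    ++ E
    ++ (List.range d).map (fun i => .mul (d + i) (3 * d) (d + i))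
    ++ (List.range d).map (fun i => .sub i i (d + i))
    ++ [.project 0]

/-- The projected subgradient method with step size `η`, `T` iterations and the estimator `E`; the
average of the `T` iterates is left in the registers `2d, …, 3d - 1`. -/
def qpsm {d m n : ℕ} (T : ℕ) (η : ℝ) (E : Program d m n) : Program d m n :=
  (List.range d).map (fun i => .const (2 * d + i) 0)
    ++ [.const (3 * d) η]
    ++ (List.replicate T (iteration E)).flatten
    ++ [.const (3 * d) (1 / T)]
    ++ (List.range d).map (fun i => .mul (2 * d + i) (3 * d) (2 * d + i))

end QPSM

end

/-! The outer method is classical. Since projecting onto `X` does not increase the distance to a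
point of `X`, expanding the squared distance to the minimizer bounds the total regret of T steps
(`Progress.succ`), and Jensen's inequality passes to the average (`Progress.average`). With T of
order 36 (GR/ε)² this gives accuracy ε, provided that every step has a subgradient with slope error
δ of order ε/R and offset γ = ε/3. Each step fails with probability at most 1/(3T), so all succeed
with probability at least 2/3. What needs an idea is a subgradient estimator with
polylogarithmically many queries.

Random shift: `f` need not be differentiable at x. At a uniformly random point z of a grid with
spacing h and N points per direction, the mean second difference in any direction telescopes to at
most 2Gh/N (`gridAvg_secDiff_le`). By Markov's inequality the second differences at z are small with
high probability (`reaches_pointProg`), and convexity then makes `f` almost linear on the vertices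
of every cube with corner z and edge at most h/d (`linearization_error_le`). A subgradient g at z
serves at x too, at the price 2G‖z - x‖.

Phase kickback: query, phase gates and a second query turn the uniform superposition over the
vertices z + σu into one with phases close to const + Σ uᵢτgᵢ (`run_kickbackProg`, `phase_close`).
Linear phases give a product state (`layer_linear`), so measuring all coordinate qubits yields for
every i at once a bit whose mean is close to (1 - cos τgᵢ)/2 or (1 - sin τgᵢ)/2. Two queries thus
serve all d coordinates, and logarithmically many repetitions suffice by an exponential moment bound
and a union bound (`reaches_counters`). Only 14 output bits affect the phase noticeably modulo 2π
(`outPhase_window`), so the gate count does not depend on m.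

Doubling: if gᵢ is known up to 1/τ, a crude estimate of sin(τ(gᵢ - aᵢ)) improves this to 1/(2τ)
(`ensures_decodeProg`). Starting from aᵢ = 0 with error G, each stage doubles the edge of the cube
and halves the error, as long as the cube stays in the linear region.

Choosing the spacing so that Markov's inequality fails with probability at most ρ/2, and the phase
scale 2^e of order 1/θ, bounds the final slope error by A d²√(θG/(ρr₁)) (`resolution_le`). For the
prescribed θ the powers of d cancel and this is of order √c ε/R (`error_budget`).

Probabilities are handled through sums over branches: `Ensures` and `Reaches` are Hoare triples that
hold surely and with bounded failure probability, and `Reaches.seq` adds failure probabilities. -/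

noncomputable section

namespace QPSM

/-! ### Expectations over the branches of a program -/

section Calculus

variable {d m n : ℕ} {F : EuclideanSpace ℝ (Fin d) → BitVec m} {X : Set (EuclideanSpace ℝ (Fin d))}

/-- The sum of `Φ` over all branches of a program. -/
def ev (F : EuclideanSpace ℝ (Fin d) → BitVec m) (X : Set (EuclideanSpace ℝ (Fin d)))
    (P : Program d m n) (c : Config n) (Φ : Config n → ℝ) : ℝ :=
  ((run F X P c).map Φ).sum

theorem run_append (P Q : Program d m n) (c : Config n) :
    run F X (P ++ Q) c = (run F X P c).flatMap (run F X Q) := by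
  induction P generalizing c with
  | nil => simp [run]
  | cons i P ih => simp [run, funext ih, List.flatMap_assoc]

theorem run_singleton (i : Instr d m n) (c : Config n) : run F X [i] c = step F X i c := by
  simp [run]

theorem sum_map_flatMap {α β : Type*} (l : List α) (f : α → List β) (Φ : β → ℝ) :
    ((l.flatMap f).map Φ).sum = (l.map fun a => ((f a).map Φ).sum).sum := by
  induction l with
  | nil => simp
  | cons a l ih => simp [ih]

theorem ev_nil (c : Config n) (Φ : Config n → ℝ) : ev F X [] c Φ = Φ c := by simp [ev, run]

theorem ev_cons (i : Instr d m n) (P : Program d m n) (c : Config n) (Φ : Config n → ℝ) :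
    ev F X (i :: P) c Φ = ((step F X i c).map fun c' => ev F X P c' Φ).sum := by
  simp only [ev, run, sum_map_flatMap]

theorem ev_append (P Q : Program d m n) (c : Config n) (Φ : Config n → ℝ) :
    ev F X (P ++ Q) c Φ = ev F X P c fun c' => ev F X Q c' Φ := by
  simp only [ev, run_append, sum_map_flatMap]

theorem ev_mono {P : Program d m n} {c : Config n} {Φ Ψ : Config n → ℝ}
    (h : ∀ c' ∈ run F X P c, Φ c' ≤ Ψ c') : ev F X P c Φ ≤ ev F X P c Ψ :=
  List.sum_le_sum h

theorem ev_add (P : Program d m n) (c : Config n) (Φ Ψ : Config n → ℝ) :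
    ev F X P c (fun c' => Φ c' + Ψ c') = ev F X P c Φ + ev F X P c Ψ := List.sum_map_add

theorem ev_const_mul (P : Program d m n) (c : Config n) (r : ℝ) (Φ : Config n → ℝ) :
    ev F X P c (fun c' => r * Φ c') = r * ev F X P c Φ :=
  List.sum_map_mul_left _ _ _

theorem ev_sum {ι : Type*} (t : Finset ι) (P : Program d m n) (c : Config n)
    (Φ : ι → Config n → ℝ) :
    ev F X P c (fun c' => ∑ i ∈ t, Φ i c') = ∑ i ∈ t, ev F X P c (Φ i) := by
  classical
  induction t using Finset.induction_on with
  | empty => simp [ev]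
  | insert a t ha ih => simp only [Finset.sum_insert ha, ev_add, ih]

theorem normSq_nonneg (ψ : QState n) : 0 ≤ normSq ψ := Finset.sum_nonneg fun _ _ => by positivity

open Classical in
theorem prob_eq_ev (P : Program d m n) (c : Config n) (S : Set Mem) :
    prob F X P c S = ev F X P c fun c' => if c'.mem ∈ S then normSq c'.st else 0 := rfl

theorem prob_nonneg (P : Program d m n) (c : Config n) (S : Set Mem) : 0 ≤ prob F X P c S := by
  classical
  rw [prob_eq_ev]
  refine List.sum_nonneg fun x hx => ?_
  obtain ⟨c', -, rfl⟩ := List.mem_map.1 hx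
  split_ifs
  · exact normSq_nonneg _
  · exact le_rfl

/-! ### Conservation of the total probability -/

/-- Overwriting a bit by both values produces the string itself and its flip; flipping permutes the
strings. -/
theorem sum_update_bool (q : Fin n) (f : Bits n → ℝ) :
    ∑ s, ∑ v, f (Function.update s q v) = 2 * ∑ s, f s := by
  have hflip : ∑ s : Bits n, f (Function.update s q (!s q)) = ∑ s, f s := by
    refine Fintype.sum_equiv ⟨fun s => Function.update s q (!s q),
      fun s => Function.update s q (!s q), fun s => ?_, fun s => ?_⟩ _ _ fun s => rfl <;> simp
  have : ∀ s : Bits n, ∑ v, f (Function.update s q v) = f s + f (Function.update s q (!s q)) := by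
    intro s
    cases h : s q
    · have h' : Function.update s q false = s := by rw [← h, Function.update_eq_self]
      simp [h', add_comm]
    · have h' : Function.update s q true = s := by rw [← h, Function.update_eq_self]
      simp [h']
  rw [Finset.sum_congr rfl fun s _ => this s, Finset.sum_add_distrib, hflip, two_mul]

theorem sum_norm_sq_unitary {ι : Type*} [Fintype ι] [DecidableEq ι] (U : Matrix.unitaryGroup ι ℂ)
    (v : ι → ℂ) : ∑ a, ‖∑ b, (U : Matrix ι ι ℂ) a b * v b‖ ^ 2 = ∑ b, ‖v b‖ ^ 2 := by
  have key : ∀ w : ι → ℂ, ((∑ a, ‖w a‖ ^ 2 : ℝ) : ℂ) = star w ⬝ᵥ w := by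
    intro w
    simp [dotProduct, ← Complex.conj_mul']
  have h1 : star ((U : Matrix ι ι ℂ).mulVec v) ⬝ᵥ ((U : Matrix ι ι ℂ).mulVec v) = star v ⬝ᵥ v := by
    rw [Matrix.star_mulVec, ← Matrix.dotProduct_mulVec, Matrix.mulVec_mulVec,
      ← Matrix.star_eq_conjTranspose, Matrix.UnitaryGroup.star_mul_self, Matrix.one_mulVec]
  have h2 := key ((U : Matrix ι ι ℂ).mulVec v)
  rw [h1, ← key] at h2
  exact_mod_cast h2

/-- On the four strings that agree off `q₁` and `q₂` the gate acts as the unitary `U`, which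
preserves the norm of that fibre. Summing the fibres over all strings counts everything four times
on both sides. -/
theorem normSq_applyGate (U : Matrix.unitaryGroup (Bool × Bool) ℂ) {q₁ q₂ : Fin n} (hq : q₁ ≠ q₂)
    (ψ : QState n) : normSq (applyGate U q₁ q₂ ψ) = normSq ψ := by
  have h4 : ∀ f : Bits n → ℝ, ∑ s, ∑ a : Bool × Bool,
      f (Function.update (Function.update s q₁ a.1) q₂ a.2) = 4 * ∑ s, f s := by
    intro f
    simp only [Fintype.sum_prod_type]
    have := sum_update_bool q₁ fun s => ∑ v, f (Function.update s q₂ v)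
    rw [this, sum_update_bool]
    ring
  have h := h4 fun s => ‖applyGate U q₁ q₂ ψ s‖ ^ 2
  rw [normSq, normSq]
  have e : ∀ s : Bits n, ∑ a : Bool × Bool,
      ‖applyGate U q₁ q₂ ψ (Function.update (Function.update s q₁ a.1) q₂ a.2)‖ ^ 2
        = ∑ a : Bool × Bool, ‖ψ (Function.update (Function.update s q₁ a.1) q₂ a.2)‖ ^ 2 := by
    intro s
    rw [← sum_norm_sq_unitary U fun a : Bool × Bool =>
      ψ (Function.update (Function.update s q₁ a.1) q₂ a.2)]
    refine Finset.sum_congr rfl fun a _ => ?_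
    refine congrArg (fun x : ℂ => ‖x‖ ^ 2) (Finset.sum_congr rfl fun b _ => ?_)
    have hu : ∀ x y x' y', Function.update (Function.update (Function.update (Function.update
        s q₁ x) q₂ y) q₁ x') q₂ y' = Function.update (Function.update s q₁ x') q₂ y' := by
      intro x y x' y'
      rw [Function.update_comm hq.symm]
      simp
    rw [hu]
    simp [Function.update_of_ne hq]
  rw [Finset.sum_congr rfl fun s _ => e s, h4 fun s => ‖ψ s‖ ^ 2] at h
  linarith

theorem oracleMap_apply_out {b : ℕ} {idx : Fin d → Fin b → Fin n} {out : Fin m → Fin n}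
    (hout : Function.Injective out) (corner : EuclideanSpace ℝ (Fin d)) (h : ℝ) (s : Bits n)
    (j : Fin m) : oracleMap F idx out corner h s (out j) =
      xor (s (out j)) ((F (gridPoint idx corner h s)).getLsbD j) := by
  have hj : ∃ j', out j' = out j := ⟨j, rfl⟩
  rw [oracleMap, dif_pos hj, hout (Classical.choose_spec hj)]

theorem oracleMap_apply_of_ne {b : ℕ} {idx : Fin d → Fin b → Fin n} {out : Fin m → Fin n}
    (corner : EuclideanSpace ℝ (Fin d)) (h : ℝ) (s : Bits n) {q : Fin n} (hq : ∀ j, out j ≠ q) :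
    oracleMap F idx out corner h s q = s q := by
  rw [oracleMap, dif_neg (by simpa using hq)]

theorem gridPoint_oracleMap {b : ℕ} {idx : Fin d → Fin b → Fin n} {out : Fin m → Fin n}
    (hdisj : ∀ i k j, idx i k ≠ out j) (corner : EuclideanSpace ℝ (Fin d)) (h : ℝ) (s : Bits n) :
    gridPoint idx corner h (oracleMap F idx out corner h s) = gridPoint idx corner h s := by
  have : ∀ i k, oracleMap F idx out corner h s (idx i k) = s (idx i k) := fun i k =>
    oracleMap_apply_of_ne corner h s fun j => (hdisj i k j).symm
  simp only [gridPoint, this]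

/-- The index qubits are disjoint from the output qubits, so both applications read the same grid
point and XOR the same value. -/
theorem oracleMap_involutive {b : ℕ} {idx : Fin d → Fin b → Fin n} {out : Fin m → Fin n}
    (hout : Function.Injective out) (hdisj : ∀ i k j, idx i k ≠ out j)
    (corner : EuclideanSpace ℝ (Fin d)) (h : ℝ) :
    Function.Involutive (oracleMap F idx out corner h) := by
  intro s
  funext q
  by_cases hq : ∃ j, out j = q
  · obtain ⟨j, rfl⟩ := hq
    rw [oracleMap_apply_out hout, oracleMap_apply_out hout, gridPoint_oracleMap hdisj]
    simp
  · push Not at hq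
    rw [oracleMap_apply_of_ne _ _ _ hq, oracleMap_apply_of_ne _ _ _ hq]

theorem normSq_zeroState : normSq (zeroState n) = 1 := by
  simp [normSq, zeroState, apply_ite]

theorem normSq_smul (r : ℂ) (ψ : QState n) : normSq (fun s => r * ψ s) = ‖r‖ ^ 2 * normSq ψ := by
  simp [normSq, mul_pow, Finset.mul_sum]

theorem normSq_collapse_add (q : Fin n) (ψ : QState n) :
    normSq (collapse q false ψ) + normSq (collapse q true ψ) = normSq ψ := by
  simp only [normSq, collapse, ← Finset.sum_add_distrib]
  refine Finset.sum_congr rfl fun s _ => ?_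
  cases s q <;> simp

theorem sum_normSq_step (i : Instr d m n) (c : Config n) :
    ((step F X i c).map fun c' => normSq c'.st).sum = normSq c.st := by
  cases i with
  | fresh =>
    simp [step, normSq_smul, normSq_zeroState, Real.sq_sqrt (normSq_nonneg _)]
  | gate U q₁ q₂ hq => simpa [step] using normSq_applyGate U hq c.st
  | measure q dst => simpa [step] using normSq_collapse_add q c.st
  | query b idx out base sp hout hdisj =>
    simp only [step, List.map_cons, List.map_nil, List.sum_cons, List.sum_nil, add_zero, normSq]
    exact Fintype.sum_equiv (oracleMap_involutive hout hdisj _ _).toPerm _ _ fun s => rfl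
  | _ => simp [step]

theorem ev_normSq (P : Program d m n) (c : Config n) :
    ev F X P c (fun c' => normSq c'.st) = normSq c.st := by
  induction P generalizing c with
  | nil => simp [ev_nil]
  | cons i P ih => rw [ev_cons]; simp only [ih, sum_normSq_step]

/-! ### Frame rule -/

/-- The registers that an instruction may change. -/
def Instr.Writes : Instr d m n → ℕ → Prop
  | .const dst _, j => j = dst
  | .add dst _ _, j => j = dst
  | .sub dst _ _, j => j = dst
  | .mul dst _ _, j => j = dst
  | .select dst _ _ _ _, j => j = dst
  | .project base, j => base ≤ j ∧ j < base + d
  | .measure _ dst, j => j = dst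
  | _, _ => False

theorem step_mem_of_not_writes {i : Instr d m n} {c c' : Config n} (hc : c' ∈ step F X i c) {j : ℕ}
    (hj : ¬ i.Writes j) : c'.mem j = c.mem j := by
  cases i <;> simp only [step, List.mem_cons, List.not_mem_nil, or_false] at hc
  case measure =>
    rcases hc with rfl | rfl <;> simp only [Instr.Writes] at hj <;> simp [Function.update_of_ne hj]
  case project => subst hc; simp only [Instr.Writes] at hj; simp [writeVec, hj]
  all_goals subst hc; simp only [Instr.Writes] at hj; simp [Function.update_of_ne, hj]

theorem run_mem_of_not_writes {P : Program d m n} {c c' : Config n} (hc : c' ∈ run F X P c) {j : ℕ}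
    (hj : ∀ i ∈ P, ¬ i.Writes j) : c'.mem j = c.mem j := by
  induction P generalizing c with
  | nil => simp [run] at hc; rw [hc]
  | cons i P ih =>
    simp only [run, List.mem_flatMap] at hc
    obtain ⟨c₁, h₁, h₂⟩ := hc
    rw [ih h₂ fun i hi => hj i (List.mem_cons_of_mem _ hi),
      step_mem_of_not_writes h₁ (hj _ List.mem_cons_self)]

/-! ### Correctness triples -/

/-- Started with a memory in `I`, every branch of `P` ends with a memory in `J`. -/
def Ensures (F : EuclideanSpace ℝ (Fin d) → BitVec m) (X : Set (EuclideanSpace ℝ (Fin d)))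
    (I : Mem → Prop) (P : Program d m n) (J : Mem → Prop) : Prop :=
  ∀ c, I c.mem → ∀ c' ∈ run F X P c, J c'.mem

/-- Started with a memory in `I`, `P` ends with a memory in `J` with probability at least
`1 - ε`. -/
def Reaches (F : EuclideanSpace ℝ (Fin d) → BitVec m) (X : Set (EuclideanSpace ℝ (Fin d)))
    (I : Mem → Prop) (P : Program d m n) (J : Mem → Prop) (ε : ℝ) : Prop :=
  ∀ c, I c.mem → (1 - ε) * normSq c.st ≤ prob F X P c {μ | J μ}

theorem Ensures.seq {I J K : Mem → Prop} {P Q : Program d m n} (hP : Ensures F X I P J)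
    (hQ : Ensures F X J Q K) : Ensures F X I (P ++ Q) K := by
  intro c hc c' hc'
  rw [run_append, List.mem_flatMap] at hc'
  obtain ⟨c₁, h₁, h₂⟩ := hc'
  exact hQ c₁ (hP c hc c₁ h₁) c' h₂

theorem Ensures.nil {I : Mem → Prop} : Ensures F X I ([] : Program d m n) I := by
  intro c hc c' hc'
  simp [run] at hc'
  rwa [hc']

theorem Ensures.reaches {I J : Mem → Prop} {P : Program d m n} (h : Ensures F X I P J) :
    Reaches F X I P J 0 := by
  classical
  intro c hc
  rw [prob_eq_ev, sub_zero, one_mul, ← ev_normSq (F := F) (X := X) P c]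
  exact ev_mono fun c' hc' => by simp [h c hc c' hc']

/-- Branches in which `P` fails still have nonnegative weight and may be dropped; the rest is (1 -
ε₁)(1 - ε₂) ≥ 1 - ε₁ - ε₂. -/
theorem Reaches.seq {I J K : Mem → Prop} {P Q : Program d m n} {ε₁ ε₂ : ℝ} (h₁ : 0 ≤ ε₁)
    (h₂ : 0 ≤ ε₂) (hP : Reaches F X I P J ε₁) (hQ : Reaches F X J Q K ε₂) :
    Reaches F X I (P ++ Q) K (ε₁ + ε₂) := by
  classical
  intro c hc
  have hN := normSq_nonneg c.st
  rcases le_or_gt 1 ε₂ with h | h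
  -- For ε₂ ≥ 1 the claim is void; otherwise multiplying by 1 - ε₂ preserves inequalities.
  · exact le_trans (mul_nonpos_of_nonpos_of_nonneg (by linarith) hN) (prob_nonneg _ _ _)
  calc (1 - (ε₁ + ε₂)) * normSq c.st ≤ (1 - ε₂) * ((1 - ε₁) * normSq c.st) := by
        nlinarith [mul_nonneg (mul_nonneg h₁ h₂) hN]
    _ ≤ (1 - ε₂) * prob F X P c {μ | J μ} := by gcongr; exact hP c hc
    _ ≤ prob F X (P ++ Q) c {μ | K μ} := by
        rw [prob_eq_ev, prob_eq_ev, ev_append, ← ev_const_mul]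
        refine ev_mono fun c' _ => ?_
        split_ifs with hJ
        · exact hQ c' hJ
        · rw [mul_zero]; exact prob_nonneg _ _ _

theorem Reaches.mono {I J I' J' : Mem → Prop} {P : Program d m n} {ε ε' : ℝ}
    (h : Reaches F X I P J ε) (hI : ∀ μ, I' μ → I μ) (hJ : ∀ μ, J μ → J' μ) (hε : ε ≤ ε') :
    Reaches F X I' P J' ε' := by
  classical
  intro c hc
  refine le_trans (mul_le_mul_of_nonneg_right (by linarith) (normSq_nonneg _))
    (le_trans (h c (hI _ hc)) ?_)
  rw [prob_eq_ev, prob_eq_ev]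
  refine ev_mono fun c' _ => ?_
  by_cases h1 : J c'.mem
  · simp [h1, hJ _ h1]
  · simp only [Set.mem_ofPred_eq, h1, if_false]
    split_ifs
    exacts [normSq_nonneg _, le_rfl]

/-- A postcondition that holds on every branch may be added to one that holds with high
probability. -/
theorem Reaches.and {I J J' : Mem → Prop} {P : Program d m n} {ε : ℝ} (h : Reaches F X I P J ε)
    (h' : Ensures F X I P J') : Reaches F X I P (fun μ => J μ ∧ J' μ) ε := by
  classical
  intro c hc
  refine le_trans (h c hc) ?_
  rw [prob_eq_ev, prob_eq_ev]
  refine ev_mono fun c' hc' => ?_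
  simp only [Set.mem_ofPred_eq, h' c hc c' hc', and_true]
  exact le_rfl

/-- Union bound: a family of events, each of which fails with expected weight at most `ε`. -/
theorem reaches_of_forall_expect {ι : Type*} (t : Finset ι) {I J : Mem → Prop} {P : Program d m n}
    {ε : ℝ} (w : ι → Mem → ℝ) (hw : ∀ i μ, 0 ≤ w i μ)
    (hJ : ∀ c, I c.mem → ∀ c' ∈ run F X P c, ¬ J c'.mem → ∃ i ∈ t, 1 ≤ w i c'.mem)
    (hε : ∀ i ∈ t, ∀ c, I c.mem →
      ev F X P c (fun c' => w i c'.mem * normSq c'.st) ≤ ε * normSq c.st) :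
    Reaches F X I P J (t.card * ε) := by
  classical
  intro c hc
  have h1 : ev F X P c (fun c' => ∑ i ∈ t, w i c'.mem * normSq c'.st)
      ≤ t.card * ε * normSq c.st := by
    rw [ev_sum, mul_assoc, ← nsmul_eq_mul]
    exact Finset.sum_le_card_nsmul _ _ _ fun i hi => hε i hi c hc
  have h2 : normSq c.st ≤ prob F X P c {μ | J μ}
      + ev F X P c (fun c' => ∑ i ∈ t, w i c'.mem * normSq c'.st) := by
    rw [prob_eq_ev, ← ev_add, ← ev_normSq (F := F) (X := X) P c]
    refine ev_mono fun c' hc' => ?_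
    have hN := normSq_nonneg c'.st
    have hs : ∀ i ∈ t, 0 ≤ w i c'.mem * normSq c'.st := fun i _ => mul_nonneg (hw i _) hN
    by_cases hj : J c'.mem
    · simpa [hj] using Finset.sum_nonneg hs
    · obtain ⟨i, hi, h⟩ := hJ c hc c' hc' hj
      have := Finset.single_le_sum hs hi
      simp only [Set.mem_ofPred_eq, hj, if_false, zero_add]
      nlinarith
  linarith

/-- Running the blocks `B i`, `i ∈ l`, one after the other establishes all `J i`, if `B i`
establishes `J i` from `I i` and does not disturb what belongs to the other indices. -/
theorem ensures_flatMap {ι : Type*} {l : List ι} (hl : l.Nodup) {B : ι → Program d m n}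
    {I J : ι → Mem → Prop} (hB : ∀ i ∈ l, Ensures F X (I i) (B i) (J i))
    (hI : ∀ i ∈ l, ∀ j ∈ l, i ≠ j → Ensures F X (I j) (B i) (I j))
    (hJ : ∀ i ∈ l, ∀ j ∈ l, i ≠ j → Ensures F X (J j) (B i) (J j)) :
    Ensures F X (fun μ => ∀ i ∈ l, I i μ) (l.flatMap B) (fun μ => ∀ i ∈ l, J i μ) := by
  -- Generalize to a suffix `l'` of pending blocks: finished indices satisfy `J`, pending ones still
  -- satisfy `I`.
  suffices h : ∀ l' : List ι, (∀ i ∈ l', i ∈ l) → l'.Nodup →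
      Ensures F X (fun μ => (∀ i ∈ l, i ∉ l' → J i μ) ∧ ∀ i ∈ l', I i μ) (l'.flatMap B)
        (fun μ => ∀ i ∈ l, J i μ) by
    intro c hc
    exact h l (fun _ h => h) hl c ⟨fun i hi hi' => absurd hi hi', hc⟩
  intro l' hl' hn
  induction l' with
  | nil =>
    intro c hc c' hc'
    simp only [List.flatMap_nil, run, List.mem_singleton] at hc'
    subst hc'
    simpa using hc.1
  | cons a l' ih =>
    rw [List.nodup_cons] at hn
    rw [List.flatMap_cons]
    refine Ensures.seq ?_ (ih (fun i hi => hl' i (List.mem_cons_of_mem _ hi)) hn.2)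
    intro c hc c' hc'
    have ha := hl' a List.mem_cons_self
    refine ⟨fun i hi hil => ?_, fun i hi => ?_⟩
    · by_cases hia : i = a
      · subst hia; exact hB i ha c (hc.2 i List.mem_cons_self) c' hc'
      · exact hJ a ha i hi (Ne.symm hia) c (hc.1 i hi (by simp [hia, hil])) c' hc'
    · have : a ≠ i := by rintro rfl; exact hn.1 hi
      exact hI a ha i (hl' i (List.mem_cons_of_mem _ hi)) this c
        (hc.2 i (List.mem_cons_of_mem _ hi)) c' hc'

end Calculus

/-! ### Convex functions -/

section ConvexFunctions

variable {d : ℕ} {f : EuclideanSpace ℝ (Fin d) → ℝ} {G : ℝ}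

/-- Hahn-Banach separates the point (z, f z) from the open strict epigraph; the separating
functional is not vertical, and normalizing its vertical part gives the slope. -/
theorem exists_subgradient (hf : ConvexOn ℝ Set.univ f) (hc : Continuous f)
    (z : EuclideanSpace ℝ (Fin d)) : ∃ g, ∀ q, f z + inner ℝ g (q - z) ≤ f q := by
  have hopen : IsOpen {p : EuclideanSpace ℝ (Fin d) × ℝ | p.1 ∈ Set.univ ∧ f p.1 < p.2} := by
    simpa using isOpen_lt (hc.comp continuous_fst) continuous_snd
  obtain ⟨φ, hφ⟩ := geometric_hahn_banach_open_point hf.convex_strict_epigraph hopen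
    (x := (z, f z)) (by simp)
  have hdec : ∀ x t, φ (x, t) = φ (x, 0) + t * φ (0, 1) := by
    intro x t
    have : ((x, t) : EuclideanSpace ℝ (Fin d) × ℝ) = (x, 0) + t • (0, 1) := by simp
    rw [this, map_add, map_smul, smul_eq_mul]
  have hβ : φ (0, 1) < 0 := by
    have := hφ (z, f z + 1) (by simp)
    rw [hdec, hdec z (f z)] at this
    linarith
  -- The separation is strict only above the graph; letting the height e/(-φ(0,1)) above the graph
  -- tend to zero extends it to the graph.
  have hle : ∀ q, φ (q, 0) + f q * φ (0, 1) ≤ φ (z, 0) + f z * φ (0, 1) := by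
    intro q
    refine le_of_forall_pos_le_add fun e he => ?_
    have := hφ (q, f q + e / (-φ (0, 1))) (by simp; exact div_pos he (by linarith))
    rw [hdec, hdec z (f z)] at this
    have h2 : e / (-φ (0, 1)) * φ (0, 1) = -e := by
      rw [div_neg, neg_mul, div_mul_cancel₀ _ hβ.ne]
    linarith
  let l : StrongDual ℝ (EuclideanSpace ℝ (Fin d)) := φ.comp (ContinuousLinearMap.inl ℝ _ ℝ)
  let g := (InnerProductSpace.toDual ℝ (EuclideanSpace ℝ (Fin d))).symm l
  refine ⟨(-φ (0, 1))⁻¹ • g, fun q => ?_⟩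
  have hl : ∀ v, inner ℝ g v = φ (v, 0) := by
    intro v
    simp [g, l]
  have hsub : φ (q - z, 0) = φ (q, 0) - φ (z, 0) := by rw [← map_sub]; simp
  rw [real_inner_smul_left, hl, hsub]
  have := hle q
  have hpos : 0 < -φ (0, 1) := by linarith
  have h3 : (-φ (0, 1))⁻¹ * (φ (q, 0) - φ (z, 0)) ≤ (-φ (0, 1))⁻¹ * ((f q - f z) * -φ (0, 1)) := by
    gcongr
    linarith
  rw [show (-φ (0, 1))⁻¹ * ((f q - f z) * -φ (0, 1)) = f q - f z by
    rw [mul_comm, mul_assoc, mul_inv_cancel₀ hpos.ne', mul_one]] at h3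
  linarith

theorem sub_le_of_lipschitz (hG : 0 < G) (hf : LipschitzWith G.toNNReal f)
    (x y : EuclideanSpace ℝ (Fin d)) : f x - f y ≤ G * ‖x - y‖ := by
  have := hf.dist_le_mul x y
  rw [Real.dist_eq, dist_eq_norm, Real.coe_toNNReal _ hG.le] at this
  exact le_trans (le_abs_self _) this

theorem abs_subgradient_le (hG : 0 < G) (hf : LipschitzWith G.toNNReal f)
    {z g : EuclideanSpace ℝ (Fin d)} (hg : ∀ q, f z + inner ℝ g (q - z) ≤ f q) (i : Fin d) :
    |g i| ≤ G := by
  have key : ∀ t : ℝ, |t| = 1 → t * g i ≤ G := by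
    intro t ht
    have h1 := hg (z + EuclideanSpace.single i t)
    have h2 := sub_le_of_lipschitz hG hf (z + EuclideanSpace.single i t) z
    rw [add_sub_cancel_left] at h1 h2
    rw [PiLp.norm_single, Real.norm_eq_abs, ht] at h2
    rw [EuclideanSpace.inner_single_right] at h1
    simp at h1
    linarith
  have h1 := key 1 (by simp)
  have h2 := key (-1) (by simp)
  rw [abs_le]
  constructor <;> linarith

/-- Second difference of `f` at `z` in the `i`-th coordinate direction. -/
def secDiff (f : EuclideanSpace ℝ (Fin d) → ℝ) (h : ℝ) (i : Fin d) (z : EuclideanSpace ℝ (Fin d)) :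
    ℝ :=
  f (z + EuclideanSpace.single i h) + f (z - EuclideanSpace.single i h) - 2 * f z

/-- On a small cube with corner `z` a convex function is close to linear if its second differences
at `z` are small. -/
theorem linearization_error_le (hf : ConvexOn ℝ Set.univ f) {z g : EuclideanSpace ℝ (Fin d)}
    (hg : ∀ q, f z + inner ℝ g (q - z) ≤ f q) (hd : 0 < d) {h : ℝ} (hh : 0 < h)
    (a : EuclideanSpace ℝ (Fin d)) (ha : ∀ i, 0 ≤ a i) (ha' : ∀ i, d * a i ≤ h) :
    f (z + a) - f z - inner ℝ g a ≤ (1 / d) * ∑ i, secDiff f h i z := by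
  have hd' : (0 : ℝ) < d := by exact_mod_cast hd
  -- The point z + a is the barycentre of points on the coordinate axes through z. This is why the
  -- cube must be smaller than h by a factor d.
  let y : Fin d → EuclideanSpace ℝ (Fin d) := fun i => z + EuclideanSpace.single i (d * a i)
  have hy : z + a = ∑ i, (1 / d : ℝ) • y i := by
    ext j
    simp only [y, PiLp.add_apply, WithLp.ofLp_sum, Finset.sum_apply, PiLp.smul_apply, smul_eq_mul,
      mul_add, Finset.sum_add_distrib, PiLp.single_apply, mul_ite, mul_zero]
    simp
    field_simp
  have h1 : f (z + a) ≤ ∑ i, (1 / d : ℝ) • f (y i) := by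
    rw [hy]
    refine hf.map_sum_le (fun _ _ => by positivity) ?_ fun _ _ => Set.mem_univ _
    simp
    field_simp
  -- Interpolate between z and z + h eᵢ. The increment of `f` up to the latter exceeds h gᵢ by at
  -- most the second difference, because f(z - h eᵢ) ≥ f z - h gᵢ.
  have h2 : ∀ i, f (y i) ≤ f z + d * a i * g i + secDiff f h i z := by
    intro i
    have hp := hg (z + EuclideanSpace.single i h)
    have hm := hg (z - EuclideanSpace.single i h)
    rw [add_sub_cancel_left, EuclideanSpace.inner_single_right] at hp
    rw [sub_sub_cancel_left, inner_neg_right, EuclideanSpace.inner_single_right] at hm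
    simp at hp hm
    have hyi : y i = (1 - d * a i / h) • z + (d * a i / h) • (z + EuclideanSpace.single i h) := by
      ext j
      by_cases hj : j = i
      · subst hj; simp [y]; field_simp; ring
      · simp [y, hj]; ring
    have hl0 : 0 ≤ d * a i / h := div_nonneg (mul_nonneg hd'.le (ha i)) hh.le
    have hl1 : d * a i / h ≤ 1 := (div_le_one hh).2 (ha' i)
    have hconv : f (y i) ≤ (1 - d * a i / h) • f z
        + (d * a i / h) • f (z + EuclideanSpace.single i h) := by
      rw [hyi]
      exact hf.2 (Set.mem_univ _) (Set.mem_univ _) (by linarith) hl0 (by ring)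
    simp only [smul_eq_mul] at hconv
    have e : d * a i * g i = d * a i / h * (h * g i) := by field_simp
    rw [e]
    unfold secDiff
    nlinarith
  have h3 : ∑ i, (1 / d : ℝ) • f (y i)
      ≤ ∑ i, (1 / d : ℝ) * (f z + d * a i * g i + secDiff f h i z) :=
    Finset.sum_le_sum fun i _ => mul_le_mul_of_nonneg_left (h2 i) (by positivity)
  have h4 : ∑ i, (1 / d : ℝ) * (f z + d * a i * g i + secDiff f h i z)
      = f z + inner ℝ g a + (1 / d) * ∑ i, secDiff f h i z := by
    rw [← Finset.mul_sum, Finset.sum_add_distrib, Finset.sum_add_distrib]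
    have : inner ℝ g a = ∑ i, a i * g i := by
      simp [PiLp.inner_apply]
    rw [this, mul_add, mul_add]
    simp only [mul_assoc, ← Finset.mul_sum]
    simp
    field_simp
  linarith

/-! ### Averages over a grid -/

/-- Average of `Φ` over the points that arise from `z` by adding multiples `0, …, N - 1` of `h` to
the coordinates listed in `l`. -/
def gridAvg (N : ℕ) (h : ℝ) : List (Fin d) → (EuclideanSpace ℝ (Fin d) → ℝ) →
    EuclideanSpace ℝ (Fin d) → ℝ
  | [], Φ, z => Φ z
  | i :: l, Φ, z =>
      (1 / N : ℝ) * ∑ v ∈ Finset.range N, gridAvg N h l Φ (z + EuclideanSpace.single i (h * v))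

variable {N : ℕ} {h : ℝ}

theorem gridAvg_translate (l : List (Fin d)) (Φ : EuclideanSpace ℝ (Fin d) → ℝ)
    (w z : EuclideanSpace ℝ (Fin d)) :
    gridAvg N h l (fun y => Φ (y + w)) z = gridAvg N h l Φ (z + w) := by
  induction l generalizing z with
  | nil => rfl
  | cons i l ih => simp only [gridAvg, ih, add_right_comm]

theorem gridAvg_add (l : List (Fin d)) (Φ Ψ : EuclideanSpace ℝ (Fin d) → ℝ)
    (z : EuclideanSpace ℝ (Fin d)) :
    gridAvg N h l (fun y => Φ y + Ψ y) z = gridAvg N h l Φ z + gridAvg N h l Ψ z := by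
  induction l generalizing z with
  | nil => rfl
  | cons i l ih => simp only [gridAvg, ih, Finset.sum_add_distrib, mul_add]

theorem gridAvg_const_mul (l : List (Fin d)) (r : ℝ) (Φ : EuclideanSpace ℝ (Fin d) → ℝ)
    (z : EuclideanSpace ℝ (Fin d)) :
    gridAvg N h l (fun y => r * Φ y) z = r * gridAvg N h l Φ z := by
  induction l generalizing z with
  | nil => rfl
  | cons i l ih => simp only [gridAvg, ih, ← Finset.mul_sum]; ring

theorem gridAvg_sum {ι : Type*} (t : Finset ι) (l : List (Fin d))
    (Φ : ι → EuclideanSpace ℝ (Fin d) → ℝ) (z : EuclideanSpace ℝ (Fin d)) :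
    gridAvg N h l (fun y => ∑ i ∈ t, Φ i y) z = ∑ i ∈ t, gridAvg N h l (Φ i) z := by
  induction l generalizing z with
  | nil => rfl
  | cons i l ih => simp only [gridAvg, ih, ← Finset.mul_sum]; rw [Finset.sum_comm]

theorem one_div_mul_sum_range_le (hN : 0 < N) {u : ℕ → ℝ} {B : ℝ} (hu : ∀ v, u v ≤ B) :
    (1 / N : ℝ) * ∑ v ∈ Finset.range N, u v ≤ B := by
  have hN' : (0 : ℝ) < N := by exact_mod_cast hN
  have := Finset.sum_le_card_nsmul (Finset.range N) u B fun v _ => hu v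
  rw [Finset.card_range, nsmul_eq_mul] at this
  rw [one_div, inv_mul_le_iff₀ hN']
  exact this

theorem gridAvg_le (hN : 0 < N) (l : List (Fin d)) {Φ : EuclideanSpace ℝ (Fin d) → ℝ} {B : ℝ}
    (hΦ : ∀ y, Φ y ≤ B) (z : EuclideanSpace ℝ (Fin d)) : gridAvg N h l Φ z ≤ B := by
  induction l generalizing z with
  | nil => exact hΦ z
  | cons i l ih => exact one_div_mul_sum_range_le hN fun v => ih _

/-- The difference is the average of increments of `f` along one fixed vector, so the Lipschitz
bound survives averaging. -/
theorem gridAvg_sub_le (hN : 0 < N) (hG : 0 < G) (hf : LipschitzWith G.toNNReal f)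
    (l : List (Fin d)) (y z : EuclideanSpace ℝ (Fin d)) :
    gridAvg N h l f y - gridAvg N h l f z ≤ G * ‖y - z‖ := by
  have h1 : gridAvg N h l f y = gridAvg N h l (fun w => f (w + (y - z))) z := by
    rw [gridAvg_translate, add_sub_cancel]
  have h2 : gridAvg N h l (fun w => f (w + (y - z)) + -1 * f w) z
      = gridAvg N h l f y - gridAvg N h l f z := by
    rw [gridAvg_add, gridAvg_const_mul, h1]; ring
  rw [← h2]
  refine gridAvg_le hN l (fun w => ?_) z
  have := sub_le_of_lipschitz hG hf (w + (y - z)) w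
  rw [add_sub_cancel_left] at this
  linarith

theorem sum_range_secDiff (u : ℕ → ℝ) (N : ℕ) :
    ∑ v ∈ Finset.range N, (u (v + 2) + u v - 2 * u (v + 1)) = u (N + 1) - u N - (u 1 - u 0) := by
  induction N with
  | zero => simp
  | succ N ih => rw [Finset.sum_range_succ, ih]; ring

/-- The mean second difference over a grid is small, by telescoping. -/
theorem gridAvg_secDiff_le (hN : 0 < N) (hG : 0 < G) (hf : LipschitzWith G.toNNReal f)
    (hh : 0 < h) {i : Fin d} {l : List (Fin d)} (hi : i ∈ l) (z : EuclideanSpace ℝ (Fin d)) :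
    gridAvg N h l (secDiff f h i) z ≤ 2 * G * h / N := by
  have hN' : (0 : ℝ) < N := by exact_mod_cast hN
  induction l generalizing z with
  | nil => simp at hi
  | cons j l ih =>
    by_cases hij : i ∈ l
    · exact one_div_mul_sum_range_le hN fun v => ih hij _
    · have : i = j := by simpa [hij] using hi
      subst this
      -- Averaging over the other coordinates commutes with translations, hence with second
      -- differences; what remains is a one-dimensional sum that telescopes.
      have hsec : ∀ y, gridAvg N h l (secDiff f h i) y = secDiff (gridAvg N h l f) h i y := by
        intro y
        have : secDiff f h i = fun y => (f (y + EuclideanSpace.single i h)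
            + f (y + -EuclideanSpace.single i h)) + (-2) * f y := by
          funext y; rw [secDiff, sub_eq_add_neg y]; ring
        rw [this, gridAvg_add, gridAvg_add, gridAvg_const_mul, gridAvg_translate,
          gridAvg_translate, secDiff, sub_eq_add_neg y]
        ring
      simp only [gridAvg, hsec]
      -- The index is shifted by one so that the left neighbour of the grid is `u 0`.
      let u : ℕ → ℝ := fun v => gridAvg N h l f (z + EuclideanSpace.single i (h * (v - 1)))
      have hs : ∀ a b : ℝ, (EuclideanSpace.single i a : EuclideanSpace ℝ (Fin d))
          + EuclideanSpace.single i b = EuclideanSpace.single i (a + b) := by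
        intro a b
        ext k; by_cases hk : k = i
        · subst hk; simp
        · simp [hk]
      have hs' : ∀ a b : ℝ, (EuclideanSpace.single i a : EuclideanSpace ℝ (Fin d))
          - EuclideanSpace.single i b = EuclideanSpace.single i (a - b) := by
        intro a b
        ext k; by_cases hk : k = i
        · subst hk; simp
        · simp [hk]
      have hu : ∀ v : ℕ, secDiff (gridAvg N h l f) h i (z + EuclideanSpace.single i (h * v))
          = u (v + 2) + u v - 2 * u (v + 1) := by
        intro v
        simp only [secDiff, u, add_assoc, hs, add_sub_assoc, hs']
        push_cast
        ring_nf
      rw [Finset.sum_congr rfl fun v _ => hu v, sum_range_secDiff]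
      have hb : ∀ v w : ℕ, |(v : ℝ) - w| = 1 → u v - u w ≤ G * h := by
        intro v w hvw
        refine (gridAvg_sub_le hN hG hf l _ _).trans (le_of_eq ?_)
        rw [add_sub_add_left_eq_sub, hs', PiLp.norm_single, Real.norm_eq_abs,
          show h * ((v : ℝ) - 1) - h * (w - 1) = h * (v - w) by ring, abs_mul, hvw, abs_of_pos hh,
          mul_one]
      have h1 := hb (N + 1) N (by simp)
      have h2 := hb 0 1 (by simp)
      rw [one_div, inv_mul_le_iff₀ hN', mul_div_cancel₀ _ hN'.ne']
      linarith

/-- Midpoint convexity. Nonnegativity is what makes Markov's inequality applicable to the second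
differences at a random point. -/
theorem secDiff_nonneg (hf : ConvexOn ℝ Set.univ f) (h : ℝ) (i : Fin d)
    (z : EuclideanSpace ℝ (Fin d)) : 0 ≤ secDiff f h i z := by
  have := hf.2 (Set.mem_univ (z + EuclideanSpace.single i h))
    (Set.mem_univ (z - EuclideanSpace.single i h)) (by norm_num : (0 : ℝ) ≤ 1 / 2)
    (by norm_num : (0 : ℝ) ≤ 1 / 2) (by norm_num)
  have e : (1 / 2 : ℝ) • (z + EuclideanSpace.single i h)
      + (1 / 2 : ℝ) • (z - EuclideanSpace.single i h) = z := by
    rw [← smul_add, add_add_sub_cancel, ← two_smul ℝ z, smul_smul]; norm_num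
  rw [e] at this
  simp only [smul_eq_mul] at this
  unfold secDiff
  linarith

end ConvexFunctions

/-! ### One-qubit gates and product states -/

section Gates

open Complex

variable {n : ℕ}

/-- A one-qubit gate, as a two-qubit gate that ignores its second qubit. -/
def oneQubit (V : Matrix.unitaryGroup Bool ℂ) : Matrix.unitaryGroup (Bool × Bool) ℂ :=
  ⟨Matrix.kronecker (V : Matrix Bool Bool ℂ) (1 : Matrix Bool Bool ℂ),
    Matrix.kronecker_mem_unitary V.2 (one_mem _)⟩

theorem applyGate_oneQubit (V : Matrix.unitaryGroup Bool ℂ) {q₁ q₂ : Fin n} (hq : q₁ ≠ q₂)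
    (ψ : QState n) (s : Bits n) :
    applyGate (oneQubit V) q₁ q₂ ψ s
      = ∑ a, (V : Matrix Bool Bool ℂ) (s q₁) a * ψ (Function.update s q₁ a) := by
  have h : ∀ a, Function.update (Function.update s q₁ a) q₂ (s q₂) = Function.update s q₁ a := by
    intro a
    conv_lhs => rw [← Function.update_of_ne hq.symm a s]
    exact Function.update_eq_self _ _
  unfold applyGate oneQubit
  rw [Fintype.sum_prod_type]
  refine Finset.sum_congr rfl fun a _ => ?_
  rw [Finset.sum_eq_single (s q₂)]
  · simp [h]
  · intro b _ hb
    simp [Matrix.one_apply_ne hb.symm]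
  · simp

theorem applyGate_sub (U : Matrix (Bool × Bool) (Bool × Bool) ℂ) (q₁ q₂ : Fin n) (ψ φ : QState n) :
    applyGate U q₁ q₂ (ψ - φ) = applyGate U q₁ q₂ ψ - applyGate U q₁ q₂ φ := by
  funext s
  simp [applyGate, mul_sub, Finset.sum_sub_distrib]

/-- The Hadamard gate. -/
def hadamard : Matrix.unitaryGroup Bool ℂ :=
  ⟨Matrix.of fun a b => ((√2 : ℝ) : ℂ)⁻¹ * if a && b then -1 else 1, by
    have h2 : ((√2 : ℝ) : ℂ) * ((√2 : ℝ) : ℂ) = 2 := by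
      rw [← ofReal_mul, Real.mul_self_sqrt (by norm_num)]; norm_num
    have h3 : (((√2 : ℝ) : ℂ))⁻¹ * (((√2 : ℝ) : ℂ))⁻¹ = 1 / 2 := by
      rw [← mul_inv, h2, one_div]
    rw [Matrix.mem_unitaryGroup_iff]
    ext a b
    cases a <;> cases b <;> (simp [Matrix.mul_apply, h3]; try norm_num)⟩

/-- The Hadamard gate after the phase gate `diag (1, -i)`: a measurement after this gate is one in
the eigenbasis of the Pauli matrix `Y`. -/
def hadamardY : Matrix.unitaryGroup Bool ℂ :=
  ⟨Matrix.of fun a b => ((√2 : ℝ) : ℂ)⁻¹ * if b then (if a then I else -I) else 1, by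
    have h2 : ((√2 : ℝ) : ℂ) * ((√2 : ℝ) : ℂ) = 2 := by
      rw [← ofReal_mul, Real.mul_self_sqrt (by norm_num)]; norm_num
    have h3 : (((√2 : ℝ) : ℂ))⁻¹ * (((√2 : ℝ) : ℂ))⁻¹ = 1 / 2 := by
      rw [← mul_inv, h2, one_div]
    rw [Matrix.mem_unitaryGroup_iff]
    ext a b
    have h4 : ∀ x y : ℂ, (((√2 : ℝ) : ℂ))⁻¹ * x * ((((√2 : ℝ) : ℂ))⁻¹ * y) = 1 / 2 * (x * y) := by
      intro x y; rw [← h3]; ring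
    cases a <;> cases b <;> simp [Matrix.mul_apply, h3, h4] <;> norm_num⟩

/-- The phase gate `diag (1, exp (iγ))`. -/
def phaseGate (γ : ℝ) : Matrix.unitaryGroup Bool ℂ :=
  ⟨Matrix.diagonal fun a => if a then exp (I * γ) else 1, by
    rw [Matrix.mem_unitaryGroup_iff, Matrix.star_eq_conjTranspose, Matrix.diagonal_conjTranspose,
      Matrix.diagonal_mul_diagonal, ← Matrix.diagonal_one]
    congr 1
    funext a
    cases a
    · simp
    · simp [← exp_conj, ← exp_add]⟩

theorem applyGate_phaseGate (γ : ℝ) {q₁ q₂ : Fin n} (hq : q₁ ≠ q₂) (ψ : QState n) (s : Bits n) :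
    applyGate (oneQubit (phaseGate γ)) q₁ q₂ ψ s
      = exp (I * ((if s q₁ then γ else 0 : ℝ) : ℂ)) * ψ s := by
  rw [applyGate_oneQubit _ hq]
  have h' : ∀ b, s q₁ = b → Function.update s q₁ b = s := by
    rintro b rfl; exact Function.update_eq_self _ _
  cases h : s q₁ <;> simp [phaseGate, Matrix.diagonal, h' _ h]

/-- The product of the one-qubit states `χ q`. -/
def prodState (χ : Fin n → Bool → ℂ) : QState n := fun s => ∏ q, χ q (s q)

theorem zeroState_eq_prodState : zeroState n = prodState fun _ v => if v then 0 else 1 := by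
  funext s
  unfold zeroState prodState
  split_ifs with h
  · simp [h]
  · obtain ⟨q, hq⟩ : ∃ q, s q ≠ false := by
      by_contra! h'; exact h (funext h')
    exact (Finset.prod_eq_zero (Finset.mem_univ q) (by simpa using hq)).symm

theorem applyGate_prodState (V : Matrix.unitaryGroup Bool ℂ) {q₁ q₂ : Fin n} (hq : q₁ ≠ q₂)
    (r : ℂ) (χ : Fin n → Bool → ℂ) :
    applyGate (oneQubit V) q₁ q₂ (fun s => r * prodState χ s) = fun s => r * prodState
      (Function.update χ q₁ fun v => ∑ a, (V : Matrix Bool Bool ℂ) v a * χ q₁ a) s := by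
  funext s
  rw [applyGate_oneQubit V hq]
  unfold prodState
  have h1 : ∀ a, ∏ q, χ q (Function.update s q₁ a q)
      = χ q₁ a * ∏ q ∈ Finset.univ.erase q₁, χ q (s q) := by
    intro a
    rw [← Finset.mul_prod_erase _ _ (Finset.mem_univ q₁), Function.update_self]
    congr 1
    refine Finset.prod_congr rfl fun q hq => ?_
    rw [Function.update_of_ne (Finset.ne_of_mem_erase hq)]
  rw [← Finset.mul_prod_erase _ _ (Finset.mem_univ q₁), Function.update_self]
  have h2 : ∏ q ∈ Finset.univ.erase q₁, Function.update χ q₁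
      (fun v => ∑ a, (V : Matrix Bool Bool ℂ) v a * χ q₁ a) q (s q)
        = ∏ q ∈ Finset.univ.erase q₁, χ q (s q) := by
    refine Finset.prod_congr rfl fun q hq => ?_
    rw [Function.update_of_ne (Finset.ne_of_mem_erase hq)]
  rw [h2, Finset.sum_mul, Finset.mul_sum]
  refine Finset.sum_congr rfl fun a _ => ?_
  rw [h1]
  ring

/-- Marginal distribution of a qubit in a product state of unit vectors. -/
theorem sum_ite_norm_prodState (χ : Fin n → Bool → ℂ) (hχ : ∀ q, ∑ v, ‖χ q v‖ ^ 2 = 1)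
    (q₀ : Fin n) :
    ∑ s, (if s q₀ then ‖prodState χ s‖ ^ 2 else 0) = ‖χ q₀ true‖ ^ 2 := by
  -- The indicator of the outcome is absorbed into the factor of `q₀`, so that the sum of products
  -- becomes a product of sums.
  let w : Fin n → Bool → ℝ := fun q v =>
    if q = q₀ then (if v then ‖χ q v‖ ^ 2 else 0) else ‖χ q v‖ ^ 2
  have h1 : ∀ s : Bits n, (if s q₀ then ‖prodState χ s‖ ^ 2 else 0) = ∏ q, w q (s q) := by
    intro s
    rw [← Finset.mul_prod_erase _ _ (Finset.mem_univ q₀)]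
    have : ∏ q ∈ Finset.univ.erase q₀, w q (s q)
        = ∏ q ∈ Finset.univ.erase q₀, ‖χ q (s q)‖ ^ 2 := by
      refine Finset.prod_congr rfl fun q hq => ?_
      simp [w, Finset.ne_of_mem_erase hq]
    rw [this, prodState, norm_prod, ← Finset.prod_pow,
      ← Finset.mul_prod_erase _ _ (Finset.mem_univ q₀)]
    cases h : s q₀ <;> simp [w]
  rw [Finset.sum_congr rfl fun s _ => h1 s, ← Fintype.prod_sum,
    ← Finset.mul_prod_erase _ _ (Finset.mem_univ q₀), Finset.prod_eq_one, mul_one]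
  · simp [w]
  · intro q hq
    rw [← hχ q]
    simp [w, Finset.ne_of_mem_erase hq]

theorem normSq_prodState (χ : Fin n → Bool → ℂ) (hχ : ∀ q, ∑ v, ‖χ q v‖ ^ 2 = 1) :
    normSq (prodState χ) = 1 := by
  have h1 : ∀ s : Bits n, ‖prodState χ s‖ ^ 2 = ∏ q, ‖χ q (s q)‖ ^ 2 := by
    intro s
    rw [prodState, norm_prod, ← Finset.prod_pow]
  rw [normSq, Finset.sum_congr rfl fun s _ => h1 s,
    ← Fintype.prod_sum (f := fun q v => ‖χ q v‖ ^ 2)]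
  exact Finset.prod_eq_one fun q _ => hχ q

/-- Close states have close measurement statistics. -/
theorem abs_sum_ite_sub_le (S : Bits n → Prop) [DecidablePred S] {ψ φ : QState n} {N κ : ℝ}
    (hκ : 0 < κ) (hψ : normSq ψ ≤ N) (hφ : normSq φ ≤ N)
    (h : normSq (ψ - φ) ≤ κ ^ 2 * N) :
    |∑ s, (if S s then ‖ψ s‖ ^ 2 else 0) - ∑ s, (if S s then ‖φ s‖ ^ 2 else 0)| ≤ 2 * κ * N := by
  rw [← Finset.sum_sub_distrib]
  refine (Finset.abs_sum_le_sum_abs _ _).trans ?_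
  -- The difference of squares is at most e(a + b), where a and b are the two norms and e is the
  -- norm of the difference; weighted AM-GM splits this into e²/κ + κ(a² + b²)/2. Each part
  -- contributes κN after summation.
  have hpt : ∀ s, |(if S s then ‖ψ s‖ ^ 2 else 0) - (if S s then ‖φ s‖ ^ 2 else 0)|
      ≤ κ⁻¹ * ‖(ψ - φ) s‖ ^ 2 + κ / 2 * (‖ψ s‖ ^ 2 + ‖φ s‖ ^ 2) := by
    intro s
    split_ifs
    · have h1 : |‖ψ s‖ - ‖φ s‖| ≤ ‖(ψ - φ) s‖ := abs_norm_sub_norm_le _ _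
      have h2 : |‖ψ s‖ ^ 2 - ‖φ s‖ ^ 2| = |‖ψ s‖ - ‖φ s‖| * (‖ψ s‖ + ‖φ s‖) := by
        rw [← abs_of_nonneg (add_nonneg (norm_nonneg (ψ s)) (norm_nonneg (φ s))), ← abs_mul]
        ring_nf
      rw [h2]
      set a := ‖ψ s‖
      set b := ‖φ s‖
      set e := ‖(ψ - φ) s‖
      have ha : 0 ≤ a := norm_nonneg _
      have hb : 0 ≤ b := norm_nonneg _
      have h3 : |a - b| * (a + b) ≤ e * (a + b) := by gcongr
      have h4 : κ⁻¹ * e ^ 2 = κ * (κ⁻¹ * e) ^ 2 := by field_simp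
      have h5 : e * (a + b) = κ * ((κ⁻¹ * e) * (a + b)) := by field_simp
      rw [h4]
      rw [h5] at h3
      refine h3.trans ?_
      have : κ⁻¹ * e * (a + b) ≤ (κ⁻¹ * e) ^ 2 + 1 / 2 * (a ^ 2 + b ^ 2) := by
        nlinarith [sq_nonneg (κ⁻¹ * e - (a + b) / 2), sq_nonneg (a - b)]
      nlinarith
    · simp; positivity
  refine (Finset.sum_le_sum fun s _ => hpt s).trans ?_
  rw [Finset.sum_add_distrib, ← Finset.mul_sum, ← Finset.mul_sum, Finset.sum_add_distrib]
  change κ⁻¹ * normSq (ψ - φ) + κ / 2 * (normSq ψ + normSq φ) ≤ _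
  have h6 : κ⁻¹ * normSq (ψ - φ) ≤ κ⁻¹ * (κ ^ 2 * N) := by gcongr
  have h7 : κ⁻¹ * (κ ^ 2 * N) = κ * N := by field_simp
  nlinarith

theorem norm_exp_I_mul_sub_le (a b : ℝ) : ‖exp (I * a) - exp (I * b)‖ ≤ |a - b| := by
  have : exp (I * a) - exp (I * b) = exp (I * b) * (exp (I * ((a - b : ℝ) : ℂ)) - 1) := by
    rw [mul_sub, ← exp_add]; push_cast; ring_nf
  rw [this, norm_mul, mul_comm I, norm_exp_ofReal_mul_I, one_mul]
  exact Real.norm_exp_I_mul_ofReal_sub_one_le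

/-- The amplitude is (1 - exp(iα))/2. The cosine alone does not determine the sign of α, which is
why `norm_sq_hadamardY` supplies the sine. -/
theorem norm_sq_hadamard (α : ℝ) :
    ‖∑ a, (hadamard : Matrix Bool Bool ℂ) true a
      * (((√2 : ℝ) : ℂ)⁻¹ * exp (I * ((if a then α else 0 : ℝ) : ℂ)))‖ ^ 2
        = (1 - Real.cos α) / 2 := by
  have h2 : (√2)⁻¹ * (√2)⁻¹ = (1 / 2 : ℝ) := by
    rw [← mul_inv, Real.mul_self_sqrt (by norm_num), one_div]
  have h : ∑ a, (hadamard : Matrix Bool Bool ℂ) true a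
      * (((√2 : ℝ) : ℂ)⁻¹ * exp (I * ((if a then α else 0 : ℝ) : ℂ)))
      = (((√2)⁻¹ * (√2)⁻¹ : ℝ) : ℂ) * (1 - exp (I * α)) := by
    simp [hadamard]; ring
  rw [h, h2, mul_comm I, exp_mul_I, ← ofReal_cos, ← ofReal_sin, ← normSq_eq_norm_sq,
    normSq_apply]
  simp
  rw [cos_ofReal_re, sin_ofReal_re]
  nlinarith [Real.sin_sq_add_cos_sq α]

theorem norm_sq_hadamardY (α : ℝ) :
    ‖∑ a, (hadamardY : Matrix Bool Bool ℂ) true a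
      * (((√2 : ℝ) : ℂ)⁻¹ * exp (I * ((if a then α else 0 : ℝ) : ℂ)))‖ ^ 2
        = (1 - Real.sin α) / 2 := by
  have h2 : (√2)⁻¹ * (√2)⁻¹ = (1 / 2 : ℝ) := by
    rw [← mul_inv, Real.mul_self_sqrt (by norm_num), one_div]
  have h : ∑ a, (hadamardY : Matrix Bool Bool ℂ) true a
      * (((√2 : ℝ) : ℂ)⁻¹ * exp (I * ((if a then α else 0 : ℝ) : ℂ)))
      = (((√2)⁻¹ * (√2)⁻¹ : ℝ) : ℂ) * (1 + I * exp (I * α)) := by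
    simp [hadamardY]; ring
  rw [h, h2, mul_comm I (α : ℂ), exp_mul_I, ← ofReal_cos, ← ofReal_sin, ← normSq_eq_norm_sq,
    normSq_apply]
  simp
  rw [cos_ofReal_re, sin_ofReal_re]
  nlinarith [Real.sin_sq_add_cos_sq α]

end Gates

/-! ### Phase kickback on a cube

The estimator works on `d + 1 + m` qubits: one for every coordinate, an idle ancilla and the `m`
output qubits of the oracle. -/

section Kickback

open Complex

variable {d m : ℕ} {F : EuclideanSpace ℝ (Fin d) → BitVec m} {X : Set (EuclideanSpace ℝ (Fin d))}

/-- The qubit of the `i`-th coordinate. -/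
def idxQ (m : ℕ) {d : ℕ} (i : Fin d) : Fin (d + 1 + m) := ⟨i, by omega⟩

/-- The ancilla. -/
def ancQ (d m : ℕ) : Fin (d + 1 + m) := ⟨d, by omega⟩

/-- The `j`-th output qubit. -/
def outQ (d : ℕ) {m : ℕ} (j : Fin m) : Fin (d + 1 + m) := ⟨d + 1 + j, by omega⟩

theorem idxQ_ne_ancQ (i : Fin d) : idxQ m i ≠ ancQ d m := by
  simp [idxQ, ancQ, Fin.ext_iff]; omega

theorem outQ_ne_ancQ (j : Fin m) : outQ d j ≠ ancQ d m := by
  simp [outQ, ancQ, Fin.ext_iff]; omega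

theorem idxQ_ne_outQ (i : Fin d) (j : Fin m) : idxQ m i ≠ outQ d j := by
  simp [outQ, idxQ, Fin.ext_iff]; omega

theorem outQ_injective : Function.Injective (outQ d : Fin m → Fin (d + 1 + m)) := by
  intro i j h
  simpa [outQ, Fin.ext_iff] using h

theorem idxQ_injective : Function.Injective (idxQ m : Fin d → Fin (d + 1 + m)) := by
  intro i j h
  simpa [idxQ, Fin.ext_iff] using h

/-- Apply `V` to the qubits of the coordinates in `l`. -/
def layerProg (V : Matrix.unitaryGroup Bool ℂ) (l : List (Fin d)) : Program d m (d + 1 + m) :=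
  l.map fun i => .gate (oneQubit V) (idxQ m i) (ancQ d m) (idxQ_ne_ancQ i)

/-- The effect of `layerProg`. -/
def layer (V : Matrix.unitaryGroup Bool ℂ) (l : List (Fin d)) (ψ : QState (d + 1 + m)) :
    QState (d + 1 + m) :=
  l.foldl (fun ψ i => applyGate (oneQubit V) (idxQ m i) (ancQ d m) ψ) ψ

theorem run_layerProg (V : Matrix.unitaryGroup Bool ℂ) (l : List (Fin d))
    (c : Config (d + 1 + m)) : run F X (layerProg V l) c = [⟨c.mem, layer V l c.st⟩] := by
  induction l generalizing c with
  | nil => simp [layerProg, layer, run]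
  | cons i l ih =>
    rw [layerProg, List.map_cons, run, step, List.flatMap_singleton]
    exact ih _

theorem layer_sub (V : Matrix.unitaryGroup Bool ℂ) (l : List (Fin d)) (ψ φ : QState (d + 1 + m)) :
    layer V l (ψ - φ) = layer V l ψ - layer V l φ := by
  induction l generalizing ψ φ with
  | nil => rfl
  | cons i l ih => simp only [layer, List.foldl_cons, applyGate_sub] at ih ⊢; exact ih _ _

theorem normSq_layer (V : Matrix.unitaryGroup Bool ℂ) (l : List (Fin d)) (ψ : QState (d + 1 + m)) :
    normSq (layer V l ψ) = normSq ψ := by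
  induction l generalizing ψ with
  | nil => rfl
  | cons i l ih =>
    simp only [layer, List.foldl_cons] at ih ⊢
    rw [ih, normSq_applyGate _ (idxQ_ne_ancQ i)]

open Classical in
theorem layer_prodState (V : Matrix.unitaryGroup Bool ℂ) {l : List (Fin d)} (hl : l.Nodup) (r : ℂ)
    (χ : Fin (d + 1 + m) → Bool → ℂ) :
    layer V l (fun s => r * prodState χ s) = fun s => r * prodState (fun q v =>
      if ∃ i ∈ l, idxQ m i = q then ∑ a, (V : Matrix Bool Bool ℂ) v a * χ q a else χ q v) s := by
  induction l generalizing χ with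
  | nil => simp [layer]
  | cons i l ih =>
    rw [List.nodup_cons] at hl
    rw [layer, List.foldl_cons, applyGate_prodState V (idxQ_ne_ancQ i)]
    rw [← layer, ih hl.2]
    funext s
    congr 2
    funext q v
    by_cases hq : q = idxQ m i
    · subst hq
      have : ¬ ∃ i' ∈ l, idxQ m i' = idxQ m i := by
        rintro ⟨i', h', h⟩
        exact hl.1 (idxQ_injective h ▸ h')
      simp [this]
    · simp [Function.update_of_ne hq, Ne.symm hq]

/-- Apply phase gates to the output qubits in `l`. -/
def phaseProg (γ : Fin m → ℝ) (l : List (Fin m)) : Program d m (d + 1 + m) :=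
  l.map fun j => .gate (oneQubit (phaseGate (γ j))) (outQ d j) (ancQ d m) (outQ_ne_ancQ j)

theorem run_phaseProg (γ : Fin m → ℝ) (l : List (Fin m)) (c : Config (d + 1 + m)) :
    run F X (phaseProg γ l) c = [⟨c.mem, fun s =>
      exp (I * (((l.map fun j => if s (outQ d j) then γ j else 0).sum : ℝ) : ℂ)) * c.st s⟩] := by
  induction l generalizing c with
  | nil => simp [phaseProg, run]
  | cons j l ih =>
    rw [phaseProg, List.map_cons, run, step, List.flatMap_singleton]
    rw [← phaseProg, ih]
    congr 2
    funext s
    dsimp only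
    rw [applyGate_phaseGate _ (outQ_ne_ancQ j), ← mul_assoc, ← exp_add, List.map_cons,
      List.sum_cons]
    push_cast
    ring_nf

/-- Query the oracle on the vertices of the cube whose corner is stored from register `3d + 1` on
and whose edge length is in register `9d + 1`. -/
def cubeQuery (d m : ℕ) : Instr d m (d + 1 + m) :=
  .query 1 (fun i _ => idxQ m i) (outQ d) (3 * d + 1) (9 * d + 1) outQ_injective
    fun i _ j => idxQ_ne_outQ i j

/-- A vertex of the cube with corner `z` and edge length `σ`. -/
def vertex (z : EuclideanSpace ℝ (Fin d)) (σ : ℝ) (u : Fin d → Bool) : EuclideanSpace ℝ (Fin d) :=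
  WithLp.toLp 2 fun i => z i + if u i then σ else 0

theorem gridPoint_eq_vertex (z : EuclideanSpace ℝ (Fin d)) (σ : ℝ) (s : Bits (d + 1 + m)) :
    gridPoint (fun i (_ : Fin 1) => idxQ m i) z σ s = vertex z σ fun i => s (idxQ m i) := by
  simp [gridPoint, vertex]

/-- The phase that the phase gates attach to an output string. -/
def outPhase (γ : Fin m → ℝ) (l : List (Fin m)) (v : BitVec m) : ℝ :=
  (l.map fun j : Fin m => if v.getLsbD j then γ j else 0).sum

/-- Fresh qubits, uniform superposition over the vertices, phase kickback and a layer of gates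
`V`. -/
def kickbackProg (V : Matrix.unitaryGroup Bool ℂ) (γ : Fin m → ℝ) (l : List (Fin m)) :
    Program d m (d + 1 + m) :=
  [.fresh] ++ (layerProg hadamard (List.finRange d) ++ ([cubeQuery d m] ++ (phaseProg γ l ++
    ([cubeQuery d m] ++ layerProg V (List.finRange d)))))

/-- The uniform superposition over the vertices. -/
def uniformState (d m : ℕ) : Fin (d + 1 + m) → Bool → ℂ := fun q v =>
  if (q : ℕ) < d then ((√2 : ℝ) : ℂ)⁻¹ else if v then 0 else 1

theorem exists_idxQ_iff (q : Fin (d + 1 + m)) :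
    (∃ i ∈ List.finRange d, idxQ m i = q) ↔ (q : ℕ) < d := by
  constructor
  · rintro ⟨i, -, rfl⟩; exact i.2
  · intro h; exact ⟨⟨q, h⟩, List.mem_finRange _, rfl⟩

theorem layer_hadamard_zeroState (r : ℂ) :
    layer hadamard (List.finRange d) (fun s => r * zeroState (d + 1 + m) s)
      = fun s => r * prodState (uniformState d m) s := by
  classical
  rw [zeroState_eq_prodState, layer_prodState _ (List.nodup_finRange d)]
  funext s
  congr 2
  funext q v
  simp only [exists_idxQ_iff, uniformState]
  split_ifs <;> simp [hadamard]

/-- The first query writes the value of `F` at the vertex into the cleared output qubits, the phase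
gates turn it into a phase, and the second query, being inverse to the first, clears the output
again. -/
theorem run_kickbackProg (V : Matrix.unitaryGroup Bool ℂ) (γ : Fin m → ℝ) (l : List (Fin m))
    (c : Config (d + 1 + m)) :
    run F X (kickbackProg V γ l) c = [⟨c.mem, layer V (List.finRange d) fun s =>
      exp (I * ((outPhase γ l (F (vertex (readVec d c.mem (3 * d + 1)) (c.mem (9 * d + 1))
        fun i => s (idxQ m i))) : ℝ) : ℂ))
        * ((√(normSq c.st) : ℝ) * prodState (uniformState d m) s)⟩] := by
  have hinv := oracleMap_involutive (F := F) (b := 1) (idx := fun i _ => idxQ m i) (out := outQ d)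
    outQ_injective (fun i _ j => idxQ_ne_outQ i j) (readVec d c.mem (3 * d + 1)) (c.mem (9 * d + 1))
  rw [kickbackProg, run_append, run_singleton, step, List.flatMap_singleton, run_append,
    run_layerProg, List.flatMap_singleton, run_append, run_singleton, cubeQuery, step,
    List.flatMap_singleton, run_append, run_phaseProg, List.flatMap_singleton, run_append,
    run_singleton, step, List.flatMap_singleton, run_layerProg, layer_hadamard_zeroState]
  congr 3
  funext s
  dsimp only
  rw [hinv s]
  -- Strings with a nonzero output have amplitude zero in the initial superposition, so only the
  -- value XORed into zeros matters.
  by_cases h0 : ∀ j, s (outQ d j) = false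
  · congr 5
    refine List.map_congr_left fun j _ => ?_
    rw [oracleMap_apply_out outQ_injective, h0, gridPoint_eq_vertex]
    simp
  · push Not at h0
    obtain ⟨j, hj⟩ := h0
    have : prodState (uniformState d m) s = 0 := by
      refine Finset.prod_eq_zero (Finset.mem_univ (outQ d j)) ?_
      have hj' : s (outQ d j) = true := by simpa using hj
      simp only [uniformState, hj']
      rw [if_neg (by simp [outQ]; omega)]
      simp
    simp [this]

/-- The product state that results if the phases are exactly linear, with slopes `α`. -/
def linearState (V : Matrix.unitaryGroup Bool ℂ) (α : Fin d → ℝ) : Fin (d + 1 + m) → Bool → ℂ :=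
  fun q v => if h : (q : ℕ) < d then ∑ a, (V : Matrix Bool Bool ℂ) v a
    * (((√2 : ℝ) : ℂ)⁻¹ * exp (I * ((if a then α ⟨q, h⟩ else 0 : ℝ) : ℂ)))
  else if v then 0 else 1

/-- The exponential of a sum over coordinates factors over the qubits, so linear phases keep the
state a product state and the gates act on each factor separately. -/
theorem layer_linear (V : Matrix.unitaryGroup Bool ℂ) (α : Fin d → ℝ) (r : ℂ) (β : ℝ) :
    layer V (List.finRange d) (fun s : Bits (d + 1 + m) =>
      exp (I * ((β + ∑ i, (if s (idxQ m i) then α i else 0) : ℝ) : ℂ))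
        * (r * prodState (uniformState d m) s))
      = fun s => exp (I * β) * r * prodState (linearState V α) s := by
  classical
  let χ : Fin (d + 1 + m) → Bool → ℂ := fun q v => if h : (q : ℕ) < d then
    ((√2 : ℝ) : ℂ)⁻¹ * exp (I * ((if v then α ⟨q, h⟩ else 0 : ℝ) : ℂ)) else if v then 0 else 1
  have h1 : (fun s : Bits (d + 1 + m) =>
      exp (I * ((β + ∑ i, (if s (idxQ m i) then α i else 0) : ℝ) : ℂ))
        * (r * prodState (uniformState d m) s)) = fun s => exp (I * β) * r * prodState χ s := by
    funext s
    have h2 : prodState χ s = exp (I * ((∑ i, (if s (idxQ m i) then α i else 0) : ℝ) : ℂ))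
        * prodState (uniformState d m) s := by
      unfold prodState
      have h3 : ∀ q, χ q (s q) = exp (I * ((if h : (q : ℕ) < d then
          (if s q then α ⟨q, h⟩ else 0) else 0 : ℝ) : ℂ)) * uniformState d m q (s q) := by
        intro q
        simp only [χ, uniformState]
        split_ifs <;> simp [mul_comm]
      rw [Finset.prod_congr rfl fun q _ => h3 q, Finset.prod_mul_distrib, ← exp_sum,
        ← Finset.mul_sum, ← ofReal_sum]
      congr 4
      rw [Fin.sum_univ_add, Fin.sum_univ_add]
      have h4 : ∀ x : ℕ, ¬ d + 1 + x < d := fun x => by omega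
      simp [idxQ, Fin.castAdd, Fin.castLE, Fin.natAdd, h4]
      rfl
    rw [h2, ofReal_add, mul_add, exp_add]
    ring
  rw [h1, layer_prodState V (List.nodup_finRange d)]
  funext s
  congr 2
  funext q v
  simp only [exists_idxQ_iff, linearState, χ]
  split_ifs <;> simp

theorem sum_norm_sq_linearState (V : Matrix.unitaryGroup Bool ℂ) (α : Fin d → ℝ)
    (q : Fin (d + 1 + m)) : ∑ v, ‖linearState V α q v‖ ^ 2 = 1 := by
  by_cases h : (q : ℕ) < d
  · simp only [linearState, h, dif_pos]
    rw [sum_norm_sq_unitary V]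
    simp [norm_exp]
  · simp [linearState, h]

theorem sum_norm_sq_uniformState (q : Fin (d + 1 + m)) : ∑ v, ‖uniformState d m q v‖ ^ 2 = 1 := by
  unfold uniformState
  split_ifs <;> simp

/-- Measurement statistics after the kickback, if the phases are approximately linear. -/
theorem abs_marginal_sub_le (V : Matrix.unitaryGroup Bool ℂ) (Ψ : (Fin d → Bool) → ℝ)
    (α : Fin d → ℝ) (β κ N : ℝ) (hκ : 0 < κ) (hN : 0 ≤ N)
    (hΨ : ∀ u, ∃ k : ℤ, |Ψ u - (β + ∑ i, if u i then α i else 0) - 2 * Real.pi * k| ≤ κ)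
    (i : Fin d) :
    |∑ s : Bits (d + 1 + m), (if s (idxQ m i) then
        ‖layer V (List.finRange d) (fun s => exp (I * ((Ψ fun i => s (idxQ m i) : ℝ) : ℂ))
          * ((√N : ℝ) * prodState (uniformState d m) s)) s‖ ^ 2 else 0)
      - N * ‖∑ a, (V : Matrix Bool Bool ℂ) true a
        * (((√2 : ℝ) : ℂ)⁻¹ * exp (I * ((if a then α i else 0 : ℝ) : ℂ)))‖ ^ 2| ≤ 2 * κ * N := by
  set ψ : QState (d + 1 + m) := fun s => exp (I * ((Ψ fun i => s (idxQ m i) : ℝ) : ℂ))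
          * ((√N : ℝ) * prodState (uniformState d m) s) with hψ
  set φ : QState (d + 1 + m) := fun s =>
      exp (I * ((β + ∑ i, (if s (idxQ m i) then α i else 0) : ℝ) : ℂ))
        * ((√N : ℝ) * prodState (uniformState d m) s) with hφ
  have hexp : ∀ x : ℝ, ‖exp (I * x)‖ = 1 := fun x => by rw [mul_comm, norm_exp_ofReal_mul_I]
  have hsq : (√N) ^ 2 = N := Real.sq_sqrt hN
  have hu : normSq (fun s => ((√N : ℝ) : ℂ) * prodState (uniformState d m) s) = N := by
    rw [normSq_smul, normSq_prodState _ sum_norm_sq_uniformState, Complex.norm_real]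
    simp [hsq]
  have hnψ : normSq ψ = N := by
    rw [← hu]
    simp only [normSq, ψ, norm_mul, hexp, one_mul]
  have hnφ : normSq φ = N := by
    rw [← hu]
    simp only [normSq, φ, norm_mul, hexp, one_mul]
  have hdiff : normSq (ψ - φ) ≤ κ ^ 2 * N := by
    rw [← hu]
    unfold normSq
    rw [Finset.mul_sum]
    refine Finset.sum_le_sum fun s _ => ?_
    simp only [ψ, φ, Pi.sub_apply, ← sub_mul]
    rw [norm_mul, mul_pow]
    refine mul_le_mul_of_nonneg_right ?_ (by positivity)
    obtain ⟨k, hk⟩ := hΨ fun i => s (idxQ m i)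
    -- Only phases modulo 2π matter, so the integer `k` may be absorbed.
    have hper : exp (I * ((β + ∑ i, (if s (idxQ m i) then α i else 0) : ℝ) : ℂ))
        = exp (I * (((β + ∑ i, (if s (idxQ m i) then α i else 0)) + 2 * Real.pi * k : ℝ) : ℂ)) := by
      rw [exp_eq_exp_iff_exists_int]
      exact ⟨-k, by push_cast; ring⟩
    rw [hper]
    refine pow_le_pow_left₀ (norm_nonneg _) ((norm_exp_I_mul_sub_le _ _).trans ?_) 2
    rw [← sub_sub]
    exact hk
  have key := abs_sum_ite_sub_le (fun s : Bits (d + 1 + m) => s (idxQ m i) = true)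
    (ψ := layer V (List.finRange d) ψ) (φ := layer V (List.finRange d) φ) (N := N) hκ
    (by rw [normSq_layer, hnψ]) (by rw [normSq_layer, hnφ])
    (by rw [← layer_sub, normSq_layer]; exact hdiff)
  have hlin : ∑ s : Bits (d + 1 + m), (if s (idxQ m i) then
      ‖layer V (List.finRange d) φ s‖ ^ 2 else 0) = N * ‖∑ a, (V : Matrix Bool Bool ℂ) true a
        * (((√2 : ℝ) : ℂ)⁻¹ * exp (I * ((if a then α i else 0 : ℝ) : ℂ)))‖ ^ 2 := by
    rw [hφ, layer_linear]
    simp only [norm_mul, hexp, one_mul, mul_pow, Complex.norm_real, Real.norm_eq_abs, sq_abs, hsq]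
    have := sum_ite_norm_prodState (linearState V α : Fin (d + 1 + m) → Bool → ℂ)
      (sum_norm_sq_linearState V α) (idxQ m i)
    rw [show linearState V α (idxQ m i) true = ∑ a, (V : Matrix Bool Bool ℂ) true a
        * (((√2 : ℝ) : ℂ)⁻¹ * exp (I * ((if a then α i else 0 : ℝ) : ℂ))) by
      simp [linearState, idxQ]] at this
    rw [← this, Finset.mul_sum]
    refine Finset.sum_congr rfl fun s _ => ?_
    split_ifs <;> simp
  rw [hlin] at key
  exact key

end Kickback

/-! ### Repeated measurements -/

section Repetition

variable {d m n : ℕ} {F : EuclideanSpace ℝ (Fin d) → BitVec m} {X : Set (EuclideanSpace ℝ (Fin d))}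

/-- Componentwise instructions that do not interfere with each other. -/
theorem run_map_pointwise {ι : Type*} {l : List ι} (hl : l.Nodup) (ins : ι → Instr d m n)
    (dst : ι → ℕ) (val : ι → Mem → ℝ) (hdst : ∀ i ∈ l, ∀ j ∈ l, i ≠ j → dst i ≠ dst j)
    (hstep : ∀ i ∈ l, ∀ c, step F X (ins i) c
      = [⟨Function.update c.mem (dst i) (val i c.mem), c.st⟩])
    (hval : ∀ i ∈ l, ∀ j ∈ l, i ≠ j → ∀ μ x, val i (Function.update μ (dst j) x) = val i μ)
    (c : Config n) :
    ∃ μ, run F X (l.map ins) c = [⟨μ, c.st⟩] ∧ (∀ i ∈ l, μ (dst i) = val i c.mem)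
      ∧ ∀ r, (∀ i ∈ l, r ≠ dst i) → μ r = c.mem r := by
  induction l generalizing c with
  | nil => exact ⟨c.mem, by simp [run], by simp, by simp⟩
  | cons a l ih =>
    rw [List.nodup_cons] at hl
    obtain ⟨μ, h1, h2, h3⟩ := ih hl.2
      (fun i hi j hj => hdst i (List.mem_cons_of_mem _ hi) j (List.mem_cons_of_mem _ hj))
      (fun i hi => hstep i (List.mem_cons_of_mem _ hi))
      (fun i hi j hj => hval i (List.mem_cons_of_mem _ hi) j (List.mem_cons_of_mem _ hj))
      ⟨Function.update c.mem (dst a) (val a c.mem), c.st⟩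
    have hne : ∀ i ∈ l, i ≠ a := by rintro i hi rfl; exact hl.1 hi
    refine ⟨μ, ?_, ?_, ?_⟩
    · rw [List.map_cons, run, hstep a List.mem_cons_self, List.flatMap_singleton, h1]
    · intro i hi
      rcases List.mem_cons.1 hi with rfl | hi'
      · rw [h3 _ fun j hj => hdst i hi j (List.mem_cons_of_mem _ hj) (hne j hj).symm]
        simp
      · rw [h2 i hi', hval i hi a List.mem_cons_self (hne i hi')]
    · intro r hr
      rw [h3 r fun i hi => hr i (List.mem_cons_of_mem _ hi)]
      exact Function.update_of_ne (hr a List.mem_cons_self) _ _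

theorem ev_append_of_run_eq {P Q : Program d m n} {c c₁ : Config n} {Φ : Config n → ℝ}
    (h : run F X P c = [c₁]) : ev F X (P ++ Q) c Φ = ev F X Q c₁ Φ := by
  rw [ev_append]
  simp [ev, h]

/-- Measure the qubits of the coordinates in `l`; the outcomes go to the registers from `4d + 1`
on. -/
def measureProg (l : List (Fin d)) : Program d m (d + 1 + m) :=
  l.map fun i : Fin d => .measure (idxQ m i) (4 * d + 1 + i)

/-- The memory after the outcomes `s` of a measurement. -/
def recordBits (l : List (Fin d)) (s : Bits (d + 1 + m)) (μ : Mem) : Mem :=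
  l.foldl (fun μ (i : Fin d) => Function.update μ (4 * d + 1 + i) (if s (idxQ m i) then 1 else 0)) μ

theorem recordBits_of_notMem (l : List (Fin d)) (s : Bits (d + 1 + m)) (μ : Mem) {r : ℕ}
    (hr : ∀ i ∈ l, r ≠ 4 * d + 1 + i) : recordBits l s μ r = μ r := by
  induction l generalizing μ with
  | nil => rfl
  | cons i l ih =>
    rw [recordBits, List.foldl_cons, ← recordBits, ih _ fun i hi => hr i (List.mem_cons_of_mem _ hi),
      Function.update_of_ne (hr i List.mem_cons_self)]

theorem recordBits_of_mem {l : List (Fin d)} (hl : l.Nodup) (s : Bits (d + 1 + m)) (μ : Mem)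
    {i : Fin d} (hi : i ∈ l) :
    recordBits l s μ (4 * d + 1 + i) = if s (idxQ m i) then 1 else 0 := by
  induction l generalizing μ with
  | nil => simp at hi
  | cons j l ih =>
    rw [List.nodup_cons] at hl
    rw [recordBits, List.foldl_cons, ← recordBits]
    rcases List.mem_cons.1 hi with rfl | hi
    · rw [recordBits_of_notMem]
      · simp
      · intro k hk h
        have : k = i := Fin.ext (by omega)
        exact hl.1 (this ▸ hk)
    · exact ih hl.2 _ hi

/-- Successive collapses remove, for every basis string, all branches but the one with the matching
outcomes; the branch sum therefore becomes a sum over basis strings with weights given by squared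
amplitudes. -/
theorem ev_measureProg (l : List (Fin d)) (c : Config (d + 1 + m)) (Φ : Mem → ℝ) :
    ev F X (measureProg l) c (fun c' => Φ c'.mem * normSq c'.st)
      = ∑ s, Φ (recordBits l s c.mem) * ‖c.st s‖ ^ 2 := by
  induction l generalizing c with
  | nil => simp [measureProg, ev_nil, recordBits, normSq, Finset.mul_sum]
  | cons i l ih =>
    rw [measureProg, List.map_cons, ← measureProg, ev_cons]
    simp only [step, List.map_cons, List.map_nil, List.sum_cons, List.sum_nil, add_zero, ih]
    rw [← Finset.sum_add_distrib]
    refine Finset.sum_congr rfl fun s _ => ?_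
    rw [recordBits, recordBits, recordBits, List.foldl_cons]
    cases h : s (idxQ m i) <;> simp [collapse, h]

/-- Add the measured bits to counters in the registers from `cb` on. -/
def countProg (cb : ℕ) : Program d m n :=
  (List.finRange d).map fun i : Fin d => .add (cb + i) (cb + i) (4 * d + 1 + i)

theorem run_countProg {cb : ℕ} (hcb : 5 * d + 1 ≤ cb) (c : Config n) :
    ∃ μ, run F X (countProg cb : Program d m n) c = [⟨μ, c.st⟩] ∧
      ∀ i : Fin d, μ (cb + i) = c.mem (cb + i) + c.mem (4 * d + 1 + i) := by
  obtain ⟨μ, h1, h2, -⟩ := run_map_pointwise (F := F) (X := X) (List.nodup_finRange d)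
    (fun i : Fin d => (Instr.add (cb + i) (cb + i) (4 * d + 1 + i) : Instr d m n))
    (fun i => cb + i) (fun i μ => μ (cb + i) + μ (4 * d + 1 + i))
    (fun i _ j _ hij h => hij (Fin.ext (by omega)))
    (fun i _ c => rfl)
    (fun i _ j _ hij μ x => by
      have : (i : ℕ) ≠ j := fun h => hij (Fin.ext h)
      rw [Function.update_of_ne (by omega), Function.update_of_ne (by omega)]) c
  exact ⟨μ, h1, fun i => h2 i (List.mem_finRange i)⟩

/-- One run: kickback, measurement, counting. -/
def sampleProg (V : Matrix.unitaryGroup Bool ℂ) (γ : Fin m → ℝ) (js : List (Fin m)) (cb : ℕ) :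
    Program d m (d + 1 + m) :=
  kickbackProg V γ js ++ (measureProg (List.finRange d) ++ countProg cb)

/-- For a single counter, one run is a Bernoulli trial: it increments the counter with weight `P₁`
and otherwise keeps it. Stating this for every `u` allows exponential moments to be used later. Bits
of different coordinates may be correlated, which is harmless for a union bound. -/
theorem ev_sampleProg (V : Matrix.unitaryGroup Bool ℂ) (γ : Fin m → ℝ) (js : List (Fin m)) {cb : ℕ}
    (hcb : 5 * d + 1 ≤ cb) (c : Config (d + 1 + m)) (i : Fin d) (α : Fin d → ℝ) (β κ : ℝ)
    (hκ : 0 < κ)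
    (hα : ∀ u, ∃ k : ℤ, |outPhase γ js (F (vertex (readVec d c.mem (3 * d + 1))
      (c.mem (9 * d + 1)) u)) - (β + ∑ i, if u i then α i else 0) - 2 * Real.pi * k| ≤ κ) :
    ∃ P₁ : ℝ, |P₁ - normSq c.st * ‖∑ a, (V : Matrix Bool Bool ℂ) true a
        * (((√2 : ℝ) : ℂ)⁻¹ * Complex.exp (Complex.I * ((if a then α i else 0 : ℝ) : ℂ)))‖ ^ 2|
          ≤ 2 * κ * normSq c.st ∧
      ∀ u : ℝ → ℝ, ev F X (sampleProg V γ js cb) c (fun c' => u (c'.mem (cb + i)) * normSq c'.st)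
        = P₁ * u (c.mem (cb + i) + 1) + (normSq c.st - P₁) * u (c.mem (cb + i)) := by
  have hm := abs_marginal_sub_le (m := m) V (fun u => outPhase γ js
    (F (vertex (readVec d c.mem (3 * d + 1)) (c.mem (9 * d + 1)) u))) α β κ (normSq c.st) hκ
    (normSq_nonneg _) hα i
  refine ⟨_, hm, fun u => ?_⟩
  have hN : normSq (layer V (List.finRange d) fun s : Bits (d + 1 + m) =>
      Complex.exp (Complex.I * ((outPhase γ js (F (vertex (readVec d c.mem (3 * d + 1))
        (c.mem (9 * d + 1)) fun i => s (idxQ m i))) : ℝ) : ℂ))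
        * ((√(normSq c.st) : ℝ) * prodState (uniformState d m) s)) = normSq c.st := by
    have h1 := ev_normSq (F := F) (X := X) (kickbackProg V γ js) c
    rwa [ev, run_kickbackProg, List.map_singleton, List.sum_singleton] at h1
  rw [sampleProg, ev_append_of_run_eq (run_kickbackProg V γ js c), ev_append]
  set ψ := layer V (List.finRange d) fun s : Bits (d + 1 + m) =>
      Complex.exp (Complex.I * ((outPhase γ js (F (vertex (readVec d c.mem (3 * d + 1))
        (c.mem (9 * d + 1)) fun i => s (idxQ m i))) : ℝ) : ℂ))
        * ((√(normSq c.st) : ℝ) * prodState (uniformState d m) s)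
  have hcount : ∀ c' : Config (d + 1 + m), ev F X (countProg cb) c'
      (fun c' => u (c'.mem (cb + i)) * normSq c'.st)
        = (fun μ : Mem => u (μ (cb + i) + μ (4 * d + 1 + i))) c'.mem * normSq c'.st := by
    intro c'
    obtain ⟨μ, h1, h2⟩ := run_countProg (F := F) (X := X) hcb c'
    simp [ev, h1, h2]
  simp only [hcount]
  rw [ev_measureProg (F := F) (X := X) (List.finRange d) _
    (fun μ : Mem => u (μ (cb + i) + μ (4 * d + 1 + i)))]
  simp only [recordBits_of_mem (List.nodup_finRange d) _ _ (List.mem_finRange i)]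
  have hr : ∀ s : Bits (d + 1 + m), recordBits (List.finRange d) s c.mem (cb + i)
      = c.mem (cb + i) := fun s => recordBits_of_notMem _ _ _ fun j _ => by omega
  simp only [hr]
  rw [← hN, normSq, ← Finset.sum_sub_distrib, Finset.sum_mul, Finset.sum_mul,
    ← Finset.sum_add_distrib]
  refine Finset.sum_congr rfl fun s _ => ?_
  cases h : s (idxQ m i) <;> simp <;> ring

/-- Growth of the exponential moment in one Bernoulli trial. -/
theorem bernoulli_mgf_le {q P₁ N ν l : ℝ} (hq0 : 0 ≤ q) (hq1 : q ≤ 1) (hN : 0 ≤ N)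
    (hl : |l| ≤ 1) (hP : |P₁ - N * q| ≤ ν * N) :
    P₁ * Real.exp l + (N - P₁) ≤ Real.exp (l * q + l ^ 2 + 2 * |l| * ν) * N := by
  have h1 := Real.abs_exp_sub_one_le hl
  have h2 := abs_le.1 (Real.abs_exp_sub_one_sub_id_le hl)
  have h3 : (P₁ - N * q) * (Real.exp l - 1) ≤ ν * N * (2 * |l|) := by
    refine (le_abs_self _).trans ?_
    rw [abs_mul]
    exact mul_le_mul hP h1 (abs_nonneg _) ((abs_nonneg _).trans hP)
  -- Here exp l - 1 ≤ l + l² for |l| ≤ 1. Together with `h3` the growth factor is at most 1 + lq +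
  -- l² + 2|l|ν, which is below the exponential.
  have h4 : q * (Real.exp l - 1) ≤ l * q + l ^ 2 := by nlinarith [sq_nonneg l]
  have h5 := Real.add_one_le_exp (l * q + l ^ 2 + 2 * |l| * ν)
  have h6 := mul_le_mul_of_nonneg_right h5 hN
  have h7 := mul_le_mul_of_nonneg_left h4 hN
  nlinarith

/-- Exponential moments of a counter after `M` independent trials. -/
theorem ev_replicate_exp_le {B : Program d m n} {I : Mem → Prop} {r : ℕ} {q ν l : ℝ}
    (hq0 : 0 ≤ q) (hq1 : q ≤ 1) (hl : |l| ≤ 1) (hI : Ensures F X I B I)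
    (hB : ∀ c, I c.mem → ∃ P₁ : ℝ, |P₁ - normSq c.st * q| ≤ ν * normSq c.st ∧
      ∀ u : ℝ → ℝ, ev F X B c (fun c' => u (c'.mem r) * normSq c'.st)
        = P₁ * u (c.mem r + 1) + (normSq c.st - P₁) * u (c.mem r)) (M : ℕ) (c : Config n)
    (hc : I c.mem) :
    ev F X (List.replicate M B).flatten c (fun c' => Real.exp (l * c'.mem r) * normSq c'.st)
      ≤ Real.exp (M * (l * q + l ^ 2 + 2 * |l| * ν)) * (Real.exp (l * c.mem r) * normSq c.st) := by
  induction M generalizing c with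
  | zero => simp [ev_nil]
  | succ M ih =>
    rw [List.replicate_succ, List.flatten_cons, ev_append]
    refine (ev_mono fun c' hc' => ih c' (hI c hc c' hc')).trans ?_
    rw [ev_const_mul]
    obtain ⟨P₁, hP, hu⟩ := hB c hc
    rw [hu fun x => Real.exp (l * x)]
    have h := bernoulli_mgf_le hq0 hq1 (normSq_nonneg c.st) hl hP
    have h2 : P₁ * Real.exp (l * (c.mem r + 1)) + (normSq c.st - P₁) * Real.exp (l * c.mem r)
        = Real.exp (l * c.mem r) * (P₁ * Real.exp l + (normSq c.st - P₁)) := by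
      rw [mul_add, mul_one, Real.exp_add]; ring
    rw [h2]
    calc _ ≤ Real.exp (M * (l * q + l ^ 2 + 2 * |l| * ν)) * (Real.exp (l * c.mem r)
          * (Real.exp (l * q + l ^ 2 + 2 * |l| * ν) * normSq c.st)) := by gcongr
      _ = _ := by
        rw [show ((M + 1 : ℕ) : ℝ) * (l * q + l ^ 2 + 2 * |l| * ν)
          = M * (l * q + l ^ 2 + 2 * |l| * ν) + (l * q + l ^ 2 + 2 * |l| * ν) by push_cast; ring,
          Real.exp_add (M * _)]
        ring

/-- Concentration of `d` counters around their means. -/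
theorem reaches_counters {B : Program d m n} {I : Mem → Prop} {cb : ℕ} {q : Fin d → ℝ}
    (hq0 : ∀ i, 0 ≤ q i) (hq1 : ∀ i, q i ≤ 1) (hI : Ensures F X I B I)
    (hB : ∀ i : Fin d, ∀ c, I c.mem → ∃ P₁ : ℝ, |P₁ - normSq c.st * q i| ≤ 1 / 200 * normSq c.st ∧
      ∀ u : ℝ → ℝ, ev F X B c (fun c' => u (c'.mem (cb + i)) * normSq c'.st)
        = P₁ * u (c.mem (cb + i) + 1) + (normSq c.st - P₁) * u (c.mem (cb + i))) (M : ℕ) :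
    Reaches F X (fun μ => I μ ∧ ∀ i : Fin d, μ (cb + i) = 0) (List.replicate M B).flatten
      (fun μ => ∀ i : Fin d, |μ (cb + i) - M * q i| ≤ 3 / 100 * M)
      (2 * d * Real.exp (-M / 10000)) := by
  have hcard : (2 * d : ℝ) = ((Finset.univ : Finset (Fin d × Bool)).card : ℝ) := by
    simp; ring
  rw [hcard]
  let sg : Bool → ℝ := fun b => if b then 1 / 100 else -(1 / 100)
  have hsg : ∀ b, |sg b| = 1 / 100 := by
    intro b; cases b <;> simp [sg]
  -- There is one event per coordinate and sign. With |l| = 1/100 and ν = 1/200 the exponential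
  -- moment grows by at most (1 + 1) M/10⁴ in the exponent, whereas a deviation 3M/100 costs 3M/10⁴;
  -- the net exponent is -M/10⁴.
  refine reaches_of_forall_expect Finset.univ
    (fun p μ => Real.exp (sg p.2 * (μ (cb + p.1) - M * q p.1) - 3 / 10000 * M))
    (fun p μ => (Real.exp_pos _).le) ?_ ?_
  · intro c _ c' _ hJ
    push Not at hJ
    obtain ⟨i, hi⟩ := hJ
    rcases le_or_gt 0 (c'.mem (cb + i) - M * q i) with h | h
    · rw [abs_of_nonneg h] at hi
      exact ⟨(i, true), Finset.mem_univ _, Real.one_le_exp (by simp [sg]; linarith)⟩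
    · rw [abs_of_neg h] at hi
      exact ⟨(i, false), Finset.mem_univ _, Real.one_le_exp (by simp [sg]; linarith)⟩
  · rintro ⟨i, b⟩ - c ⟨hc, h0⟩
    have h := ev_replicate_exp_le (hq0 i) (hq1 i) (l := sg b) (by rw [hsg]; norm_num) hI (hB i) M c
      hc
    rw [h0 i] at h
    have e : ∀ c' : Config n, Real.exp (sg b * (c'.mem (cb + i) - M * q i) - 3 / 10000 * M)
        * normSq c'.st = Real.exp (-(sg b * (M * q i)) - 3 / 10000 * M)
          * (Real.exp (sg b * c'.mem (cb + i)) * normSq c'.st) := by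
      intro c'
      rw [← mul_assoc, ← Real.exp_add]
      ring_nf
    simp only [e]
    rw [ev_const_mul]
    refine (mul_le_mul_of_nonneg_left h (Real.exp_pos _).le).trans (le_of_eq ?_)
    rw [mul_zero, Real.exp_zero, one_mul, ← mul_assoc, ← Real.exp_add, ← sq_abs (sg b), hsg]
    congr 2
    ring

end Repetition

/-! ### Refining the estimate of a slope -/

section Decoding

variable {d m n : ℕ} {F : EuclideanSpace ℝ (Fin d) → BitVec m} {X : Set (EuclideanSpace ℝ (Fin d))}

/-- From an approximation of `sin y` with `|y| ≤ 1`, decide for one of the values `-2/3, 0, 2/3` at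
distance at most `1/2` from `y`. -/
theorem abs_sub_ternary_le {y D : ℝ} (hy : |y| ≤ 1) (hD : |D - Real.sin y| ≤ 12 / 100) :
    |y - 2 / 3 * ((if 3 / 10 < D then 1 else 0) - if D < -(3 / 10) then 1 else 0)| ≤ 1 / 2 := by
  have pos : ∀ y D : ℝ, 0 ≤ y → y ≤ 1 → |D - Real.sin y| ≤ 12 / 100 →
      |y - 2 / 3 * ((if 3 / 10 < D then 1 else 0) - if D < -(3 / 10) then 1 else 0)| ≤ 1 / 2 := by
    intro y D h0 h1 hD
    have h2 := abs_le.1 hD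
    have h3 : Real.sin y ≤ y := Real.sin_le h0
    have h4 : 0 ≤ Real.sin y := Real.sin_nonneg_of_nonneg_of_le_pi h0 (by linarith [Real.pi_gt_three])
    rw [if_neg (by linarith : ¬ D < -(3 / 10))]
    -- Above the threshold sin y ≥ 0.18, so y lies in [1/6, 1], within 1/2 of 2/3. Below it sin y ≤
    -- 0.42, whereas y > 1/2 would force sin y > 0.46 by the cubic lower bound.
    split_ifs with h
    · have : (1 / 6 : ℝ) ≤ y := by linarith
      rw [abs_le]; constructor <;> linarith
    · have : y ≤ 1 / 2 := by
        by_contra hc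
        push Not at hc
        have h5 := Real.sin_gt_sub_cube (by linarith : 0 < y)
        nlinarith [mul_nonneg h0 (by linarith : 0 ≤ 1 - y), mul_nonneg h0 h0]
      rw [abs_le]; constructor <;> linarith
  rcases le_or_gt 0 y with h | h
  · exact pos y D h ((le_abs_self y).trans hy) hD
  · have h1 := pos (-y) (-D) (by linarith) ((neg_le_abs y).trans hy) (by
      rw [Real.sin_neg, ← abs_neg]; convert hD using 2; ring)
    rw [← abs_neg] at h1
    convert h1 using 2
    have e1 : (3 / 10 < -D) ↔ D < -(3 / 10) := by constructor <;> intro h <;> linarith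
    have e2 : (-D < -(3 / 10)) ↔ 3 / 10 < D := by constructor <;> intro h <;> linarith
    simp only [e1, e2]
    ring

/-- Estimate cosine and sine of `τ g` from the counters. -/
def quadratureProg (M : ℕ) (i : ℕ) : Program d m n :=
  [.const (9 * d + 2) (-2 / M), .const (9 * d + 3) 1,
    .mul (9 * d + 4) (5 * d + 1 + i) (9 * d + 2), .add (9 * d + 4) (9 * d + 4) (9 * d + 3),
    .mul (9 * d + 5) (6 * d + 1 + i) (9 * d + 2), .add (9 * d + 5) (9 * d + 5) (9 * d + 3)]

/-- Estimate `sin (τ (g - a))`. -/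
def residualProg (i : ℕ) : Program d m n :=
  [.mul (9 * d + 5) (9 * d + 5) (7 * d + 1 + i), .mul (9 * d + 4) (9 * d + 4) (8 * d + 1 + i),
    .sub (9 * d + 5) (9 * d + 5) (9 * d + 4)]

/-- Choose the direction of the correction. -/
def directionProg : Program d m n :=
  [.const (9 * d + 6) (3 / 10), .const (9 * d + 7) (-(3 / 10)), .const (9 * d + 8) 0,
    .select (9 * d + 9) (9 * d + 6) (9 * d + 5) (9 * d + 3) (9 * d + 8),
    .select (9 * d + 4) (9 * d + 5) (9 * d + 7) (9 * d + 3) (9 * d + 8),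
    .sub (9 * d + 9) (9 * d + 9) (9 * d + 4)]

/-- Correct the estimate. -/
def correctProg (τ : ℝ) (i : ℕ) : Program d m n :=
  [.const (9 * d + 2) (2 / 3 / τ), .mul (9 * d + 2) (9 * d + 9) (9 * d + 2),
    .add (d + i) (d + i) (9 * d + 2)]

/-- Double the angle. -/
def doubleProg (i : ℕ) : Program d m n :=
  [.mul (9 * d + 4) (7 * d + 1 + i) (7 * d + 1 + i),
    .mul (9 * d + 5) (8 * d + 1 + i) (8 * d + 1 + i), .sub (9 * d + 4) (9 * d + 4) (9 * d + 5),
    .mul (9 * d + 5) (7 * d + 1 + i) (8 * d + 1 + i), .add (9 * d + 5) (9 * d + 5) (9 * d + 5)]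

/-- Cosine and sine of the angle `4/3` in the chosen direction. -/
def angleProg : Program d m n :=
  [.mul (9 * d + 6) (9 * d + 9) (9 * d + 9), .const (9 * d + 2) (Real.cos (4 / 3) - 1),
    .mul (9 * d + 6) (9 * d + 6) (9 * d + 2), .add (9 * d + 6) (9 * d + 6) (9 * d + 3),
    .const (9 * d + 2) (Real.sin (4 / 3)), .mul (9 * d + 7) (9 * d + 9) (9 * d + 2)]

/-- Rotate by this angle. -/
def rotateProg (i : ℕ) : Program d m n :=
  [.mul (7 * d + 1 + i) (9 * d + 4) (9 * d + 6), .mul (9 * d + 2) (9 * d + 5) (9 * d + 7),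
    .sub (7 * d + 1 + i) (7 * d + 1 + i) (9 * d + 2),
    .mul (8 * d + 1 + i) (9 * d + 5) (9 * d + 6), .mul (9 * d + 2) (9 * d + 4) (9 * d + 7),
    .add (8 * d + 1 + i) (8 * d + 1 + i) (9 * d + 2)]

/-- Refine the estimate of the `i`-th slope. -/
def decodeProg (τ : ℝ) (M : ℕ) (i : ℕ) : Program d m n :=
  quadratureProg M i ++ (residualProg i ++ (directionProg ++ (correctProg τ i ++ (doubleProg i ++
    (angleProg ++ rotateProg i)))))

theorem run_quadratureProg (M : ℕ) {i : ℕ} (hi : i < d) (c : Config n) :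
    ∃ μ, run F X (quadratureProg M i : Program d m n) c = [⟨μ, c.st⟩] ∧
      μ (9 * d + 3) = 1 ∧ μ (9 * d + 4) = c.mem (5 * d + 1 + i) * (-2 / M) + 1 ∧
      μ (9 * d + 5) = c.mem (6 * d + 1 + i) * (-2 / M) + 1 ∧
      ∀ r < 9 * d + 1, μ r = c.mem r := by
  simp only [quadratureProg, run, step, List.flatMap_singleton]
  refine ⟨_, rfl, ?_, ?_, ?_, fun r hr => ?_⟩ <;>
  simp (disch := omega) only [Function.update_self, Function.update_of_ne]

theorem run_residualProg {i : ℕ} (hi : i < d) (c : Config n) :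
    ∃ μ, run F X (residualProg i : Program d m n) c = [⟨μ, c.st⟩] ∧
      μ (9 * d + 3) = c.mem (9 * d + 3) ∧ μ (9 * d + 5) = c.mem (9 * d + 5)
        * c.mem (7 * d + 1 + i) - c.mem (9 * d + 4) * c.mem (8 * d + 1 + i) ∧
      ∀ r < 9 * d + 1, μ r = c.mem r := by
  simp only [residualProg, run, step, List.flatMap_singleton]
  refine ⟨_, rfl, ?_, ?_, fun r hr => ?_⟩ <;>
  simp (disch := omega) only [Function.update_self, Function.update_of_ne]

theorem run_directionProg (c : Config n) :
    ∃ μ, run F X (directionProg : Program d m n) c = [⟨μ, c.st⟩] ∧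
      μ (9 * d + 3) = c.mem (9 * d + 3) ∧
      (c.mem (9 * d + 3) = 1 → μ (9 * d + 9) = (if 3 / 10 < c.mem (9 * d + 5) then 1 else 0)
        - if c.mem (9 * d + 5) < -(3 / 10) then 1 else 0) ∧
      ∀ r < 9 * d + 1, μ r = c.mem r := by
  simp only [directionProg, run, step, List.flatMap_singleton]
  refine ⟨_, rfl, ?_, fun h => ?_, fun r hr => ?_⟩ <;>
  simp (disch := omega) only [Function.update_self, Function.update_of_ne]
  simp only [h]

theorem run_correctProg (τ : ℝ) {i : ℕ} (hi : i < d) (c : Config n) :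
    ∃ μ, run F X (correctProg τ i : Program d m n) c = [⟨μ, c.st⟩] ∧
      μ (9 * d + 3) = c.mem (9 * d + 3) ∧ μ (9 * d + 9) = c.mem (9 * d + 9) ∧
      μ (d + i) = c.mem (d + i) + c.mem (9 * d + 9) * (2 / 3 / τ) ∧
      ∀ r < 9 * d + 1, r ≠ d + i → μ r = c.mem r := by
  simp only [correctProg, run, step, List.flatMap_singleton]
  refine ⟨_, rfl, ?_, ?_, ?_, fun r hr hr' => ?_⟩ <;>
  simp (disch := omega) only [Function.update_self, Function.update_of_ne]

theorem run_doubleProg {i : ℕ} (hi : i < d) (c : Config n) :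
    ∃ μ, run F X (doubleProg i : Program d m n) c = [⟨μ, c.st⟩] ∧
      μ (9 * d + 3) = c.mem (9 * d + 3) ∧ μ (9 * d + 9) = c.mem (9 * d + 9) ∧
      μ (9 * d + 4) = c.mem (7 * d + 1 + i) * c.mem (7 * d + 1 + i)
        - c.mem (8 * d + 1 + i) * c.mem (8 * d + 1 + i) ∧
      μ (9 * d + 5) = c.mem (7 * d + 1 + i) * c.mem (8 * d + 1 + i)
        + c.mem (7 * d + 1 + i) * c.mem (8 * d + 1 + i) ∧
      ∀ r < 9 * d + 1, μ r = c.mem r := by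
  simp only [doubleProg, run, step, List.flatMap_singleton]
  refine ⟨_, rfl, ?_, ?_, ?_, ?_, fun r hr => ?_⟩ <;>
  simp (disch := omega) only [Function.update_self, Function.update_of_ne]

theorem run_angleProg (c : Config n) :
    ∃ μ, run F X (angleProg : Program d m n) c = [⟨μ, c.st⟩] ∧
      μ (9 * d + 4) = c.mem (9 * d + 4) ∧ μ (9 * d + 5) = c.mem (9 * d + 5) ∧
      μ (9 * d + 6)
        = c.mem (9 * d + 9) * c.mem (9 * d + 9) * (Real.cos (4 / 3) - 1) + c.mem (9 * d + 3) ∧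
      μ (9 * d + 7) = c.mem (9 * d + 9) * Real.sin (4 / 3) ∧
      ∀ r < 9 * d + 1, μ r = c.mem r := by
  simp only [angleProg, run, step, List.flatMap_singleton]
  refine ⟨_, rfl, ?_, ?_, ?_, ?_, fun r hr => ?_⟩ <;>
  simp (disch := omega) only [Function.update_self, Function.update_of_ne]

theorem run_rotateProg {i : ℕ} (hi : i < d) (c : Config n) :
    ∃ μ, run F X (rotateProg i : Program d m n) c = [⟨μ, c.st⟩] ∧
      μ (7 * d + 1 + i)
        = c.mem (9 * d + 4) * c.mem (9 * d + 6) - c.mem (9 * d + 5) * c.mem (9 * d + 7) ∧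
      μ (8 * d + 1 + i)
        = c.mem (9 * d + 5) * c.mem (9 * d + 6) + c.mem (9 * d + 4) * c.mem (9 * d + 7) ∧
      ∀ r < 7 * d + 1, μ r = c.mem r := by
  simp only [rotateProg, run, step, List.flatMap_singleton]
  refine ⟨_, rfl, ?_, ?_, fun r hr => ?_⟩ <;>
  simp (disch := omega) only [Function.update_self, Function.update_of_ne]

/-- The estimate of the slope `g` in the `i`-th coordinate has error at most `1/τ`, and its sine and
cosine at the scale `τ` are stored. -/
def Estimate (d : ℕ) (τ g : ℝ) (i : ℕ) (μ : Mem) : Prop :=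
  |g - μ (d + i)| ≤ 1 / τ ∧ μ (7 * d + 1 + i) = Real.cos (τ * μ (d + i)) ∧
    μ (8 * d + 1 + i) = Real.sin (τ * μ (d + i))

/-- The counters of the `i`-th coordinate approximate cosine and sine of `τ g`. -/
def Counted (d M : ℕ) (τ g : ℝ) (i : ℕ) (μ : Mem) : Prop :=
  |μ (5 * d + 1 + i) - M * ((1 - Real.cos (τ * g)) / 2)| ≤ 3 / 100 * M ∧
    |μ (6 * d + 1 + i) - M * ((1 - Real.sin (τ * g)) / 2)| ≤ 3 / 100 * M

theorem abs_counter_sub_le {M : ℕ} (hM : 0 < M) {x t : ℝ}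
    (h : |x - M * ((1 - t) / 2)| ≤ 3 / 100 * M) : |x * (-2 / M) + 1 - t| ≤ 6 / 100 := by
  have hM' : (0 : ℝ) < M := by exact_mod_cast hM
  have e : x * (-2 / M) + 1 - t = (x - M * ((1 - t) / 2)) * (-2 / M) := by
    field_simp; ring
  rw [e, abs_mul, abs_div, abs_neg, abs_of_pos hM', abs_of_pos (by norm_num : (0 : ℝ) < 2)]
  calc _ ≤ 3 / 100 * (M : ℝ) * (2 / M) := by gcongr
    _ = 6 / 100 := by field_simp; norm_num

/-- The counters give cos τg and sin τg up to 0.06; with the stored cosine and sine of τa, the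
subtraction formula yields sin(τ(g - a)) up to 0.12. Since |τ(g - a)| ≤ 1, a correction by 0 or
±2/(3τ) leaves an error of at most 1/(2τ). No trigonometric instruction is available, so cosine and
sine of the new angle are obtained from the old ones by doubling and rotating. -/
theorem ensures_decodeProg {τ g : ℝ} (hτ : 0 < τ) {M i : ℕ} (hM : 0 < M) (hi : i < d) :
    Ensures F X (fun μ => Estimate d τ g i μ ∧ Counted d M τ g i μ)
      (decodeProg τ M i : Program d m n) (Estimate d (2 * τ) g i) := by
  rintro c ⟨⟨he, hC, hS⟩, hx, hy⟩ c' hc'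
  obtain ⟨μ₀, r₀, h01, h02, h03, h04⟩ := run_quadratureProg (F := F) (X := X) (m := m) M hi c
  obtain ⟨μ₁, r₁, h11, h12, h13⟩ := run_residualProg (F := F) (X := X) (m := m) hi ⟨μ₀, c.st⟩
  obtain ⟨μ₂, r₂, h21, h22, h23⟩ := run_directionProg (F := F) (X := X) ⟨μ₁, c.st⟩
  obtain ⟨μ₃, r₃, h31, h32, h33, h34⟩ := run_correctProg (F := F) (X := X) τ hi ⟨μ₂, c.st⟩
  obtain ⟨μ₄, r₄, h41, h42, h43, h44, h45⟩ := run_doubleProg (F := F) (X := X) hi ⟨μ₃, c.st⟩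
  obtain ⟨μ₆, r₆, h61, h62, h63, h64, h65⟩ := run_angleProg (F := F) (X := X) ⟨μ₄, c.st⟩
  obtain ⟨μ₅, r₅, h51, h52, h53⟩ := run_rotateProg (F := F) (X := X) hi ⟨μ₆, c.st⟩
  simp only [decodeProg, run_append, r₀, r₁, r₂, r₃, r₄, r₆, r₅, List.flatMap_singleton,
    List.mem_singleton] at hc'
  subst hc'
  dsimp only at *
  set a := c.mem (d + i) with ha
  set D := μ₁ (9 * d + 5) with hDdef
  set σ : ℝ := (if 3 / 10 < D then 1 else 0) - if D < -(3 / 10) then 1 else 0 with hσ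
  have hσ3 : σ = 1 ∨ σ = 0 ∨ σ = -1 := by
    rw [hσ]
    by_cases h1 : 3 / 10 < D
    · rw [if_pos h1, if_neg (by linarith)]; simp
    · by_cases h2 : D < -(3 / 10) <;> simp [h1, h2]
  have hdist : |D - Real.sin (τ * (g - a))| ≤ 12 / 100 := by
    have e : D - Real.sin (τ * (g - a)) = (c.mem (6 * d + 1 + i) * (-2 / M) + 1 - Real.sin (τ * g))
        * Real.cos (τ * a) - (c.mem (5 * d + 1 + i) * (-2 / M) + 1 - Real.cos (τ * g))
          * Real.sin (τ * a) := by
      rw [h12, h02, h03, h04 _ (by omega), h04 _ (by omega), hC, hS, mul_sub, Real.sin_sub]; ring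
    rw [e]
    refine (abs_sub _ _).trans ?_
    rw [abs_mul, abs_mul]
    have h1 := mul_le_mul (abs_counter_sub_le hM hy) (Real.abs_cos_le_one (τ * a)) (abs_nonneg _)
      (by norm_num)
    have h2 := mul_le_mul (abs_counter_sub_le hM hx) (Real.abs_sin_le_one (τ * a)) (abs_nonneg _)
      (by norm_num)
    linarith
  have hy1 : |τ * (g - a)| ≤ 1 := by
    rw [abs_mul, abs_of_pos hτ]
    calc τ * |g - a| ≤ τ * (1 / τ) := by gcongr
      _ = 1 := by field_simp
  have hter := abs_sub_ternary_le hy1 hdist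
  rw [← hσ] at hter
  have h9 : μ₂ (9 * d + 9) = σ := h22 (h11.trans h01)
  have ha' : μ₅ (d + i) = a + σ * (2 / 3 / τ) := by
    rw [h53 _ (by omega), h65 _ (by omega), h45 _ (by omega), h33, h9, h23 _ (by omega), h13 _ (by omega), h04 _ (by omega)]
  have h7 : μ₃ (7 * d + 1 + i) = Real.cos (τ * a) := by
    rw [h34 _ (by omega) (by omega), h23 _ (by omega), h13 _ (by omega), h04 _ (by omega), hC]
  have h8 : μ₃ (8 * d + 1 + i) = Real.sin (τ * a) := by
    rw [h34 _ (by omega) (by omega), h23 _ (by omega), h13 _ (by omega), h04 _ (by omega), hS]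
  -- At the doubled scale the new angle is twice the old one plus 0 or ±4/3, so constants for the
  -- single angle 4/3 suffice.
  have hang : 2 * τ * (a + σ * (2 / 3 / τ)) = 2 * (τ * a) + σ * (4 / 3) := by
    field_simp; ring
  -- For σ in {-1, 0, 1}, cosine and sine of 4σ/3 are polynomials in σ, which saves a case
  -- distinction in the program.
  have hcos : σ * σ * (Real.cos (4 / 3) - 1) + 1 = Real.cos (σ * (4 / 3)) := by
    rcases hσ3 with h | h | h <;> simp [h]
  have hsin : σ * Real.sin (4 / 3) = Real.sin (σ * (4 / 3)) := by
    rcases hσ3 with h | h | h <;> simp [h, neg_mul]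
  refine ⟨?_, ?_, ?_⟩
  · rw [ha']
    have e : g - (a + σ * (2 / 3 / τ)) = (τ * (g - a) - 2 / 3 * σ) / τ := by
      field_simp; ring
    rw [e, abs_div, abs_of_pos hτ]
    calc _ ≤ (1 / 2) / τ := by gcongr
      _ = 1 / (2 * τ) := by field_simp
  · rw [ha', hang, h51, h61, h62, h63, h64, h43, h44, h42, h41, h32, h31, h21, h11, h01, h9, h7, h8, hcos, hsin,
      Real.cos_add, Real.cos_two_mul', Real.sin_two_mul]
    ring
  · rw [ha', hang, h52, h61, h62, h63, h64, h43, h44, h42, h41, h32, h31, h21, h11, h01, h9, h7, h8, hcos, hsin,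
      Real.sin_add, Real.cos_two_mul', Real.sin_two_mul]
    ring

theorem decodeProg_writes {τ : ℝ} {M i : ℕ} {ins : Instr d m n} (h : ins ∈ decodeProg τ M i) {j : ℕ}
    (hj : ins.Writes j) : j = d + i ∨ j = 7 * d + 1 + i ∨ j = 8 * d + 1 + i ∨ 9 * d + 1 < j := by
  simp only [decodeProg, quadratureProg, residualProg, directionProg, correctProg, doubleProg,
    angleProg, rotateProg, List.cons_append, List.nil_append, List.mem_cons, List.not_mem_nil, or_false] at h
  rcases h with rfl | rfl | rfl | rfl | rfl | rfl | rfl | rfl | rfl | rfl | rfl | rfl | rfl | rfl |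
    rfl | rfl | rfl | rfl | rfl | rfl | rfl | rfl | rfl | rfl | rfl | rfl | rfl | rfl | rfl | rfl |
    rfl | rfl | rfl | rfl | rfl <;> simp only [Instr.Writes] at hj <;> omega

end Decoding

/-! ### One stage of the estimator: all slopes are refined by a factor two -/

section Stage

variable {d m n : ℕ} {F : EuclideanSpace ℝ (Fin d) → BitVec m} {X : Set (EuclideanSpace ℝ (Fin d))}

/-- Store the constant `a` in the `d` registers from `base` on. -/
def fillProg (base : ℕ) (a : ℝ) : Program d m n :=
  (List.finRange d).map fun i : Fin d => .const (base + i) a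

theorem run_fillProg (base : ℕ) (a : ℝ) (c : Config n) :
    ∃ μ, run F X (fillProg base a : Program d m n) c = [⟨μ, c.st⟩] ∧
      (∀ i : Fin d, μ (base + i) = a) ∧ ∀ r, r < base ∨ base + d ≤ r → μ r = c.mem r := by
  obtain ⟨μ, h1, h2, h3⟩ := run_map_pointwise (F := F) (X := X) (List.nodup_finRange d)
    (fun i : Fin d => (Instr.const (base + i) a : Instr d m n)) (fun i => base + i) (fun _ _ => a)
    (fun i _ j _ hij h => hij (Fin.ext (by omega))) (fun i _ c => rfl) (fun _ _ _ _ _ _ _ => rfl) c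
  exact ⟨μ, h1, fun i => h2 i (List.mem_finRange i), fun r hr => h3 r fun i _ => by omega⟩

theorem fillProg_writes {base : ℕ} {a : ℝ} {ins : Instr d m n} (h : ins ∈ fillProg base a) {j : ℕ}
    (hj : ins.Writes j) : base ≤ j ∧ j < base + d := by
  simp only [fillProg, List.mem_map] at h
  obtain ⟨i, -, rfl⟩ := h
  simp only [Instr.Writes] at hj
  omega

theorem kickbackProg_writes {V : Matrix.unitaryGroup Bool ℂ} {γ : Fin m → ℝ} {js : List (Fin m)}
    {ins : Instr d m (d + 1 + m)} (h : ins ∈ kickbackProg V γ js) (j : ℕ) : ¬ ins.Writes j := by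
  simp only [kickbackProg, layerProg, phaseProg, cubeQuery, List.mem_append, List.mem_map,
    List.mem_singleton] at h
  rcases h with rfl | ⟨_, _, rfl⟩ | rfl | ⟨_, _, rfl⟩ | rfl | ⟨_, _, rfl⟩ <;>
    simp [Instr.Writes]

theorem sampleProg_writes {V : Matrix.unitaryGroup Bool ℂ} {γ : Fin m → ℝ} {js : List (Fin m)}
    {cb : ℕ} {ins : Instr d m (d + 1 + m)} (h : ins ∈ sampleProg V γ js cb) {j : ℕ}
    (hj : ins.Writes j) : (4 * d + 1 ≤ j ∧ j < 5 * d + 1) ∨ (cb ≤ j ∧ j < cb + d) := by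
  simp only [sampleProg, measureProg, countProg, List.mem_append, List.mem_map] at h
  rcases h with h | ⟨i, -, rfl⟩ | ⟨i, -, rfl⟩
  · exact absurd hj (kickbackProg_writes h j)
  all_goals simp only [Instr.Writes] at hj; omega

/-- All slopes have been estimated at the point `z` with error at most `1/τ`. -/
def Estimates (z g : EuclideanSpace ℝ (Fin d)) (τ : ℝ) (μ : Mem) : Prop :=
  readVec d μ (3 * d + 1) = z ∧ ∀ i : Fin d, Estimate d τ (g i) i μ

theorem readVec_congr {μ μ' : Mem} {base : ℕ} (h : ∀ r, base ≤ r → r < base + d → μ' r = μ r) :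
    readVec d μ' base = readVec d μ base := by
  simp only [readVec]
  congr 1
  funext i
  exact h _ (by omega) (by omega)

theorem Estimate.congr {τ g : ℝ} {i : ℕ} {μ μ' : Mem} (h : Estimate d τ g i μ)
    (h₁ : μ' (d + i) = μ (d + i)) (h₂ : μ' (7 * d + 1 + i) = μ (7 * d + 1 + i))
    (h₃ : μ' (8 * d + 1 + i) = μ (8 * d + 1 + i)) : Estimate d τ g i μ' := by
  unfold Estimate
  rw [h₁, h₂, h₃]
  exact h

theorem Estimates.congr {z g : EuclideanSpace ℝ (Fin d)} {τ : ℝ} {μ μ' : Mem}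
    (h : Estimates z g τ μ)
    (h' : ∀ r, r < 4 * d + 1 ∨ (7 * d + 1 ≤ r ∧ r < 9 * d + 1) → μ' r = μ r) :
    Estimates z g τ μ' :=
  ⟨(readVec_congr fun r _ _ => h' r (by omega)).trans h.1, fun i => (h.2 i).congr
    (h' _ (by omega)) (h' _ (by omega)) (h' _ (by omega))⟩

/-- Set the edge length of the cube and clear the counters. -/
def resetProg (σ : ℝ) : Program d m n :=
  [.const (9 * d + 1) σ] ++ (fillProg (5 * d + 1) 0 ++ fillProg (6 * d + 1) 0)

theorem ensures_resetProg (z g : EuclideanSpace ℝ (Fin d)) (τ σ : ℝ) :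
    Ensures F X (Estimates z g τ) (resetProg σ : Program d m n) (fun μ => (Estimates z g τ μ ∧
      μ (9 * d + 1) = σ) ∧ (∀ i : Fin d, μ (5 * d + 1 + i) = 0) ∧
        ∀ i : Fin d, μ (6 * d + 1 + i) = 0) := by
  intro c hc c' hc'
  obtain ⟨μ₁, r₁, h11, h12⟩ := run_fillProg (F := F) (X := X) (m := m) (5 * d + 1) 0
    ⟨Function.update c.mem (9 * d + 1) σ, c.st⟩
  obtain ⟨μ₂, r₂, h21, h22⟩ := run_fillProg (F := F) (X := X) (m := m) (6 * d + 1) 0 ⟨μ₁, c.st⟩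
  simp only [resetProg, run_append, run_singleton, step, r₁, r₂, List.flatMap_singleton,
    List.mem_singleton] at hc'
  subst hc'
  dsimp only at *
  refine ⟨⟨hc.congr fun r hr => ?_, ?_⟩, fun i => ?_, h21⟩
  · rw [h22 _ (by omega), h12 _ (by omega), Function.update_of_ne (by omega)]
  · rw [h22 _ (by omega), h12 _ (by omega), Function.update_self]
  · rw [h22 _ (by omega), h11]

/-- Run a program `M` times. -/
def repeatProg (M : ℕ) (B : Program d m n) : Program d m n := (List.replicate M B).flatten

theorem mem_repeatProg {M : ℕ} {B : Program d m n} {ins : Instr d m n}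
    (h : ins ∈ repeatProg M B) : ins ∈ B := by
  simp only [repeatProg, List.mem_flatten, List.mem_replicate] at h
  obtain ⟨l, ⟨-, rfl⟩, h⟩ := h
  exact h

/-- Refine all estimates. -/
def stageProg (γ : Fin m → ℝ) (js : List (Fin m)) (M : ℕ) (σ τ : ℝ) : Program d m (d + 1 + m) :=
  resetProg σ ++ (repeatProg M (sampleProg hadamard γ js (5 * d + 1)) ++
    (repeatProg M (sampleProg hadamardY γ js (6 * d + 1)) ++
      (List.finRange d).flatMap fun i : Fin d => decodeProg τ M i))

/-- M samples in each of the two bases fill the counters of all coordinates, each series failing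
with probability at most 2d exp(-M/10⁴); the decoding is deterministic. The phase error 1/400
perturbs the outcome probabilities by at most 1/200, as `reaches_counters` requires. -/
theorem reaches_stageProg {γ : Fin m → ℝ} {js : List (Fin m)} {M : ℕ} (hM : 0 < M) {σ τ : ℝ}
    (hτ : 0 < τ) {z g : EuclideanSpace ℝ (Fin d)} {β : ℝ}
    (hlin : ∀ u, ∃ k : ℤ, |outPhase γ js (F (vertex z σ u))
      - (β + ∑ i, if u i then τ * g i else 0) - 2 * Real.pi * k| ≤ 1 / 400) :
    Reaches F X (Estimates z g τ) (stageProg γ js M σ τ) (Estimates z g (2 * τ))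
      (4 * d * Real.exp (-M / 10000)) := by
  have hex := Real.exp_pos (-M / 10000)
  -- the two series of measurements
  have hX := reaches_counters (F := F) (X := X) (cb := 5 * d + 1)
    (B := sampleProg hadamard γ js (5 * d + 1))
    (I := fun μ => readVec d μ (3 * d + 1) = z ∧ μ (9 * d + 1) = σ)
    (q := fun i => (1 - Real.cos (τ * g i)) / 2)
    (fun i => by linarith [Real.cos_le_one (τ * g i)])
    (fun i => by linarith [Real.neg_one_le_cos (τ * g i)])
    (fun c hc c' hc' => by
      have hf : ∀ r, r < 4 * d + 1 ∨ r = 9 * d + 1 → c'.mem r = c.mem r := fun r hr =>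
        run_mem_of_not_writes hc' fun i hi hw => by
          rcases sampleProg_writes hi hw with h | h <;> omega
      exact ⟨(readVec_congr fun r _ _ => hf r (by omega)).trans hc.1, (hf _ (by omega)).trans hc.2⟩)
    (fun i c hc => by
      obtain ⟨P₁, h1, h2⟩ := ev_sampleProg (F := F) (X := X) hadamard γ js (cb := 5 * d + 1) le_rfl
        c i (fun i => τ * g i) β (1 / 400) (by norm_num) (by rw [hc.1, hc.2]; exact hlin)
      rw [norm_sq_hadamard] at h1
      exact ⟨P₁, by linarith, h2⟩) M
  have hY := reaches_counters (F := F) (X := X) (cb := 6 * d + 1)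
    (B := sampleProg hadamardY γ js (6 * d + 1))
    (I := fun μ => readVec d μ (3 * d + 1) = z ∧ μ (9 * d + 1) = σ)
    (q := fun i => (1 - Real.sin (τ * g i)) / 2)
    (fun i => by linarith [Real.sin_le_one (τ * g i)])
    (fun i => by linarith [Real.neg_one_le_sin (τ * g i)])
    (fun c hc c' hc' => by
      have hf : ∀ r, r < 4 * d + 1 ∨ r = 9 * d + 1 → c'.mem r = c.mem r := fun r hr =>
        run_mem_of_not_writes hc' fun i hi hw => by
          rcases sampleProg_writes hi hw with h | h <;> omega
      exact ⟨(readVec_congr fun r _ _ => hf r (by omega)).trans hc.1, (hf _ (by omega)).trans hc.2⟩)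
    (fun i c hc => by
      obtain ⟨P₁, h1, h2⟩ := ev_sampleProg (F := F) (X := X) hadamardY γ js (cb := 6 * d + 1)
        (by omega) c i (fun i => τ * g i) β (1 / 400) (by norm_num)
        (by rw [hc.1, hc.2]; exact hlin)
      rw [norm_sq_hadamardY] at h1
      exact ⟨P₁, by linarith, h2⟩) M
  have hX' : Reaches F X (fun μ => (Estimates z g τ μ ∧ μ (9 * d + 1) = σ) ∧
      (∀ i : Fin d, μ (5 * d + 1 + i) = 0) ∧ ∀ i : Fin d, μ (6 * d + 1 + i) = 0)
      (repeatProg M (sampleProg hadamard γ js (5 * d + 1)))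
      (fun μ => (∀ i : Fin d, |μ (5 * d + 1 + i) - M * ((1 - Real.cos (τ * g i)) / 2)|
        ≤ 3 / 100 * M) ∧ (Estimates z g τ μ ∧ μ (9 * d + 1) = σ)
          ∧ ∀ i : Fin d, μ (6 * d + 1 + i) = 0) (2 * d * Real.exp (-M / 10000)) := by
    refine (hX.mono (fun μ h => ⟨⟨h.1.1.1, h.1.2⟩, h.2.1⟩) (fun _ h => h) le_rfl).and ?_
    intro c hc c' hc'
    have hf : ∀ r, r < 4 * d + 1 ∨ 6 * d + 1 ≤ r → c'.mem r = c.mem r := fun r hr =>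
      run_mem_of_not_writes hc' fun i hi hw => by
        rcases sampleProg_writes (mem_repeatProg hi) hw with h | h <;> omega
    exact ⟨⟨hc.1.1.congr fun r hr => hf r (by omega), (hf _ (by omega)).trans hc.1.2⟩,
      fun i => (hf _ (by omega)).trans (hc.2.2 i)⟩
  have hY' : Reaches F X (fun μ => (∀ i : Fin d, |μ (5 * d + 1 + i)
      - M * ((1 - Real.cos (τ * g i)) / 2)| ≤ 3 / 100 * M) ∧ (Estimates z g τ μ ∧
        μ (9 * d + 1) = σ) ∧ ∀ i : Fin d, μ (6 * d + 1 + i) = 0)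
      (repeatProg M (sampleProg hadamardY γ js (6 * d + 1)))
      (fun μ => readVec d μ (3 * d + 1) = z ∧ ∀ i ∈ List.finRange d,
        Estimate d τ (g i) i μ ∧ Counted d M τ (g i) i μ) (2 * d * Real.exp (-M / 10000)) := by
    refine ((hY.mono (I' := fun μ => (∀ i : Fin d, |μ (5 * d + 1 + i)
      - M * ((1 - Real.cos (τ * g i)) / 2)| ≤ 3 / 100 * M) ∧ (Estimates z g τ μ ∧
        μ (9 * d + 1) = σ) ∧ ∀ i : Fin d, μ (6 * d + 1 + i) = 0)
      (fun μ h => ⟨⟨h.2.1.1.1, h.2.1.2⟩, h.2.2⟩) (fun _ h => h) le_rfl).and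
      (J' := fun μ => Estimates z g τ μ ∧ ∀ i : Fin d, |μ (5 * d + 1 + i)
      - M * ((1 - Real.cos (τ * g i)) / 2)| ≤ 3 / 100 * M) ?_).mono (fun _ h => h)
        (fun μ h => ⟨h.2.1.1, fun i _ => ⟨h.2.1.2 i, h.2.2 i, h.1 i⟩⟩) le_rfl
    intro c hc c' hc'
    have hf : ∀ r, r < 4 * d + 1 ∨ (5 * d + 1 ≤ r ∧ r < 6 * d + 1) ∨ 7 * d + 1 ≤ r →
        c'.mem r = c.mem r := fun r hr =>
      run_mem_of_not_writes hc' fun i hi hw => by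
        rcases sampleProg_writes (mem_repeatProg hi) hw with h | h <;> omega
    exact ⟨hc.2.1.1.congr fun r hr => hf r (by omega), fun i => by
      rw [hf _ (by omega)]; exact hc.1 i⟩
  have hD : Ensures F X (fun μ => readVec d μ (3 * d + 1) = z ∧ ∀ i ∈ List.finRange d,
        Estimate d τ (g i) i μ ∧ Counted d M τ (g i) i μ)
      ((List.finRange d).flatMap fun i : Fin d => decodeProg τ M i : Program d m (d + 1 + m))
      (Estimates z g (2 * τ)) := by
    have hframe : ∀ i j : Fin d, i ≠ j → ∀ c c' : Config (d + 1 + m),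
        c' ∈ run F X (decodeProg τ M i : Program d m (d + 1 + m)) c →
        c'.mem (d + j) = c.mem (d + j) ∧ c'.mem (5 * d + 1 + j) = c.mem (5 * d + 1 + j) ∧
        c'.mem (6 * d + 1 + j) = c.mem (6 * d + 1 + j) ∧
        c'.mem (7 * d + 1 + j) = c.mem (7 * d + 1 + j) ∧
        c'.mem (8 * d + 1 + j) = c.mem (8 * d + 1 + j) := by
      intro i j hij c c' hc'
      have hij' : (i : ℕ) ≠ j := fun h => hij (Fin.ext h)
      refine ⟨?_, ?_, ?_, ?_, ?_⟩ <;> refine run_mem_of_not_writes hc' fun ins hi hw => ?_ <;>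
        have := decodeProg_writes hi hw <;> omega
    have h1 := ensures_flatMap (F := F) (X := X) (List.nodup_finRange d)
      (B := fun i : Fin d => (decodeProg τ M i : Program d m (d + 1 + m)))
      (I := fun i μ => Estimate d τ (g i) i μ ∧ Counted d M τ (g i) i μ)
      (J := fun i μ => Estimate d (2 * τ) (g i) i μ)
      (fun i _ => ensures_decodeProg hτ hM i.2)
      (fun i _ j _ hij c hc c' hc' => by
        obtain ⟨h1, h2, h3, h4, h5⟩ := hframe i j hij c c' hc'
        refine ⟨hc.1.congr h1 h4 h5, ?_⟩
        unfold Counted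
        rw [h2, h3]
        exact hc.2)
      (fun i _ j _ hij c hc c' hc' => by
        obtain ⟨h1, h2, h3, h4, h5⟩ := hframe i j hij c c' hc'
        exact hc.congr h1 h4 h5)
    intro c hc c' hc'
    refine ⟨(readVec_congr fun r h h' => run_mem_of_not_writes hc' fun ins hi hw => ?_).trans hc.1,
      fun i => h1 c hc.2 c' hc' i (List.mem_finRange i)⟩
    obtain ⟨i, -, hi⟩ := List.mem_flatMap.1 hi
    have := decodeProg_writes hi hw
    omega
  have h0 : (0 : ℝ) ≤ 2 * d * Real.exp (-M / 10000) := by positivity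
  exact ((ensures_resetProg z g τ σ).reaches.seq le_rfl (by linarith)
    (hX'.seq h0 (by linarith) (hY'.seq h0 le_rfl hD.reaches))).mono (fun _ h => h) (fun _ h => h)
      (by linarith)

theorem stageProg_writes {γ : Fin m → ℝ} {js : List (Fin m)} {M : ℕ} {σ τ : ℝ}
    {ins : Instr d m (d + 1 + m)} (h : ins ∈ stageProg γ js M σ τ) {j : ℕ} (hj : ins.Writes j) :
    (d ≤ j ∧ j < 2 * d) ∨ 4 * d + 1 ≤ j := by
  simp only [stageProg, resetProg, List.mem_append, List.mem_singleton] at h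
  rcases h with (rfl | h | h) | h | h | h
  · simp only [Instr.Writes] at hj; omega
  · have := fillProg_writes h hj; omega
  · have := fillProg_writes h hj; omega
  · have := sampleProg_writes (mem_repeatProg h) hj; omega
  · have := sampleProg_writes (mem_repeatProg h) hj; omega
  · obtain ⟨i, -, hi⟩ := List.mem_flatMap.1 h
    have := decodeProg_writes hi hj
    omega

end Stage

/-! ### Sampling a random grid point near the iterate -/

section Sampling

variable {d m n : ℕ} {F : EuclideanSpace ℝ (Fin d) → BitVec m} {X : Set (EuclideanSpace ℝ (Fin d))}

/-- Toss a coin and accordingly add `w` to the `i`-th coordinate of the vector stored from register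
`3d + 1` on. -/
def coinProg (i : Fin d) (w : ℝ) : Program d m (d + 1 + m) :=
  [.fresh] ++ (layerProg hadamard [i] ++ (measureProg [i] ++ [.const (9 * d + 3) w,
    .mul (9 * d + 2) (4 * d + 1 + i) (9 * d + 3), .add (3 * d + 1 + i) (3 * d + 1 + i) (9 * d + 2)]))

/-- A Hadamard gate on a fresh qubit gives a fair coin. The formula holds for every functional of
the stored vector, so that successive tosses compose into an average over the grid. -/
theorem ev_coinProg (i : Fin d) (w : ℝ) (c : Config (d + 1 + m))
    (Φ : EuclideanSpace ℝ (Fin d) → ℝ) :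
    ev F X (coinProg i w) c (fun c' => Φ (readVec d c'.mem (3 * d + 1)) * normSq c'.st)
      = (1 / 2 * (Φ (readVec d c.mem (3 * d + 1))
        + Φ (readVec d c.mem (3 * d + 1) + EuclideanSpace.single i w))) * normSq c.st := by
  classical
  set z := readVec d c.mem (3 * d + 1) with hz
  have htail : ∀ c' : Config (d + 1 + m), ev F X [.const (9 * d + 3) w,
      .mul (9 * d + 2) (4 * d + 1 + i) (9 * d + 3),
      .add (3 * d + 1 + i) (3 * d + 1 + i) (9 * d + 2)] c'
      (fun c' => Φ (readVec d c'.mem (3 * d + 1)) * normSq c'.st)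
        = (fun μ : Mem => Φ (readVec d μ (3 * d + 1)
          + EuclideanSpace.single i (μ (4 * d + 1 + i) * w))) c'.mem * normSq c'.st := by
    intro c'
    simp only [ev, run, step, List.flatMap_singleton, List.map_singleton, List.sum_singleton]
    congr 2
    ext j
    simp only [readVec, PiLp.add_apply, PiLp.single_apply]
    by_cases hj : j = i
    · subst hj
      simp (disch := omega) only [Function.update_self, Function.update_of_ne, if_true]
    · have hj' : (j : ℕ) ≠ i := fun h => hj (Fin.ext h)
      simp (disch := omega) only [Function.update_of_ne]
      simp [hj]
  have hl := layer_prodState (m := m) hadamard (List.nodup_singleton i) ((√(normSq c.st) : ℝ) : ℂ)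
    fun _ v => if v then 0 else 1
  rw [← zeroState_eq_prodState] at hl
  set χ : Fin (d + 1 + m) → Bool → ℂ := fun q v => if ∃ i' ∈ [i], idxQ m i' = q then
    ∑ a, (hadamard : Matrix Bool Bool ℂ) v a * (if a then 0 else 1) else if v then 0 else 1 with hχ
  have hχ1 : ∀ q, ∑ v, ‖χ q v‖ ^ 2 = 1 := by
    intro q
    simp only [χ]
    split_ifs
    · rw [sum_norm_sq_unitary hadamard fun a => if a then (0 : ℂ) else 1]
      simp
    · simp
  have hχ2 : ‖χ (idxQ m i) true‖ ^ 2 = 1 / 2 := by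
    simp [χ, hadamard]
  have h1 := sum_ite_norm_prodState χ hχ1 (idxQ m i)
  have h2 := normSq_prodState χ hχ1
  rw [hχ2] at h1
  rw [coinProg, ev_append_of_run_eq (run_singleton _ _), ev_append_of_run_eq (run_layerProg _ _ _)]
  dsimp only
  rw [hl, ev_append]
  simp only [htail]
  rw [ev_measureProg (F := F) (X := X) [i] _ (fun μ : Mem => Φ (readVec d μ (3 * d + 1)
          + EuclideanSpace.single i (μ (4 * d + 1 + i) * w)))]
  have h3 : ∀ s : Bits (d + 1 + m), readVec d (recordBits [i] s c.mem) (3 * d + 1) = z := fun s =>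
    readVec_congr fun r _ _ => recordBits_of_notMem _ _ _ fun j _ => by omega
  simp only [h3, recordBits_of_mem (List.nodup_singleton i) _ _ (List.mem_singleton_self i)]
  have h4 : ∀ s : Bits (d + 1 + m),
      Φ (z + EuclideanSpace.single i ((if s (idxQ m i) then 1 else 0) * w))
        * ‖((√(normSq c.st) : ℝ) : ℂ) * prodState χ s‖ ^ 2
      = normSq c.st * (Φ z * ‖prodState χ s‖ ^ 2 + (Φ (z + EuclideanSpace.single i w) - Φ z)
        * if s (idxQ m i) then ‖prodState χ s‖ ^ 2 else 0) := by
    intro s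
    rw [norm_mul, mul_pow, Complex.norm_real, Real.norm_eq_abs, sq_abs,
      Real.sq_sqrt (normSq_nonneg _)]
    have h5 : (EuclideanSpace.single i (0 : ℝ) : EuclideanSpace ℝ (Fin d)) = 0 := by
      ext j; simp
    cases s (idxQ m i) <;> simp [h5] <;> ring
  rw [Finset.sum_congr rfl fun s _ => h4 s, ← Finset.mul_sum, Finset.sum_add_distrib,
    ← Finset.mul_sum, ← Finset.mul_sum, h1]
  rw [normSq] at h2
  rw [h2]
  ring

/-- Add a uniformly random multiple `0, …, 2 ^ a - 1` of `h` to the `i`-th coordinate. -/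
def shiftProg (a : ℕ) (h : ℝ) (i : Fin d) : Program d m (d + 1 + m) :=
  (List.range a).flatMap fun k => coinProg i (h * 2 ^ k)

theorem single_add_single (i : Fin d) (a b : ℝ) : (EuclideanSpace.single i a :
    EuclideanSpace ℝ (Fin d)) + EuclideanSpace.single i b = EuclideanSpace.single i (a + b) := by
  ext k
  by_cases hk : k = i
  · subst hk; simp
  · simp [hk]

/-- Coins of weights h, 2h, 4h, ... are the binary digits of a uniform integer; in the induction the
new coin is the top digit and splits the range into halves. -/
theorem ev_shiftProg (a : ℕ) (h : ℝ) (i : Fin d) (c : Config (d + 1 + m))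
    (Φ : EuclideanSpace ℝ (Fin d) → ℝ) :
    ev F X (shiftProg a h i) c (fun c' => Φ (readVec d c'.mem (3 * d + 1)) * normSq c'.st)
      = ((1 / (2 ^ a : ℕ) : ℝ) * ∑ v ∈ Finset.range (2 ^ a),
        Φ (readVec d c.mem (3 * d + 1) + EuclideanSpace.single i (h * v))) * normSq c.st := by
  induction a generalizing Φ with
  | zero =>
    have h5 : (EuclideanSpace.single i (0 : ℝ) : EuclideanSpace ℝ (Fin d)) = 0 := by
      ext j; simp
    simp [shiftProg, ev_nil, h5]
  | succ a ih =>
    have e : (shiftProg (a + 1) h i : Program d m (d + 1 + m))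
        = shiftProg a h i ++ coinProg i (h * 2 ^ a) := by
      simp [shiftProg, List.range_succ]
    rw [e, ev_append]
    simp only [ev_coinProg]
    rw [ih fun y => 1 / 2 * (Φ y + Φ (y + EuclideanSpace.single i (h * 2 ^ a)))]
    rw [pow_succ, mul_two, Finset.sum_range_add]
    simp only [add_assoc, single_add_single, ← Finset.mul_sum, Finset.sum_add_distrib]
    have e2 : ∀ v : ℕ, h * (v : ℝ) + h * 2 ^ a = h * ((2 ^ a + v : ℕ) : ℝ) := by
      intro v; push_cast; ring
    simp only [e2]
    push_cast
    field_simp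
    ring

/-- Move the vector stored from register `3d + 1` on to a random grid point. -/
def shiftsProg (a : ℕ) (h : ℝ) (l : List (Fin d)) : Program d m (d + 1 + m) :=
  l.flatMap (shiftProg a h)

theorem ev_shiftsProg (a : ℕ) (h : ℝ) (l : List (Fin d)) (c : Config (d + 1 + m))
    (Φ : EuclideanSpace ℝ (Fin d) → ℝ) :
    ev F X (shiftsProg a h l) c (fun c' => Φ (readVec d c'.mem (3 * d + 1)) * normSq c'.st)
      = gridAvg (2 ^ a) h l Φ (readVec d c.mem (3 * d + 1)) * normSq c.st := by
  induction l generalizing c with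
  | nil => simp [shiftsProg, ev_nil, gridAvg]
  | cons i l ih =>
    rw [shiftsProg, List.flatMap_cons, ← shiftsProg, ev_append]
    simp only [ih]
    rw [ev_shiftProg, gridAvg]

/-- Every grid point lies in the box. Applied to the indicator of the complement of the box, this
shows that the random point never leaves it. -/
theorem gridAvg_eq_zero {N : ℕ} {h : ℝ} (hh : 0 ≤ h) {l : List (Fin d)} (hl : l.Nodup)
    {Φ : EuclideanSpace ℝ (Fin d) → ℝ} (z : EuclideanSpace ℝ (Fin d))
    (hΦ : ∀ y, (∀ i, z i ≤ y i ∧ y i ≤ z i + if i ∈ l then h * N else 0) → Φ y = 0) :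
    gridAvg N h l Φ z = 0 := by
  induction l generalizing z with
  | nil => exact hΦ z fun i => by simp
  | cons j l ih =>
    rw [List.nodup_cons] at hl
    rw [gridAvg, Finset.sum_eq_zero, mul_zero]
    intro v hv
    have hv' : (v : ℝ) ≤ N := by exact_mod_cast (Finset.mem_range.1 hv).le
    have h1 : h * v ≤ h * N := by gcongr
    have h0 : 0 ≤ h * v := by positivity
    refine ih hl.2 _ fun y hy => hΦ y fun i => ?_
    have h2 := hy i
    by_cases hij : i = j
    · subst hij
      simp only [hl.1, PiLp.add_apply, PiLp.single_apply, if_true, if_false, List.mem_cons,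
        true_or] at h2 ⊢
      constructor <;> linarith
    · simpa [hij] using h2

/-- Copy the iterate and move the copy to a random grid point. -/
def pointProg (a : ℕ) (h : ℝ) : Program d m (d + 1 + m) :=
  [.const (9 * d + 2) 0] ++ ((List.finRange d).map (fun i : Fin d =>
    .add (3 * d + 1 + i) i (9 * d + 2)) ++ shiftsProg a h (List.finRange d))

/-- Markov's inequality: each coordinate has mean second difference at most 2Gh/2^a, hence so has
the average over the coordinates, and it is compared with θ. -/
theorem reaches_pointProg {f : EuclideanSpace ℝ (Fin d) → ℝ} {G h θ : ℝ} {a : ℕ} (hd : 0 < d)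
    (hf : ConvexOn ℝ Set.univ f) (hG : 0 < G) (hL : LipschitzWith G.toNNReal f) (hh : 0 < h)
    (hθ : 0 < θ) (x : EuclideanSpace ℝ (Fin d)) :
    Reaches F X (fun μ => readVec d μ 0 = x) (pointProg a h : Program d m (d + 1 + m))
      (fun μ => (∀ i, x i ≤ readVec d μ (3 * d + 1) i ∧
        readVec d μ (3 * d + 1) i ≤ x i + h * 2 ^ a) ∧
          (1 / d) * ∑ i, secDiff f h i (readVec d μ (3 * d + 1)) ≤ θ)
      (2 * G * h / (2 ^ a * θ)) := by
  classical
  have hd' : (0 : ℝ) < d := by exact_mod_cast hd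
  have hcopy : Ensures F X (fun μ => readVec d μ 0 = x) ([.const (9 * d + 2) 0] ++
      (List.finRange d).map (fun i : Fin d => .add (3 * d + 1 + i) i (9 * d + 2)) :
        Program d m (d + 1 + m)) (fun μ => readVec d μ (3 * d + 1) = x) := by
    intro c hc c' hc'
    obtain ⟨μ, h1, h2, -⟩ := run_map_pointwise (F := F) (X := X) (List.nodup_finRange d)
      (fun i : Fin d => (.add (3 * d + 1 + i) i (9 * d + 2) : Instr d m (d + 1 + m)))
      (fun i => 3 * d + 1 + i) (fun i μ => μ i + μ (9 * d + 2))
      (fun i _ j _ hij h => hij (Fin.ext (by omega))) (fun i _ c => rfl)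
      (fun i _ j _ hij μ x => by
        rw [Function.update_of_ne (by omega), Function.update_of_ne (by omega)])
      ⟨Function.update c.mem (9 * d + 2) 0, c.st⟩
    simp only [run_append, run_singleton, step, h1, List.flatMap_singleton,
      List.mem_singleton] at hc'
    subst hc'
    rw [← hc]
    simp only [readVec]
    congr 1
    funext i
    rw [h2 i (List.mem_finRange i)]
    dsimp only
    rw [Function.update_self, Function.update_of_ne (by omega)]
    simp
  -- One weight for both ways to fail: it is at least 1 if the second differences exceed θ or if the
  -- point leaves the box, and the indicator contributes nothing to the mean.
  let w : EuclideanSpace ℝ (Fin d) → ℝ := fun y => θ⁻¹ * ((1 / d) * ∑ i, secDiff f h i y)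
    + if ∀ i, x i ≤ y i ∧ y i ≤ x i + h * 2 ^ a then 0 else 1
  have hsec : ∀ y, 0 ≤ θ⁻¹ * ((1 / d) * ∑ i, secDiff f h i y) := fun y =>
    mul_nonneg (by positivity) (mul_nonneg (by positivity)
      (Finset.sum_nonneg fun i _ => secDiff_nonneg hf h i y))
  have hw0 : ∀ y, 0 ≤ w y := by
    intro y
    refine add_nonneg (hsec y) ?_
    split_ifs <;> norm_num
  have havg : gridAvg (2 ^ a) h (List.finRange d) w x ≤ 2 * G * h / (2 ^ a * θ) := by
    have hN : 0 < 2 ^ a := by positivity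
    simp only [w]
    rw [gridAvg_add, gridAvg_const_mul, gridAvg_const_mul, gridAvg_sum,
      gridAvg_eq_zero hh.le (List.nodup_finRange d) x, add_zero]
    · have h1 : ∑ i, gridAvg (2 ^ a) h (List.finRange d) (secDiff f h i) x
          ≤ d * (2 * G * h / (2 ^ a : ℕ)) := by
        refine (Finset.sum_le_card_nsmul _ _ _ fun i _ =>
          gridAvg_secDiff_le hN hG hL hh (List.mem_finRange i) x).trans (le_of_eq ?_)
        simp
      calc _ ≤ θ⁻¹ * ((1 / d) * (d * (2 * G * h / (2 ^ a : ℕ)))) := by gcongr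
        _ = _ := by push_cast; field_simp
    · intro y hy
      rw [if_pos]
      intro i
      simpa using hy i
  have hshift : Reaches F X (fun μ => readVec d μ (3 * d + 1) = x)
      (shiftsProg a h (List.finRange d) : Program d m (d + 1 + m))
      (fun μ => (∀ i, x i ≤ readVec d μ (3 * d + 1) i ∧
        readVec d μ (3 * d + 1) i ≤ x i + h * 2 ^ a) ∧
          (1 / d) * ∑ i, secDiff f h i (readVec d μ (3 * d + 1)) ≤ θ)
      (((Finset.univ : Finset Unit).card : ℝ) * (2 * G * h / (2 ^ a * θ))) := by
    refine reaches_of_forall_expect Finset.univ (fun _ μ => w (readVec d μ (3 * d + 1)))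
      (fun _ μ => hw0 _) ?_ ?_
    · intro c _ c' _ hJ
      refine ⟨(), Finset.mem_univ _, ?_⟩
      by_cases hbox : ∀ i, x i ≤ readVec d c'.mem (3 * d + 1) i ∧
        readVec d c'.mem (3 * d + 1) i ≤ x i + h * 2 ^ a
      · have h1 : ¬ (1 / d) * ∑ i, secDiff f h i (readVec d c'.mem (3 * d + 1)) ≤ θ :=
          fun h => hJ ⟨hbox, h⟩
        push Not at h1
        simp only [w, if_pos hbox, add_zero]
        rw [inv_mul_eq_div, one_le_div hθ]
        exact h1.le
      · simp only [w, if_neg hbox]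
        linarith [hsec (readVec d c'.mem (3 * d + 1))]
    · intro _ _ c hc
      rw [ev_shiftsProg, hc]
      exact mul_le_mul_of_nonneg_right havg (normSq_nonneg _)
  rw [pointProg, ← List.append_assoc]
  exact (hcopy.reaches.seq le_rfl (by positivity) hshift).mono (fun _ h => h) (fun _ h => h)
    (by simp)

theorem pointProg_writes {a : ℕ} {h : ℝ} {ins : Instr d m (d + 1 + m)}
    (hi : ins ∈ (pointProg a h : Program d m (d + 1 + m))) {j : ℕ} (hj : ins.Writes j) :
    3 * d + 1 ≤ j := by
  simp only [pointProg, shiftsProg, shiftProg, coinProg, layerProg, measureProg, List.mem_append,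
    List.mem_map, List.mem_flatMap, List.mem_cons, List.not_mem_nil, or_false] at hi
  rcases hi with rfl | ⟨i, _, rfl⟩ | ⟨i, _, k, _, rfl | ⟨_, _, rfl⟩ | ⟨_, _, rfl⟩ | rfl | rfl | rfl⟩ <;>
    simp only [Instr.Writes] at hj <;> omega

end Sampling

/-! ### Reading a phase off the output qubits -/

section Window

variable {m : ℕ}

/-- Weight of the `j`-th bit in two's complement. -/
def bitWeight (m : ℕ) (j : Fin m) : ℤ := if (j : ℕ) + 1 = m then -2 ^ (j : ℕ) else 2 ^ (j : ℕ)

theorem sum_testBit_eq_mod (x m : ℕ) :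
    ∑ j ∈ Finset.range m, (if x.testBit j then 2 ^ j else 0) = x % 2 ^ m := by
  induction m with
  | zero => simp [Nat.mod_one]
  | succ m ih =>
    rw [Finset.sum_range_succ, ih, Nat.mod_pow_succ, Nat.testBit_eq_decide_div_mod_eq]
    rcases Nat.mod_two_eq_zero_or_one (x / 2 ^ m) with h | h <;> simp [h]

/-- Two's complement is the unsigned value minus 2^m if the top bit is set, which changes the weight
of that bit from 2^(m-1) to -2^(m-1). -/
theorem toInt_eq_sum_bitWeight (v : BitVec m) :
    v.toInt = ∑ j : Fin m, if v.getLsbD j then bitWeight m j else 0 := by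
  have h1 : (v.toNat : ℤ) = ∑ j : Fin m, if v.getLsbD j then (2 : ℤ) ^ (j : ℕ) else 0 := by
    have := sum_testBit_eq_mod v.toNat m
    rw [Nat.mod_eq_of_lt v.isLt, ← Fin.sum_univ_eq_sum_range
      (fun j => if v.toNat.testBit j then 2 ^ j else 0)] at this
    rw [← this]
    push_cast
    rfl
  rw [BitVec.toInt_eq_msb_cond]
  cases m with
  | zero => simp [BitVec.eq_nil v]
  | succ m =>
    have h2 : ∑ j : Fin (m + 1), (if v.getLsbD j then bitWeight (m + 1) j else 0)
        = (∑ j : Fin (m + 1), if v.getLsbD j then (2 : ℤ) ^ (j : ℕ) else 0)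
          - if v.getLsbD m then 2 ^ (m + 1) else 0 := by
      rw [Fin.sum_univ_castSucc, Fin.sum_univ_castSucc]
      have h3 : ∀ j : Fin m, bitWeight (m + 1) j.castSucc = 2 ^ (j : ℕ) := by
        intro j
        have := j.2
        simp [bitWeight, j.2.ne]
      simp only [h3, Fin.val_castSucc]
      simp only [bitWeight, Fin.val_last, if_true]
      split_ifs <;> ring
    rw [h2, ← h1, BitVec.msb_eq_getLsbD_last]
    simp only [Nat.add_sub_cancel]
    split_ifs <;> simp

/-- The bits that matter for the phase `2π 2 ^ e y` to accuracy `2π / 2 ^ 14`, where `y` has `p`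
fractional bits. -/
def window (m p : ℕ) (e : ℤ) : List (Fin m) :=
  (List.finRange m).filter fun j => -14 ≤ e + (j : ℕ) - p ∧ e + (j : ℕ) - p < 0

/-- The phases that encode `2π 2 ^ e y`. -/
def windowPhase (m p : ℕ) (e : ℤ) (j : Fin m) : ℝ :=
  2 * Real.pi * (2 ^ e * bitWeight m j / 2 ^ p)

theorem length_window_le (m p : ℕ) (e : ℤ) : (window m p e).length ≤ 14 := by
  have hn : (window m p e).Nodup := (List.nodup_finRange m).filter _
  rw [← List.toFinset_card_of_nodup hn, show 14 = (Finset.Ico (-14 : ℤ) 0).card by simp]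
  refine Finset.card_le_card_of_injOn (fun j : Fin m => e + (j : ℕ) - p) ?_ ?_
  · intro j hj
    simpa [window] using hj
  · intro i _ j _ hij
    simp only at hij
    exact Fin.ext (by omega)

/-- A geometric series. The induction needs both bounds: the sum stays below the weight of the next
bit, and that weight is at most 2^(-14) whenever a term has been added. -/
theorem sum_low_bits_le (e : ℤ) (p m : ℕ) :
    ∑ j ∈ Finset.range m, (if e + (j : ℕ) - p < -14 then (2 : ℝ) ^ (e + (j : ℕ) - p) else 0)
      ≤ 2 ^ (-14 : ℤ) := by
  suffices h : ∑ j ∈ Finset.range m,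
      (if e + (j : ℕ) - p < -14 then (2 : ℝ) ^ (e + (j : ℕ) - p) else 0)
        ≤ 2 ^ (e + m - p) ∧ ∑ j ∈ Finset.range m,
      (if e + (j : ℕ) - p < -14 then (2 : ℝ) ^ (e + (j : ℕ) - p) else 0) ≤ 2 ^ (-14 : ℤ) from h.2
  induction m with
  | zero => simp; positivity
  | succ m ih =>
    rw [Finset.sum_range_succ]
    have hs : (2 : ℝ) ^ (e + ((m + 1 : ℕ) : ℤ) - p) = 2 * 2 ^ (e + (m : ℤ) - p) := by
      rw [show e + ((m + 1 : ℕ) : ℤ) - p = (e + m - p) + 1 by push_cast; ring,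
        zpow_add_one₀ (by norm_num)]
      ring
    have hpos : (0 : ℝ) < 2 ^ (e + (m : ℤ) - p) := by positivity
    split_ifs with h
    · have h1 : (2 : ℝ) ^ (e + ((m + 1 : ℕ) : ℤ) - p) ≤ 2 ^ (-14 : ℤ) :=
        zpow_le_zpow_right₀ (by norm_num) (by push_cast; omega)
      constructor <;> linarith [ih.1]
    · exact ⟨by linarith [ih.1], by linarith [ih.2]⟩

/-- Bits of weight at least one turn contribute integer multiples of 2π and can be ignored,
including the negative sign bit; bits of weight below 2^(-14) turns add up to at most 2^(-14) turns.
At most 14 bits lie in between. -/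
theorem outPhase_window (p : ℕ) (e : ℤ) (v : BitVec m) :
    ∃ k : ℤ, |outPhase (windowPhase m p e) (window m p e) v - 2 * Real.pi * 2 ^ e * fixedPoint p v
      - 2 * Real.pi * k| ≤ 2 * Real.pi * 2 ^ (-14 : ℤ) := by
  have hfilter : ∀ (l : List (Fin m)) (P : Fin m → Prop) [DecidablePred P] (f : Fin m → ℝ),
      ((l.filter P).map f).sum = (l.map fun j => if P j then f j else 0).sum := by
    intro l P _ f
    induction l with
    | nil => simp
    | cons a l ih => by_cases h : P a <;> simp [h, ih]
  let t : Fin m → ℝ := fun j => if v.getLsbD j then 2 ^ e * bitWeight m j / 2 ^ p else 0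
  have h1 : outPhase (windowPhase m p e) (window m p e) v = 2 * Real.pi * ∑ j : Fin m,
      if -14 ≤ e + ((j : ℕ) : ℤ) - p ∧ e + ((j : ℕ) : ℤ) - p < 0 then t j else 0 := by
    rw [outPhase, window, hfilter, ← Fin.sum_univ_def, Finset.mul_sum]
    refine Finset.sum_congr rfl fun j _ => ?_
    simp only [t, windowPhase]
    split_ifs <;> simp
  have h2 : 2 ^ e * fixedPoint p v = ∑ j, t j := by
    rw [fixedPoint, toInt_eq_sum_bitWeight, mul_div_assoc', Int.cast_sum, Finset.mul_sum,
      Finset.sum_div]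
    refine Finset.sum_congr rfl fun j _ => ?_
    simp only [t]
    split_ifs <;> simp
  have hpow : ∀ j : Fin m, (2 : ℝ) ^ e * 2 ^ (j : ℕ) / 2 ^ p = 2 ^ (e + ((j : ℕ) : ℤ) - p) := by
    intro j
    rw [zpow_sub₀ (by norm_num), zpow_add₀ (by norm_num), zpow_natCast, zpow_natCast]
  have habs : ∀ j : Fin m, |t j| ≤ 2 ^ (e + ((j : ℕ) : ℤ) - p) := by
    intro j
    simp only [t]
    split_ifs with h
    · rw [← hpow]
      unfold bitWeight
      split_ifs
      · push_cast
        rw [abs_div, abs_mul, abs_neg, abs_of_pos (by positivity : (0 : ℝ) < 2 ^ e),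
          abs_of_pos (by positivity : (0 : ℝ) < 2 ^ (j : ℕ)),
          abs_of_pos (by positivity : (0 : ℝ) < 2 ^ p)]
      · push_cast
        rw [abs_of_pos (by positivity)]
    · simp; positivity
  have h_integer : ∀ j : Fin m, ∃ k : ℤ, (if 0 ≤ e + ((j : ℕ) : ℤ) - p then t j else 0) = k := by
    intro j
    split_ifs with h
    · simp only [t]
      split_ifs
      · obtain ⟨N, hN⟩ := Int.eq_ofNat_of_zero_le h
        have h3 := hpow j
        rw [hN, zpow_natCast] at h3
        unfold bitWeight
        split_ifs
        · refine ⟨-2 ^ N, ?_⟩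
          push_cast
          rw [← h3]; ring
        · refine ⟨2 ^ N, ?_⟩
          push_cast
          rw [← h3]
      · exact ⟨0, by simp⟩
    · exact ⟨0, by simp⟩
  choose k hk using h_integer
  refine ⟨-∑ j, k j, ?_⟩
  have h4 : outPhase (windowPhase m p e) (window m p e) v - 2 * Real.pi * 2 ^ e * fixedPoint p v
      - 2 * Real.pi * ((-∑ j, k j : ℤ) : ℝ)
      = 2 * Real.pi * -∑ j : Fin m, if e + ((j : ℕ) : ℤ) - p < -14 then t j else 0 := by
    rw [mul_assoc (2 * Real.pi), h1, h2]
    push_cast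
    simp only [← hk]
    rw [← mul_sub, ← mul_sub, ← Finset.sum_neg_distrib, ← Finset.sum_neg_distrib,
      ← Finset.sum_sub_distrib, ← Finset.sum_sub_distrib]
    congr 1
    refine Finset.sum_congr rfl fun j _ => ?_
    by_cases ha : 0 ≤ e + ((j : ℕ) : ℤ) - p
    · rw [if_neg (by omega), if_pos ha, if_neg (by omega)]; ring
    · by_cases hb : e + ((j : ℕ) : ℤ) - p < -14
      · rw [if_neg (by omega), if_neg ha, if_pos hb]; ring
      · rw [if_pos (by omega), if_neg ha, if_neg hb]; ring
  rw [h4, abs_mul, abs_neg, abs_of_pos Real.two_pi_pos]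
  refine mul_le_mul_of_nonneg_left ?_ Real.two_pi_pos.le
  refine (Finset.abs_sum_le_sum_abs _ _).trans (le_trans ?_ (sum_low_bits_le e p m))
  rw [← Fin.sum_univ_eq_sum_range
    (fun j => if e + (j : ℕ) - p < -14 then (2 : ℝ) ^ (e + (j : ℕ) - p) else 0)]
  refine Finset.sum_le_sum fun j _ => ?_
  split_ifs
  · exact habs j
  · simp

end Window

/-! ### The subgradient estimator -/

section Estimator

variable {d m : ℕ} {F : EuclideanSpace ℝ (Fin d) → BitVec m} {X : Set (EuclideanSpace ℝ (Fin d))}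
  {f : EuclideanSpace ℝ (Fin d) → ℝ}

/-- Start with the estimate zero. -/
def initProg : Program d m (d + 1 + m) :=
  fillProg d 0 ++ (fillProg (7 * d + 1) 1 ++ fillProg (8 * d + 1) 0)

/-- The zero estimate has error at most G, which is 1/τ for τ = 1/G, and its cosine and sine are 1
and 0. -/
theorem ensures_initProg (z g : EuclideanSpace ℝ (Fin d)) {G : ℝ}
    (hg : ∀ i, |g i| ≤ G) : Ensures F X (fun μ => readVec d μ (3 * d + 1) = z)
      (initProg : Program d m (d + 1 + m)) (Estimates z g (1 / G)) := by
  intro c hc c' hc'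
  obtain ⟨μ₁, r₁, h11, h12⟩ := run_fillProg (F := F) (X := X) (m := m) d 0 c
  obtain ⟨μ₂, r₂, h21, h22⟩ := run_fillProg (F := F) (X := X) (m := m) (7 * d + 1) 1 ⟨μ₁, c.st⟩
  obtain ⟨μ₃, r₃, h31, h32⟩ := run_fillProg (F := F) (X := X) (m := m) (8 * d + 1) 0 ⟨μ₂, c.st⟩
  simp only [initProg, run_append, r₁, r₂, r₃, List.flatMap_singleton, List.mem_singleton] at hc'
  subst hc'
  dsimp only at *
  refine ⟨(readVec_congr fun r _ _ => ?_).trans hc, fun i => ?_⟩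
  · rw [h32 _ (by omega), h22 _ (by omega), h12 _ (by omega)]
  · have h0 : μ₃ (d + i) = 0 := by rw [h32 _ (by omega), h22 _ (by omega), h11]
    unfold Estimate
    rw [h0, h31, h32 _ (by omega), h21]
    simp [hg i]

/-- The stages of the estimator. -/
def stagesProg (p : ℕ) (e : ℤ) (G : ℝ) (M K : ℕ) : Program d m (d + 1 + m) :=
  (List.range K).flatMap fun k => stageProg (windowPhase m p e) (window m p e) M
    (2 ^ k / (2 * Real.pi * 2 ^ e * G)) (2 ^ k / G)

/-- The subgradient estimator. -/
def estimatorProg (p : ℕ) (a : ℕ) (h : ℝ) (e : ℤ) (G : ℝ) (M K : ℕ) : Program d m (d + 1 + m) :=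
  pointProg a h ++ (initProg ++ stagesProg p e G M K)

theorem estimatorProg_writes {p a : ℕ} {h : ℝ} {e : ℤ} {G : ℝ} {M K : ℕ}
    {ins : Instr d m (d + 1 + m)} (hi : ins ∈ (estimatorProg p a h e G M K :
      Program d m (d + 1 + m))) {j : ℕ} (hj : ins.Writes j) :
    (d ≤ j ∧ j < 2 * d) ∨ 3 * d + 1 ≤ j := by
  simp only [estimatorProg, initProg, stagesProg, List.mem_append, List.mem_flatMap] at hi
  rcases hi with hi | (hi | hi | hi) | ⟨k, -, hi⟩
  · exact Or.inr (pointProg_writes hi hj)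
  · have := fillProg_writes hi hj; omega
  · have := fillProg_writes hi hj; omega
  · have := fillProg_writes hi hj; omega
  · have := stageProg_writes hi hj; omega

/-- Stage k works at scale 2^k/G. The edge of the cube is chosen to make τ = 2π 2^e σ, so it doubles
from stage to stage. -/
theorem reaches_stagesProg {p : ℕ} {e : ℤ} {G : ℝ} (hG : 0 < G) {M : ℕ} (hM : 0 < M) (K : ℕ)
    {z g : EuclideanSpace ℝ (Fin d)} {β : ℝ}
    (hlin : ∀ k < K, ∀ u, ∃ l : ℤ, |outPhase (windowPhase m p e) (window m p e)
        (F (vertex z (2 ^ k / (2 * Real.pi * 2 ^ e * G)) u))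
      - (β + ∑ i, if u i then 2 ^ k / G * g i else 0) - 2 * Real.pi * l| ≤ 1 / 400) :
    Reaches F X (Estimates z g (1 / G)) (stagesProg p e G M K : Program d m (d + 1 + m))
      (Estimates z g (2 ^ K / G)) (K * (4 * d * Real.exp (-M / 10000))) := by
  induction K with
  | zero => simpa [stagesProg] using (Ensures.nil (F := F) (X := X) (m := m) (n := d + 1 + m)
      (I := Estimates z g (1 / G))).reaches
  | succ K ih =>
    have hs : (stagesProg p e G M (K + 1) : Program d m (d + 1 + m)) = stagesProg p e G M K ++
        stageProg (windowPhase m p e) (window m p e) M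
          (2 ^ K / (2 * Real.pi * 2 ^ e * G)) (2 ^ K / G) := by
      simp [stagesProg, List.range_succ]
    rw [hs]
    have hst := reaches_stageProg (F := F) (X := X) hM (by positivity : 0 < 2 ^ K / G)
      (hlin K (Nat.lt_succ_self K))
    rw [show 2 * (2 ^ K / G) = 2 ^ (K + 1) / G by rw [pow_succ]; ring] at hst
    refine ((ih fun k hk => hlin k (by omega)).seq (by positivity) (by positivity) hst).mono
      (fun _ h => h) (fun _ h => h) (le_of_eq ?_)
    push_cast
    ring

/-- The kicked back phases are close to linear at a point with small second differences. -/
theorem phase_close {p : ℕ} {e : ℤ} {θ r₁ h σ τ : ℝ} (hd : 0 < d) (hh : 0 < h)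
    (hf : ConvexOn ℝ Set.univ f) (hF : IsApproxOracle p f (boxNhd X (2 * r₁)) θ F)
    {x z g : EuclideanSpace ℝ (Fin d)} (hx : x ∈ X)
    (hbox : ∀ i, x i ≤ z i ∧ z i ≤ x i + r₁) (hg : ∀ q, f z + inner ℝ g (q - z) ≤ f q)
    (hsec : (1 / d) * ∑ i, secDiff f h i z ≤ θ) (hσ : 0 ≤ σ) (hσh : d * σ ≤ h) (hσr : σ ≤ r₁)
    (hs : 2 ^ e * θ ≤ 1 / 12000) (hτ : 2 * Real.pi * 2 ^ e * σ = τ) (u : Fin d → Bool) :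
    ∃ l : ℤ, |outPhase (windowPhase m p e) (window m p e) (F (vertex z σ u))
      - (2 * Real.pi * 2 ^ e * f z + ∑ i, if u i then τ * g i else 0) - 2 * Real.pi * l|
        ≤ 1 / 400 := by
  obtain ⟨l, hl⟩ := outPhase_window p e (F (vertex z σ u))
  refine ⟨l, ?_⟩
  set a : EuclideanSpace ℝ (Fin d) := WithLp.toLp 2 fun i => if u i then σ else 0 with ha
  have hv : vertex z σ u = z + a := by
    ext i; simp [vertex, a]
  have hai : ∀ i, a i = if u i then σ else 0 := fun i => rfl
  have hor := hF (vertex z σ u) ⟨x, hx, fun i => by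
    rw [hv, PiLp.add_apply, hai, abs_le]
    have := hbox i
    split_ifs <;> constructor <;> linarith⟩
  have hlow : inner ℝ g a ≤ f (z + a) - f z := by
    have := hg (z + a)
    rw [add_sub_cancel_left] at this
    linarith
  have hup := linearization_error_le hf hg hd hh a
    (fun i => by rw [hai]; split_ifs <;> simp [hσ])
    (fun i => by rw [hai]; split_ifs; exacts [hσh, by simp [hh.le]])
  have hin : 2 * Real.pi * 2 ^ e * inner ℝ g a = ∑ i, if u i then τ * g i else 0 := by
    simp only [PiLp.inner_apply, hai, Finset.mul_sum]
    refine Finset.sum_congr rfl fun i _ => ?_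
    split_ifs
    · rw [← hτ]; simp; ring
    · simp
  rw [← hin]
  rw [hv] at hor hl ⊢
  set S : ℝ := 2 * Real.pi * 2 ^ e with hS
  have hSpos : 0 < S := by positivity
  set fp := fixedPoint p (F (z + a))
  have hSθ : S * θ ≤ 2 * Real.pi / 12000 := by
    rw [hS, mul_assoc]
    calc _ ≤ 2 * Real.pi * (1 / 12000) := by
          exact mul_le_mul_of_nonneg_left hs Real.two_pi_pos.le
      _ = _ := by ring
  have h1 : |fp - f (z + a)| ≤ θ := hor.le
  have h2 : |f (z + a) - f z - inner ℝ g a| ≤ θ := by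
    rw [abs_le]; constructor <;> linarith [abs_nonneg (fp - f (z + a))]
  have h3 : |S * (fp - f (z + a))| ≤ S * θ := by
    rw [abs_mul, abs_of_pos hSpos]; gcongr
  have h4 : |S * (f (z + a) - f z - inner ℝ g a)| ≤ S * θ := by
    rw [abs_mul, abs_of_pos hSpos]; gcongr
  set o := outPhase (windowPhase m p e) (window m p e) (F (z + a))
  have e1 : o - (S * f z + S * inner ℝ g a) - 2 * Real.pi * l
      = (o - S * fp - 2 * Real.pi * l) + S * (fp - f (z + a))
        + S * (f (z + a) - f z - inner ℝ g a) := by ring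
  rw [e1]
  refine (abs_add_le _ _).trans ((add_le_add_left (abs_add_le _ _) _).trans ?_)
  have hz : (2 : ℝ) ^ (-14 : ℤ) = 1 / 16384 := by norm_num
  rw [hz] at hl
  -- Oracle error and linearization error contribute at most 2π/12000 each and the truncation
  -- 2π/16384, together less than 1/400.
  linarith [Real.pi_lt_d2]

/-- The stages recover a subgradient g at the random point z. Replacing f z by f x and the base
point z by x costs G‖z - x‖ each, and ‖z - x‖ ≤ √d r₁; replacing g by its estimate costs δ‖q - x‖,
because each of the d coordinates has error at most G/2^K. -/
theorem isSubgradientEstimator_estimatorProg {p a M K : ℕ} {e : ℤ} {G θ r₁ h ρ δ : ℝ} (hd : 0 < d)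
    (hG : 0 < G) (hθ : 0 < θ) (hh : 0 < h) (hr : h * 2 ^ a = r₁) (hM : 0 < M)
    (hs : 2 ^ e * θ ≤ 1 / 12000)
    (hK : ∀ k < K, d * (2 ^ k / (2 * Real.pi * 2 ^ e * G)) ≤ h)
    (hδ : √d * (G / 2 ^ K) ≤ δ)
    (hρ : 2 * G * h / (2 ^ a * θ) + K * (4 * d * Real.exp (-M / 10000)) ≤ ρ)
    (hf : ConvexOn ℝ Set.univ f) (hL : LipschitzWith G.toNNReal f)
    (hF : IsApproxOracle p f (boxNhd X (2 * r₁)) θ F) :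
    IsSubgradientEstimator F X f ρ δ (2 * G * √d * r₁)
      (estimatorProg p a h e G M K : Program d m (d + 1 + m)) := by
  intro c hx
  set x := readVec d c.mem 0 with hxdef
  have hd1 : (1 : ℝ) ≤ d := by exact_mod_cast hd
  have hhr : h ≤ r₁ := by
    rw [← hr]
    exact le_mul_of_one_le_right hh.le (one_le_pow₀ (by norm_num))
  have hpoint := reaches_pointProg (F := F) (X := X) (m := m) (a := a) hd hf hG hL hh hθ x
  have hrest : Reaches F X (fun μ => (∀ i, x i ≤ readVec d μ (3 * d + 1) i ∧
        readVec d μ (3 * d + 1) i ≤ x i + h * 2 ^ a) ∧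
          (1 / d) * ∑ i, secDiff f h i (readVec d μ (3 * d + 1)) ≤ θ)
      (initProg ++ stagesProg p e G M K : Program d m (d + 1 + m))
      (fun μ => ∃ z g, (∀ i, x i ≤ z i ∧ z i ≤ x i + r₁) ∧
        (∀ q, f z + inner ℝ g (q - z) ≤ f q) ∧ Estimates z g (2 ^ K / G) μ)
      (0 + K * (4 * d * Real.exp (-M / 10000))) := by
    rintro c' ⟨hbox, hsec⟩
    replace hbox : ∀ i, x i ≤ readVec d c'.mem (3 * d + 1) i ∧
        readVec d c'.mem (3 * d + 1) i ≤ x i + r₁ := fun i =>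
      ⟨(hbox i).1, (hbox i).2.trans (by rw [← hr])⟩
    set z := readVec d c'.mem (3 * d + 1) with hz
    -- The point z varies with the branch, so it and its subgradient are fixed only after the random
    -- shift, separately for each branch.
    obtain ⟨g, hg⟩ := exists_subgradient hf hL.continuous z
    have hst : Reaches F X (Estimates z g (1 / G))
        (stagesProg p e G M K : Program d m (d + 1 + m)) (Estimates z g (2 ^ K / G))
        (K * (4 * d * Real.exp (-M / 10000))) := by
      refine reaches_stagesProg hG hM K (β := 2 * Real.pi * 2 ^ e * f z) fun k hk u => ?_
      have hσ : 0 ≤ (2 : ℝ) ^ k / (2 * Real.pi * 2 ^ e * G) := by positivity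
      refine phase_close hd hh hf hF hx hbox hg hsec hσ (hK k hk) ?_ hs ?_ u
      · exact (le_mul_of_one_le_left hσ hd1).trans ((hK k hk).trans hhr)
      · have : (2 * Real.pi * 2 ^ e : ℝ) ≠ 0 := by positivity
        field_simp
    refine (((ensures_initProg z g (abs_subgradient_le hG hL hg)).reaches.seq le_rfl
      (by positivity) hst).mono (fun _ h => h) (fun μ hμ => ?_) le_rfl) c' rfl
    exact ⟨z, g, hbox, hg, hμ⟩
  have hprog : Reaches F X (fun μ => μ = c.mem) (estimatorProg p a h e G M K :
      Program d m (d + 1 + m)) (fun μ => (∃ z g, (∀ i, x i ≤ z i ∧ z i ≤ x i + r₁) ∧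
        (∀ q, f z + inner ℝ g (q - z) ≤ f q) ∧ Estimates z g (2 ^ K / G) μ) ∧
        ∀ j, j < d ∨ (2 * d ≤ j ∧ j ≤ 3 * d) → μ j = c.mem j) ρ := by
    refine (((hpoint.seq (by positivity) (by positivity) hrest).mono (I' := fun μ => μ = c.mem)
      (fun μ hμ => by rw [hμ]) (fun _ h => h) (by linarith)).and ?_)
    intro c₁ hc₁ c' hc' j hj
    rw [← hc₁]
    refine run_mem_of_not_writes hc' fun i hi hw => ?_
    have := estimatorProg_writes hi hw
    omega
  refine (hprog.mono (fun _ h => h) (J' := fun μ =>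
    (∀ j, j < d ∨ (2 * d ≤ j ∧ j ≤ 3 * d) → μ j = c.mem j) ∧
        ∀ q, f x + inner ℝ (readVec d μ d) (q - x) - δ * ‖q - x‖ - 2 * G * √d * r₁ ≤ f q)
      ?_ le_rfl) c rfl
  rintro μ ⟨⟨z, g, hbox, hg, hest⟩, hframe⟩
  refine ⟨hframe, fun q => ?_⟩
  have hr0 : 0 < r₁ := hh.trans_le hhr
  have hzx : ‖z - x‖ ≤ √d * r₁ := by
    rw [EuclideanSpace.norm_eq, ← Real.sqrt_sq hr0.le, ← Real.sqrt_mul (by positivity)]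
    refine Real.sqrt_le_sqrt ((Finset.sum_le_card_nsmul _ _ (r₁ ^ 2) fun i _ => ?_).trans
      (le_of_eq (by simp)))
    rw [Real.norm_eq_abs, sq_abs, PiLp.sub_apply]
    have := hbox i
    exact pow_le_pow_left₀ (by linarith) (by linarith) 2
  have hgg : ‖readVec d μ d - g‖ ≤ δ := by
    refine le_trans ?_ hδ
    have hp : 0 ≤ G / 2 ^ K := by positivity
    rw [EuclideanSpace.norm_eq, ← Real.sqrt_sq hp, ← Real.sqrt_mul (by positivity)]
    refine Real.sqrt_le_sqrt ((Finset.sum_le_card_nsmul _ _ ((G / 2 ^ K) ^ 2) fun i _ => ?_).trans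
      (le_of_eq (by simp)))
    have := (hest.2 i).1
    rw [one_div_div] at this
    rw [Real.norm_eq_abs, PiLp.sub_apply, abs_sub_comm]
    exact pow_le_pow_left₀ (abs_nonneg _) this 2
  have h1 := hg q
  have h2 := sub_le_of_lipschitz hG hL x z
  have h3 : inner ℝ g (x - z) ≤ G * ‖z - x‖ ∧ -(G * ‖z - x‖) ≤ inner ℝ g (x - z) := by
    constructor
    · have h5 := hg x
      have h6 := sub_le_of_lipschitz hG hL x z
      rw [norm_sub_rev] at h6
      linarith
    · have h5 := hg (z + (z - x))
      have h6 := sub_le_of_lipschitz hG hL (z + (z - x)) z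
      rw [add_sub_cancel_left] at h5 h6
      rw [← neg_sub z x, inner_neg_right]
      linarith
  have h4 : inner ℝ (readVec d μ d - g) (q - x) ≤ δ * ‖q - x‖ :=
    (real_inner_le_norm _ _).trans (by gcongr)
  rw [inner_sub_left] at h4
  have h7 : inner ℝ g (q - z) = inner ℝ g (q - x) + inner ℝ g (x - z) := by
    rw [← inner_add_right]; congr 1; abel
  have h8 : G * ‖z - x‖ ≤ G * (√d * r₁) := by gcongr
  rw [norm_sub_rev] at h2
  rw [h7] at h1
  linarith [h3.2]

/-- If the required accuracy is not better than the Lipschitz constant, zero is an approximate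
subgradient. -/
theorem isSubgradientEstimator_fillProg {n : ℕ} {G ρ δ γ : ℝ} (hG : 0 < G) (hρ : 0 ≤ ρ)
    (hδ : G ≤ δ) (hγ : 0 ≤ γ) (hL : LipschitzWith G.toNNReal f) :
    IsSubgradientEstimator F X f ρ δ γ (fillProg d 0 : Program d m n) := by
  intro c _
  have h : Ensures F X (fun μ => μ = c.mem) (fillProg d 0 : Program d m n) (fun μ =>
      (∀ j, j < d ∨ (2 * d ≤ j ∧ j ≤ 3 * d) → μ j = c.mem j) ∧
        ∀ q, f (readVec d c.mem 0) + inner ℝ (readVec d μ d) (q - readVec d c.mem 0)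
          - δ * ‖q - readVec d c.mem 0‖ - γ ≤ f q) := by
    intro c₁ hc₁ c' hc'
    obtain ⟨μ, r, h1, h2⟩ := run_fillProg (F := F) (X := X) (m := m) d 0 c₁
    rw [r, List.mem_singleton] at hc'
    subst hc'
    refine ⟨fun j hj => ?_, fun q => ?_⟩
    · rw [← hc₁]; exact h2 j (by omega)
    · have h0 : readVec d μ d = 0 := by
        ext i
        exact h1 i
      dsimp only
      rw [h0, inner_zero_left]
      have h3 := sub_le_of_lipschitz hG hL (readVec d c.mem 0) q
      rw [norm_sub_rev] at h3
      have h4 : G * ‖q - readVec d c.mem 0‖ ≤ δ * ‖q - readVec d c.mem 0‖ := by gcongr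
      linarith
  exact (h.reaches.mono (fun _ h => h) (fun _ h => h) hρ) c rfl

end Estimator

/-! ### The projected subgradient method -/

section Method

variable {d m n : ℕ} {F : EuclideanSpace ℝ (Fin d) → BitVec m} {X : Set (EuclideanSpace ℝ (Fin d))}
  {f : EuclideanSpace ℝ (Fin d) → ℝ}

/-- The closest point p exists by completeness and convexity, and the vectors z - p and y - p
enclose an obtuse or right angle for y in `X`, so dropping ‖z - p‖² from the expansion of ‖z - y‖²
leaves ‖p - y‖². -/
theorem proj_spec (hX : IsClosed X) (hc : Convex ℝ X) (hne : X.Nonempty)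
    (z : EuclideanSpace ℝ (Fin d)) :
    proj X z ∈ X ∧ ∀ y ∈ X, ‖proj X z - y‖ ≤ ‖z - y‖ := by
  have hbdd : ∀ z : EuclideanSpace ℝ (Fin d), BddBelow (Set.range fun w : X => ‖z - w‖) :=
    fun z => ⟨0, by rintro _ ⟨w, rfl⟩; exact norm_nonneg _⟩
  have hex : ∃ p, p ∈ X ∧ ∀ y ∈ X, ‖z - p‖ ≤ ‖z - y‖ := by
    obtain ⟨p, hp, h⟩ := exists_norm_eq_iInf_of_complete_convex hne hX.isComplete hc z
    exact ⟨p, hp, fun y hy => h ▸ ciInf_le (hbdd z) ⟨y, hy⟩⟩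
  obtain ⟨hp, hmin⟩ := Classical.epsilon_spec hex
  change proj X z ∈ X at hp
  change ∀ y ∈ X, ‖z - proj X z‖ ≤ ‖z - y‖ at hmin
  refine ⟨hp, fun y hy => ?_⟩
  have : Nonempty X := ⟨⟨y, hy⟩⟩
  have hinf : ‖z - proj X z‖ = ⨅ w : X, ‖z - w‖ :=
    le_antisymm (le_ciInf fun w => hmin w w.2) (ciInf_le (hbdd z) ⟨proj X z, hp⟩)
  have hin := (norm_eq_iInf_iff_real_inner_le_zero hc hp).1 hinf y hy
  refine le_of_sq_le_sq ?_ (norm_nonneg _)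
  have e : z - y = (z - proj X z) + (proj X z - y) := by abel
  rw [e, norm_add_sq_real]
  have e2 : inner ℝ (z - proj X z) (proj X z - y) = -inner ℝ (z - proj X z) (y - proj X z) := by
    rw [← inner_neg_right]; congr 1; abel
  rw [e2]
  nlinarith [sq_nonneg ‖z - proj X z‖]

theorem readVec_writeVec (μ : Mem) (base : ℕ) (v : EuclideanSpace ℝ (Fin d)) :
    readVec d (writeVec μ base v) base = v := by
  ext i
  simp [readVec, writeVec]

/-- Test the inequality far out in the direction of g, where the offset γ is negligible against the
linear terms; s is taken so large that the excess of ‖g‖ over G + δ would produce γ + 1 ≤ γ. -/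
theorem norm_le_of_approx_subgradient {G δ γ : ℝ} (hG : 0 < G) (hδ : 0 ≤ δ) (hγ : 0 ≤ γ)
    (hL : LipschitzWith G.toNNReal f) {x g : EuclideanSpace ℝ (Fin d)}
    (hg : ∀ q, f x + inner ℝ g (q - x) - δ * ‖q - x‖ - γ ≤ f q) : ‖g‖ ≤ G + δ := by
  by_contra hc
  push Not at hc
  have hpos : 0 < ‖g‖ * (‖g‖ - (G + δ)) := mul_pos (by linarith) (by linarith)
  set s := (γ + 1) / (‖g‖ * (‖g‖ - (G + δ))) with hs
  have hs0 : 0 < s := by positivity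
  have hs1 : s * (‖g‖ * (‖g‖ - (G + δ))) = γ + 1 := div_mul_cancel₀ _ hpos.ne'
  have h1 := hg (x + s • g)
  have h2 := sub_le_of_lipschitz hG hL (x + s • g) x
  rw [add_sub_cancel_left, norm_smul, Real.norm_eq_abs, abs_of_pos hs0] at h1 h2
  rw [real_inner_smul_right, real_inner_self_eq_norm_sq] at h1
  nlinarith

/-! ### Regret of the projected subgradient steps -/

/-- After `t` iterations: the points visited so far and their total regret. -/
def Progress (f : EuclideanSpace ℝ (Fin d) → ℝ) (X : Set (EuclideanSpace ℝ (Fin d)))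
    (xs : EuclideanSpace ℝ (Fin d)) (R η b B : ℝ) (t : ℕ) (x S : EuclideanSpace ℝ (Fin d)) : Prop :=
  x ∈ X ∧ ∃ y : ℕ → EuclideanSpace ℝ (Fin d), (∀ s < t, y s ∈ X) ∧ S = ∑ s ∈ Finset.range t, y s ∧
    2 * η * ∑ s ∈ Finset.range t, (f (y s) - f xs - b) + ‖x - xs‖ ^ 2 ≤ R ^ 2 + t * (η ^ 2 * B ^ 2)

/-- Expanding ‖x - ηg - x*‖² yields -2η⟨g, x - x*⟩, which pays for the regret of x up to δR + γ, and
η²‖g‖² ≤ η²(G + δ)². Projecting does not increase the distance to x*. -/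
theorem Progress.succ {xs : EuclideanSpace ℝ (Fin d)} {R η G δ γ : ℝ} {t : ℕ}
    {x S g : EuclideanSpace ℝ (Fin d)} (hX : IsClosed X) (hc : Convex ℝ X) (hxs : xs ∈ X)
    (hR : ∀ x ∈ X, ‖x - xs‖ ≤ R) (hη : 0 < η) (hG : 0 < G) (hδ : 0 ≤ δ) (hγ : 0 ≤ γ)
    (hL : LipschitzWith G.toNNReal f)
    (hg : ∀ q, f x + inner ℝ g (q - x) - δ * ‖q - x‖ - γ ≤ f q)
    (h : Progress f X xs R η (δ * R + γ) (G + δ) t x S) :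
    Progress f X xs R η (δ * R + γ) (G + δ) (t + 1) (proj X (x - η • g)) (S + x) := by
  obtain ⟨hx, y, hy, hS, hpot⟩ := h
  obtain ⟨hp, hpr⟩ := proj_spec hX hc ⟨xs, hxs⟩ (x - η • g)
  refine ⟨hp, fun s => if s < t then y s else x, ?_, ?_, ?_⟩
  · intro s hs
    dsimp only
    split_ifs with h
    exacts [hy s h, hx]
  · rw [Finset.sum_range_succ, if_neg (lt_irrefl t), hS]
    congr 1
    exact Finset.sum_congr rfl fun s hs => by rw [if_pos (Finset.mem_range.1 hs)]
  · dsimp only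
    rw [Finset.sum_range_succ, if_neg (lt_irrefl t)]
    have e : ∑ s ∈ Finset.range t, (f (if s < t then y s else x) - f xs - (δ * R + γ))
        = ∑ s ∈ Finset.range t, (f (y s) - f xs - (δ * R + γ)) :=
      Finset.sum_congr rfl fun s hs => by rw [if_pos (Finset.mem_range.1 hs)]
    rw [e]
    have hn := norm_le_of_approx_subgradient hG hδ hγ hL hg
    have h1 := hpr xs hxs
    have h2 : ‖proj X (x - η • g) - xs‖ ^ 2 ≤ ‖x - η • g - xs‖ ^ 2 :=
      pow_le_pow_left₀ (norm_nonneg _) h1 2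
    have h3 : ‖x - η • g - xs‖ ^ 2 = ‖x - xs‖ ^ 2 - 2 * η * inner ℝ g (x - xs)
        + η ^ 2 * ‖g‖ ^ 2 := by
      rw [show x - η • g - xs = (x - xs) - η • g by abel, norm_sub_sq_real,
        real_inner_smul_right, norm_smul, real_inner_comm, mul_pow, Real.norm_eq_abs, sq_abs]
      ring
    have h4 := hg xs
    have h5 : inner ℝ g (xs - x) = -inner ℝ g (x - xs) := by
      rw [← inner_neg_right]; congr 1; abel
    have h6 : δ * ‖xs - x‖ ≤ δ * R := by
      rw [norm_sub_rev]
      exact mul_le_mul_of_nonneg_left (hR x hx) hδ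
    have h7 : f x - f xs - (δ * R + γ) ≤ inner ℝ g (x - xs) := by linarith
    have h8 : 2 * η * (f x - f xs - (δ * R + γ)) ≤ 2 * η * inner ℝ g (x - xs) := by gcongr
    have h9 : η ^ 2 * ‖g‖ ^ 2 ≤ η ^ 2 * (G + δ) ^ 2 := by gcongr
    push_cast
    nlinarith

theorem reaches_iteration {E : Program d m n} {xs : EuclideanSpace ℝ (Fin d)} {R η G δ γ ρ : ℝ}
    {t : ℕ} (hd : 0 < d) (hX : IsClosed X) (hc : Convex ℝ X) (hxs : xs ∈ X)
    (hR : ∀ x ∈ X, ‖x - xs‖ ≤ R) (hη : 0 < η) (hG : 0 < G) (hδ : 0 ≤ δ) (hγ : 0 ≤ γ) (hρ : 0 ≤ ρ)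
    (hL : LipschitzWith G.toNNReal f) (hE : IsSubgradientEstimator F X f ρ δ γ E) :
    Reaches F X (fun μ => μ (3 * d) = η ∧ Progress f X xs R η (δ * R + γ) (G + δ) t
        (readVec d μ 0) (readVec d μ (2 * d))) (iteration E)
      (fun μ => μ (3 * d) = η ∧ Progress f X xs R η (δ * R + γ) (G + δ) (t + 1)
        (readVec d μ 0) (readVec d μ (2 * d))) ρ := by
  have h1 : Ensures F X (fun μ => μ (3 * d) = η ∧ Progress f X xs R η (δ * R + γ) (G + δ) t
        (readVec d μ 0) (readVec d μ (2 * d)))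
      ((List.range d).map (fun i => .add (2 * d + i) (2 * d + i) i) : Program d m n)
      (fun μ => μ (3 * d) = η ∧ ∃ S, Progress f X xs R η (δ * R + γ) (G + δ) t (readVec d μ 0) S ∧
        readVec d μ (2 * d) = S + readVec d μ 0) := by
    rintro c ⟨hc1, hc2⟩ c' hc'
    obtain ⟨μ, r, e1, e2⟩ := run_map_pointwise (F := F) (X := X) (List.nodup_range : (List.range d).Nodup)
      (fun i => (.add (2 * d + i) (2 * d + i) i : Instr d m n)) (fun i => 2 * d + i)
      (fun i μ => μ (2 * d + i) + μ i) (fun i _ j _ hij => by omega) (fun i _ c => rfl)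
      (fun i hi j hj hij μ x => by
        have := List.mem_range.1 hi
        rw [Function.update_of_ne (by omega), Function.update_of_ne (by omega)]) c
    rw [r, List.mem_singleton] at hc'
    subst hc'
    have hx : readVec d μ 0 = readVec d c.mem 0 :=
      readVec_congr fun r _ _ => e2 r fun i hi => by have := List.mem_range.1 hi; omega
    refine ⟨?_, readVec d c.mem (2 * d), by dsimp only; rw [hx]; exact hc2, ?_⟩
    · rw [← hc1]
      exact e2 _ fun i hi => by have := List.mem_range.1 hi; omega
    · dsimp only
      rw [hx]
      ext i
      simpa [readVec] using e1 i (List.mem_range.2 i.2)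
  have h2 : Reaches F X (fun μ => μ (3 * d) = η ∧ ∃ S, Progress f X xs R η (δ * R + γ) (G + δ) t
        (readVec d μ 0) S ∧ readVec d μ (2 * d) = S + readVec d μ 0) E
      (fun μ => (μ (3 * d) = η ∧ ∃ S, Progress f X xs R η (δ * R + γ) (G + δ) t
        (readVec d μ 0) S ∧ readVec d μ (2 * d) = S + readVec d μ 0) ∧
        ∀ q, f (readVec d μ 0) + inner ℝ (readVec d μ d) (q - readVec d μ 0)
          - δ * ‖q - readVec d μ 0‖ - γ ≤ f q) ρ := by
    rintro c ⟨hc1, S, hc2, hc3⟩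
    -- The guarantee of `E` compares final with initial registers, so it becomes a triple only once
    -- the initial memory is fixed.
    have hE' : Reaches F X (fun μ => μ = c.mem) E (fun μ =>
        (∀ j, j < d ∨ (2 * d ≤ j ∧ j ≤ 3 * d) → μ j = c.mem j) ∧
        ∀ q, f (readVec d c.mem 0) + inner ℝ (readVec d μ d) (q - readVec d c.mem 0)
          - δ * ‖q - readVec d c.mem 0‖ - γ ≤ f q) ρ := by
      intro c₁ hc₁
      have := hE c₁ (by rw [hc₁]; exact hc2.1)
      rwa [hc₁] at this
    refine hE'.mono (fun _ h => h) ?_ le_rfl c rfl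
    rintro μ ⟨hfr, hg⟩
    have hx : readVec d μ 0 = readVec d c.mem 0 := readVec_congr fun r _ _ => hfr r (by omega)
    have hS : readVec d μ (2 * d) = readVec d c.mem (2 * d) :=
      readVec_congr fun r _ _ => hfr r (by omega)
    rw [hx, hS, hfr _ (by omega)]
    exact ⟨⟨hc1, S, hc2, hc3⟩, hg⟩
  have h3 : Ensures F X (fun μ => (μ (3 * d) = η ∧ ∃ S, Progress f X xs R η (δ * R + γ) (G + δ) t
        (readVec d μ 0) S ∧ readVec d μ (2 * d) = S + readVec d μ 0) ∧
        ∀ q, f (readVec d μ 0) + inner ℝ (readVec d μ d) (q - readVec d μ 0)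
          - δ * ‖q - readVec d μ 0‖ - γ ≤ f q)
      ((List.range d).map (fun i => .mul (d + i) (3 * d) (d + i)) ++
        ((List.range d).map (fun i => .sub i i (d + i)) ++ [.project 0]) : Program d m n)
      (fun μ => μ (3 * d) = η ∧ Progress f X xs R η (δ * R + γ) (G + δ) (t + 1)
        (readVec d μ 0) (readVec d μ (2 * d))) := by
    rintro c ⟨⟨hc1, S, hc2, hc3⟩, hg⟩ c' hc'
    obtain ⟨μ, r, e1, e2⟩ := run_map_pointwise (F := F) (X := X) (List.nodup_range : (List.range d).Nodup)
      (fun i => (.mul (d + i) (3 * d) (d + i) : Instr d m n)) (fun i => d + i)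
      (fun i μ => μ (3 * d) * μ (d + i)) (fun i _ j _ hij => by omega) (fun i _ c => rfl)
      (fun i hi j hj hij μ x => by
        have := List.mem_range.1 hj
        rw [Function.update_of_ne (by omega), Function.update_of_ne (by omega)]) c
    obtain ⟨μ', r', e1', e2'⟩ := run_map_pointwise (F := F) (X := X) (List.nodup_range : (List.range d).Nodup)
      (fun i => (.sub i i (d + i) : Instr d m n)) (fun i => i)
      (fun i μ => μ i - μ (d + i)) (fun i _ j _ hij => by omega) (fun i _ c => rfl)
      (fun i hi j hj hij μ x => by
        have := List.mem_range.1 hj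
        rw [Function.update_of_ne (by omega), Function.update_of_ne (by omega)]) ⟨μ, c.st⟩
    simp only [run_append, r, r', List.flatMap_singleton, run_singleton, step,
      List.mem_singleton] at hc'
    subst hc'
    dsimp only at *
    have hhi : ∀ j, 2 * d ≤ j → writeVec μ' 0 (proj X (readVec d μ' 0)) j = c.mem j := by
      intro j hj
      rw [writeVec, dif_neg (by omega), e2' j (fun i hi => by have := List.mem_range.1 hi; omega),
        e2 j (fun i hi => by have := List.mem_range.1 hi; omega)]
    have hS : readVec d (writeVec μ' 0 (proj X (readVec d μ' 0))) (2 * d)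
        = readVec d c.mem (2 * d) := readVec_congr fun r hr _ => hhi r hr
    have hx : readVec d μ' 0 = readVec d c.mem 0 - η • readVec d c.mem d := by
      ext i
      have h5 := e1' i (List.mem_range.2 i.2)
      rw [e1 i (List.mem_range.2 i.2), hc1,
        e2 i (fun j hj => by omega)] at h5
      simpa [readVec] using h5
    rw [hhi _ (by omega), readVec_writeVec, hS, hc3, hx]
    exact ⟨hc1, hc2.succ hX hc hxs hR hη hG hδ hγ hL hg⟩
  have := (h1.reaches.seq le_rfl (by simpa using hρ) (h2.seq hρ le_rfl h3.reaches)).mono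
    (fun _ h => h) (fun _ h => h) (ε' := ρ) (by linarith)
  simpa only [iteration, List.append_assoc] using this

theorem reaches_iterations {E : Program d m n} {xs : EuclideanSpace ℝ (Fin d)} {R η G δ γ ρ : ℝ}
    (hd : 0 < d) (hX : IsClosed X) (hc : Convex ℝ X) (hxs : xs ∈ X)
    (hR : ∀ x ∈ X, ‖x - xs‖ ≤ R) (hη : 0 < η) (hG : 0 < G) (hδ : 0 ≤ δ) (hγ : 0 ≤ γ) (hρ : 0 ≤ ρ)
    (hL : LipschitzWith G.toNNReal f) (hE : IsSubgradientEstimator F X f ρ δ γ E) (T : ℕ) :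
    Reaches F X (fun μ => μ (3 * d) = η ∧ Progress f X xs R η (δ * R + γ) (G + δ) 0
        (readVec d μ 0) (readVec d μ (2 * d))) (List.replicate T (iteration E)).flatten
      (fun μ => μ (3 * d) = η ∧ Progress f X xs R η (δ * R + γ) (G + δ) T
        (readVec d μ 0) (readVec d μ (2 * d))) (T * ρ) := by
  induction T with
  | zero => simpa using (Ensures.nil (F := F) (X := X) (m := m) (n := n)).reaches
  | succ T ih =>
    rw [List.replicate_succ', List.flatten_append, List.flatten_singleton]
    refine (ih.seq (by positivity) hρ (reaches_iteration hd hX hc hxs hR hη hG hδ hγ hρ hL hE)).mono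
      (fun _ h => h) (fun _ h => h) (le_of_eq ?_)
    push_cast
    ring

/-- Discard the final squared distance from the potential, divide by 2ηT and apply Jensen's
inequality. -/
theorem Progress.average {xs : EuclideanSpace ℝ (Fin d)} {R η b B : ℝ} {T : ℕ}
    {x S : EuclideanSpace ℝ (Fin d)} (hT : 0 < T) (hη : 0 < η) (hc : Convex ℝ X)
    (hf : ConvexOn ℝ Set.univ f) (h : Progress f X xs R η b B T x S) :
    (1 / T : ℝ) • S ∈ X ∧
      f ((1 / T : ℝ) • S) - f xs ≤ b + R ^ 2 / (2 * η * T) + η * B ^ 2 / 2 := by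
  have hT' : (0 : ℝ) < T := by exact_mod_cast hT
  obtain ⟨-, y, hy, rfl, hpot⟩ := h
  rw [Finset.smul_sum]
  have hw : ∑ s ∈ Finset.range T, (1 / T : ℝ) = 1 := by
    simp; field_simp
  refine ⟨hc.sum_mem (fun _ _ => by positivity) hw fun s hs => hy s (Finset.mem_range.1 hs), ?_⟩
  have hj := hf.map_sum_le (t := Finset.range T) (w := fun _ => (1 / T : ℝ)) (p := y)
    (fun _ _ => by positivity) hw fun _ _ => Set.mem_univ _
  simp only [smul_eq_mul, ← Finset.mul_sum] at hj
  have hs : ∑ s ∈ Finset.range T, (f (y s) - f xs - b)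
      = ∑ s ∈ Finset.range T, f (y s) - T * (f xs + b) := by
    rw [Finset.sum_sub_distrib, Finset.sum_sub_distrib]
    simp
    ring
  rw [hs] at hpot
  have h1 : 2 * η * (∑ s ∈ Finset.range T, f (y s) - T * (f xs + b))
      ≤ R ^ 2 + T * (η ^ 2 * B ^ 2) := by nlinarith [sq_nonneg ‖x - xs‖]
  have h2 : ∑ s ∈ Finset.range T, f (y s) - T * (f xs + b)
      ≤ (R ^ 2 + T * (η ^ 2 * B ^ 2)) / (2 * η) := by
    rw [le_div_iff₀ (by positivity)]; linarith
  have h3 : 1 / T * ∑ s ∈ Finset.range T, f (y s)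
      ≤ 1 / T * ((R ^ 2 + T * (η ^ 2 * B ^ 2)) / (2 * η) + T * (f xs + b)) := by
    gcongr; linarith
  have h4 : 1 / T * ((R ^ 2 + T * (η ^ 2 * B ^ 2)) / (2 * η) + T * (f xs + b))
      = f xs + b + R ^ 2 / (2 * η * T) + η * B ^ 2 / 2 := by
    field_simp
    ring
  linarith

/-- The regret bound enters through the hypothesis `hε` instead of being estimated here, so that the
trivial regime GR ≤ ε, where every point of `X` is good enough, is covered too. -/
theorem two_thirds_le_prob_qpsm {E : Program d m n} {x₁ xs : EuclideanSpace ℝ (Fin d)}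
    {R η G δ γ ρ ε : ℝ} {T : ℕ} (hd : 0 < d) (hT : 0 < T) (hX : IsClosed X) (hc : Convex ℝ X)
    (hf : ConvexOn ℝ Set.univ f) (hL : LipschitzWith G.toNNReal f) (hx₁ : x₁ ∈ X) (hxs : xs ∈ X)
    (hR : ∀ x ∈ X, ‖x - xs‖ ≤ R) (hη : 0 < η) (hG : 0 < G) (hδ : 0 ≤ δ) (hγ : 0 ≤ γ) (hρ : 0 ≤ ρ)
    (hTρ : T * ρ ≤ 1 / 3) (hE : IsSubgradientEstimator F X f ρ δ γ E)
    (hε : ∀ v ∈ X, f v - f xs ≤ δ * R + γ + R ^ 2 / (2 * η * T) + η * (G + δ) ^ 2 / 2 →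
      f v - f xs ≤ ε) :
    2 / 3 ≤ prob F X (qpsm T η E) (initConfig n x₁)
      {μ | readVec d μ (2 * d) ∈ X ∧ f (readVec d μ (2 * d)) - f xs ≤ ε} := by
  have h1 : Ensures F X (fun μ => readVec d μ 0 = x₁)
      ((List.range d).map (fun i => .const (2 * d + i) 0) ++ [.const (3 * d) η] : Program d m n)
      (fun μ => μ (3 * d) = η ∧ Progress f X xs R η (δ * R + γ) (G + δ) 0
        (readVec d μ 0) (readVec d μ (2 * d))) := by
    intro c hc c' hc'
    obtain ⟨μ, r, e1, e2⟩ := run_map_pointwise (F := F) (X := X) (List.nodup_range : (List.range d).Nodup)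
      (fun i => (.const (2 * d + i) 0 : Instr d m n)) (fun i => 2 * d + i)
      (fun i μ => 0) (fun i _ j _ hij => by omega) (fun i _ c => rfl)
      (fun _ _ _ _ _ _ _ => rfl) c
    simp only [run_append, r, List.flatMap_singleton, run_singleton, step,
      List.mem_singleton] at hc'
    subst hc'
    dsimp only
    have hx : readVec d (Function.update μ (3 * d) η) 0 = x₁ := by
      rw [← hc]
      refine readVec_congr fun r _ _ => ?_
      rw [Function.update_of_ne (by omega),
        e2 r fun i hi => by have := List.mem_range.1 hi; omega]
    have hS : readVec d (Function.update μ (3 * d) η) (2 * d) = 0 := by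
      ext i
      simp only [readVec]
      rw [Function.update_of_ne (by omega), e1 i (List.mem_range.2 i.2)]
      rfl
    refine ⟨Function.update_self _ _ _, ?_⟩
    rw [hx, hS]
    refine ⟨hx₁, fun _ => 0, by simp, by simp, ?_⟩
    simpa using pow_le_pow_left₀ (norm_nonneg _) (hR x₁ hx₁) 2
  have h3 : Ensures F X (fun μ => μ (3 * d) = η ∧ Progress f X xs R η (δ * R + γ) (G + δ) T
        (readVec d μ 0) (readVec d μ (2 * d)))
      ([.const (3 * d) (1 / T)] ++ (List.range d).map
        (fun i => .mul (2 * d + i) (3 * d) (2 * d + i)) : Program d m n)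
      (fun μ => readVec d μ (2 * d) ∈ X ∧ f (readVec d μ (2 * d)) - f xs ≤ ε) := by
    rintro c ⟨-, hp⟩ c' hc'
    obtain ⟨μ, r, e1, -⟩ := run_map_pointwise (F := F) (X := X) (List.nodup_range : (List.range d).Nodup)
      (fun i => (.mul (2 * d + i) (3 * d) (2 * d + i) : Instr d m n)) (fun i => 2 * d + i)
      (fun i μ => μ (3 * d) * μ (2 * d + i)) (fun i _ j _ hij => by omega) (fun i _ c => rfl)
      (fun i hi j hj hij μ x => by
        have := List.mem_range.1 hj
        rw [Function.update_of_ne (by omega), Function.update_of_ne (by omega)])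
      ⟨Function.update c.mem (3 * d) (1 / T), c.st⟩
    simp only [run_append, r, List.flatMap_singleton, run_singleton, step,
      List.mem_singleton] at hc'
    subst hc'
    dsimp only at *
    have hv : readVec d μ (2 * d) = (1 / T : ℝ) • readVec d c.mem (2 * d) := by
      ext i
      have h5 := e1 i (List.mem_range.2 i.2)
      rw [Function.update_self, Function.update_of_ne (by omega)] at h5
      simpa [readVec] using h5
    obtain ⟨h6, h7⟩ := hp.average hT hη hc hf
    rw [hv]
    exact ⟨h6, hε _ h6 h7⟩
  have h2 := reaches_iterations hd hX hc hxs hR hη hG hδ hγ hρ hL hE T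
  have hTρ0 : 0 ≤ T * ρ := by positivity
  have hall := h1.reaches.seq le_rfl (by linarith) (h2.seq hTρ0 le_rfl h3.reaches)
  have := hall (initConfig n x₁) (readVec_writeVec _ _ _)
  simp only [initConfig, normSq_zeroState] at this
  simp only [qpsm, List.append_assoc] at this ⊢
  exact le_trans (by linarith) this

end Method

/-! ### Costs -/

section Cost

variable {d m n : ℕ}

/-- The total weight of the instructions of a program. -/
def cost (w : Instr d m n → ℕ) (P : Program d m n) : ℕ := (P.map w).sum

theorem cost_append (w : Instr d m n → ℕ) (P Q : Program d m n) :
    cost w (P ++ Q) = cost w P + cost w Q := by simp [cost]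

theorem cost_singleton (w : Instr d m n → ℕ) (i : Instr d m n) : cost w [i] = w i := by simp [cost]

theorem cost_map {ι : Type*} (w : Instr d m n → ℕ) (l : List ι) (g : ι → Instr d m n) {k : ℕ}
    (h : ∀ i, w (g i) = k) : cost w (l.map g) = l.length * k := by
  simp only [cost, List.map_map, Function.comp_def, h]
  simp

theorem cost_flatMap {ι : Type*} (w : Instr d m n → ℕ) (l : List ι) (g : ι → Program d m n) {k : ℕ}
    (h : ∀ i, cost w (g i) = k) : cost w (l.flatMap g) = l.length * k := by
  induction l with
  | nil => simp [cost]
  | cons i l ih => rw [List.flatMap_cons, cost_append, ih, h, List.length_cons]; ring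

theorem cost_flatten_replicate (w : Instr d m n → ℕ) (N : ℕ) (P : Program d m n) :
    cost w (List.replicate N P).flatten = N * cost w P := by
  have := cost_flatMap w (List.range N) (fun _ => P) (k := cost w P) fun _ => rfl
  rw [List.length_range] at this
  rw [← this]
  simp [List.flatMap]

theorem cost_fillProg {w : Instr d m n → ℕ} {k : ℕ} (h : ∀ r a, w (.const r a) = k) (base : ℕ)
    (a : ℝ) : cost w (fillProg base a) = d * k := by
  rw [fillProg, cost_map w _ _ fun i => h _ a, List.length_finRange]

theorem queries_qpsm (T : ℕ) (η : ℝ) (E : Program d m n) :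
    queries (qpsm T η E) = T * queries E := by
  change cost Instr.queryCost _ = T * cost Instr.queryCost _
  simp only [qpsm, iteration, cost_append, cost_flatten_replicate, cost_singleton]
  rw [cost_map _ _ _ (k := 0) fun _ => rfl, cost_map _ _ _ (k := 0) fun _ => rfl,
    cost_map _ _ _ (k := 0) fun _ => rfl, cost_map _ _ _ (k := 0) fun _ => rfl,
    cost_map _ _ _ (k := 0) fun _ => rfl]
  simp [Instr.queryCost]

theorem gates_qpsm (τ T : ℕ) (η : ℝ) (E : Program d m n) :
    gates τ (qpsm T η E) = 2 * d + 2 + T * (3 * d + gates τ E + τ) := by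
  change cost (Instr.gateCost τ) _ = 2 * d + 2 + T * (3 * d + cost (Instr.gateCost τ) _ + τ)
  simp only [qpsm, iteration, cost_append, cost_flatten_replicate, cost_singleton]
  rw [cost_map _ _ _ (k := 1) fun _ => rfl, cost_map _ _ _ (k := 1) fun _ => rfl,
    cost_map _ _ _ (k := 1) fun _ => rfl, cost_map _ _ _ (k := 1) fun _ => rfl,
    cost_map _ _ _ (k := 1) fun _ => rfl]
  simp only [Instr.gateCost, List.length_range]
  ring

/-! ### Costs of the estimator -/

theorem queries_sampleProg (V : Matrix.unitaryGroup Bool ℂ) (γ : Fin m → ℝ) (js : List (Fin m))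
    (cb : ℕ) : cost Instr.queryCost (sampleProg V γ js cb : Program d m (d + 1 + m)) = 2 := by
  simp only [sampleProg, kickbackProg, layerProg, phaseProg, measureProg, countProg, cost_append,
    cost_singleton]
  rw [cost_map _ _ _ (k := 0) fun _ => rfl, cost_map _ _ _ (k := 0) fun _ => rfl,
    cost_map _ _ _ (k := 0) fun _ => rfl, cost_map _ _ _ (k := 0) fun _ => rfl,
    cost_map _ _ _ (k := 0) fun _ => rfl]
  rfl

theorem gates_sampleProg (τ : ℕ) (V : Matrix.unitaryGroup Bool ℂ) (γ : Fin m → ℝ)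
    (js : List (Fin m)) (cb : ℕ) :
    cost (Instr.gateCost τ) (sampleProg V γ js cb : Program d m (d + 1 + m))
      = 4 * d + js.length + 3 := by
  simp only [sampleProg, kickbackProg, layerProg, phaseProg, measureProg, countProg, cost_append,
    cost_singleton]
  rw [cost_map _ _ _ (k := 1) fun _ => rfl, cost_map _ _ _ (k := 1) fun _ => rfl,
    cost_map _ _ _ (k := 1) fun _ => rfl, cost_map _ _ _ (k := 1) fun _ => rfl,
    cost_map _ _ _ (k := 1) fun _ => rfl]
  simp only [Instr.gateCost, cubeQuery, List.length_finRange]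
  ring

theorem queries_decodeProg (τ : ℝ) (M i : ℕ) :
    cost Instr.queryCost (decodeProg τ M i : Program d m n) = 0 := by
  simp [decodeProg, quadratureProg, residualProg, directionProg, correctProg, doubleProg, angleProg,
    rotateProg, cost, Instr.queryCost]

theorem gates_decodeProg (t : ℕ) (τ : ℝ) (M i : ℕ) :
    cost (Instr.gateCost t) (decodeProg τ M i : Program d m n) = 35 := by
  simp [decodeProg, quadratureProg, residualProg, directionProg, correctProg, doubleProg, angleProg,
    rotateProg, cost, Instr.gateCost]

theorem queries_stageProg (γ : Fin m → ℝ) (js : List (Fin m)) (M : ℕ) (σ τ : ℝ) :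
    cost Instr.queryCost (stageProg γ js M σ τ : Program d m (d + 1 + m)) = 4 * M := by
  simp only [stageProg, resetProg, repeatProg, cost_append, cost_singleton, cost_flatten_replicate,
    queries_sampleProg]
  rw [cost_fillProg (k := 0) fun _ _ => rfl, cost_fillProg (k := 0) fun _ _ => rfl,
    cost_flatMap _ _ _ fun _ => queries_decodeProg _ _ _]
  simp only [Instr.queryCost]
  ring

theorem gates_stageProg (t : ℕ) (γ : Fin m → ℝ) (js : List (Fin m)) (M : ℕ) (σ τ : ℝ) :
    cost (Instr.gateCost t) (stageProg γ js M σ τ : Program d m (d + 1 + m))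
      = 37 * d + 1 + 2 * M * (4 * d + js.length + 3) := by
  simp only [stageProg, resetProg, repeatProg, cost_append, cost_singleton, cost_flatten_replicate,
    gates_sampleProg]
  rw [cost_fillProg (k := 1) fun _ _ => rfl, cost_fillProg (k := 1) fun _ _ => rfl,
    cost_flatMap _ _ _ fun _ => gates_decodeProg _ _ _ _]
  simp only [Instr.gateCost, List.length_finRange]
  ring

theorem queries_estimatorProg (p a : ℕ) (h : ℝ) (e : ℤ) (G : ℝ) (M K : ℕ) :
    queries (estimatorProg p a h e G M K : Program d m (d + 1 + m)) = K * (4 * M) := by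
  change cost Instr.queryCost _ = _
  simp only [estimatorProg, pointProg, initProg, stagesProg, shiftsProg, cost_append,
    cost_singleton]
  rw [cost_flatMap _ _ (fun k => stageProg _ _ _ _ _) fun k => queries_stageProg _ _ _ _ _,
    cost_map _ _ _ (k := 0) fun _ => rfl, cost_flatMap _ _ _ (k := 0),
    cost_fillProg (k := 0) fun _ _ => rfl, cost_fillProg (k := 0) fun _ _ => rfl,
    cost_fillProg (k := 0) fun _ _ => rfl]
  · simp [Instr.queryCost]
  · intro i
    rw [shiftProg, cost_flatMap _ _ _ (k := 0) fun _ => rfl, mul_zero]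

/-- The phase gates act on at most 14 output qubits, hence the 17 = 14 + 3 and no dependence on m.
Each of the a·d coin tosses takes six instructions. -/
theorem gates_estimatorProg_le (τ p a : ℕ) (h : ℝ) (e : ℤ) (G : ℝ) (M K : ℕ) :
    gates τ (estimatorProg p a h e G M K : Program d m (d + 1 + m))
      ≤ 4 * d + 1 + 6 * a * d + K * (37 * d + 1 + 2 * M * (4 * d + 17)) := by
  change cost (Instr.gateCost τ) _ ≤ _
  simp only [estimatorProg, pointProg, initProg, stagesProg, shiftsProg, cost_append,
    cost_singleton]
  rw [cost_flatMap _ _ (fun k => stageProg _ _ _ _ _) fun k => gates_stageProg _ _ _ _ _ _,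
    cost_map _ _ _ (k := 1) fun _ => rfl, cost_flatMap _ _ _ (k := a * 6),
    cost_fillProg (k := 1) fun _ _ => rfl, cost_fillProg (k := 1) fun _ _ => rfl,
    cost_fillProg (k := 1) fun _ _ => rfl]
  · have hw : 4 * d + (window m p e).length + 3 ≤ 4 * d + 17 := by
      have := length_window_le m p e
      omega
    have := Nat.mul_le_mul_left K (Nat.add_le_add_left (Nat.mul_le_mul_left (2 * M) hw) (37 * d + 1))
    simp only [Instr.gateCost, List.length_finRange, List.length_range]
    linarith
  · intro i
    rw [shiftProg, cost_flatMap _ _ _ (k := 6) fun _ => rfl, List.length_range]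

end Cost

/-! ### Parameters -/

section Parameters

theorem exists_four_pow_bounds {Q : ℝ} (hQ : 1 ≤ Q) :
    ∃ a : ℕ, 4 * Q ≤ 4 ^ a ∧ (4 : ℝ) ^ a ≤ 16 * Q := by
  obtain ⟨k, h1, h2⟩ := exists_nat_pow_near (show 1 ≤ 4 * Q by linarith) (show (1 : ℝ) < 4 by norm_num)
  exact ⟨k + 1, h2.le, by rw [pow_succ]; linarith⟩

theorem exists_two_pow_bounds {y : ℝ} :
    ∃ K : ℕ, y ≤ 2 ^ K ∧ (∀ k < K, (2 : ℝ) ^ k < y) := by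
  classical
  have hex : ∃ K : ℕ, y ≤ 2 ^ K := (pow_unbounded_of_one_lt y one_lt_two).imp fun _ h => h.le
  exact ⟨Nat.find hex, Nat.find_spec hex, fun k hk => not_le.1 (Nat.find_min hex hk)⟩

theorem nat_le_two_mul_log_of_two_pow_le {K : ℕ} {Q : ℝ} (h : 2 ^ K ≤ Q) : K ≤ 2 * Real.log Q := by
  have h1 := Real.log_le_log (by positivity) h
  rw [Real.log_pow] at h1
  have h2 := Real.log_two_gt_d9
  have : (0 : ℝ) ≤ K := Nat.cast_nonneg K
  nlinarith

/-- With S the square root on the right, the spacing satisfies θ ≤ 4Sh. As the phase scale s is at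
least 1/(24000 θ), the last resolution G/2^K ≤ d/(2πsh) is at most 16000 dS; bounding √d by d gives
d². -/
theorem resolution_le {d K : ℕ} {G θ r₁ ρ h s : ℝ} (hd : 0 < d) (hG : 0 < G) (hθ : 0 < θ)
    (hr : 0 < r₁) (hρ : 0 < ρ) (hh0 : 0 < h) (hh : r₁ * (θ * ρ) ≤ 16 * G * h ^ 2)
    (hs : 1 / 24000 ≤ s * θ) (hK : 2 * Real.pi * s * G * h / d ≤ 2 ^ K) :
    √d * (G / 2 ^ K) ≤ 16000 * (d : ℝ) ^ 2 * √(θ * G / (ρ * r₁)) := by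
  have hd1 : (1 : ℝ) ≤ d := by exact_mod_cast hd
  have hd0 : (0 : ℝ) < d := by linarith
  have hs0 : 0 < s := by
    by_contra hc
    nlinarith
  have hπ := Real.pi_gt_d2
  set S := √(θ * G / (ρ * r₁)) with hS
  have hS0 : 0 ≤ S := Real.sqrt_nonneg _
  have hS2 : S ^ 2 = θ * G / (ρ * r₁) := Real.sq_sqrt (by positivity)
  have h1 : θ ≤ 4 * S * h := by
    refine le_of_sq_le_sq ?_ (by positivity)
    have e1 : (4 * S * h) ^ 2 * (ρ * r₁) = θ * (16 * G * h ^ 2) := by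
      rw [mul_pow, mul_pow, hS2]; field_simp; norm_num
    have e3 : θ ^ 2 * (ρ * r₁) ≤ (4 * S * h) ^ 2 * (ρ * r₁) := by
      rw [e1]
      calc θ ^ 2 * (ρ * r₁) = θ * (r₁ * (θ * ρ)) := by ring
        _ ≤ _ := by gcongr
    exact le_of_mul_le_mul_right e3 (by positivity)
  rw [div_le_iff₀ hd0] at hK
  have h2 : G ≤ 16000 * d * S * 2 ^ K := by
    have h3 : 2 * 3.14 * s * G * h * θ ≤ 2 ^ K * d * (4 * S * h) := by
      calc 2 * 3.14 * s * G * h * θ ≤ 2 * Real.pi * s * G * h * θ := by gcongr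
        _ ≤ 2 ^ K * d * (4 * S * h) := by gcongr
    have h5 : 2 * 3.14 * (1 / 24000) * (G * h) ≤ 2 * 3.14 * (s * θ) * (G * h) := by gcongr
    have h6 : G * h ≤ (16000 * d * S * 2 ^ K) * h := by
      have : 0 ≤ 2 ^ K * d * S * h := by positivity
      linarith
    exact le_of_mul_le_mul_right h6 hh0
  have h7 : √(d : ℝ) ≤ d := Real.sqrt_le_iff.2 ⟨hd0.le, by nlinarith⟩
  calc √d * (G / 2 ^ K) ≤ d * (16000 * d * S) := by
        gcongr
        rwa [div_le_iff₀ (by positivity)]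
    _ = _ := by ring

theorem one_le_log_of_three_le {y : ℝ} (hy : 3 ≤ y) : 1 ≤ Real.log y := by
  rw [Real.le_log_iff_exp_le (by linarith)]
  have := Real.exp_one_lt_d9
  linarith

/-- The last stage used satisfies 2^(K-1) < 2πsGh/d, where s ≤ 1/(12000 θ) and h ≤ r₁. This makes
the number of stages logarithmic. -/
theorem two_pow_stages_le {d K : ℕ} {G θ r₁ ρ h s : ℝ} (hd : 0 < d) (hG : 0 < G) (hθ : 0 < θ)
    (hρ : 0 < ρ) (hρ1 : ρ ≤ 1) (hh0 : 0 < h) (hhr : h ≤ r₁)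
    (hs0 : 0 < s) (hs : s * θ ≤ 1 / 12000) (hK2 : ∀ k < K, 2 ^ k < 2 * Real.pi * s * G * h / d)
    (hQ : 1 ≤ G * r₁ / (θ * ρ)) : 2 ^ K ≤ G * r₁ / (θ * ρ) := by
  have hd1 : (1 : ℝ) ≤ d := by exact_mod_cast hd
  have hd0 : (0 : ℝ) < d := by linarith
  have hr : 0 < r₁ := by linarith
  have hπ' := Real.pi_lt_d2
  have hπ0 := Real.pi_pos
  rcases Nat.eq_zero_or_pos K with rfl | hK
  · rw [pow_zero]; exact hQ
  · have h1 := hK2 (K - 1) (by omega)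
    have h2 : (2 : ℝ) ^ K = 2 * 2 ^ (K - 1) := by rw [← pow_succ']; congr 1; omega
    rw [lt_div_iff₀ hd0] at h1
    have h3 : s * (G * h) * θ ≤ G * r₁ / 12000 := by
      have : (s * θ) * (G * h) ≤ 1 / 12000 * (G * r₁) := by gcongr
      linarith
    have h5 : (2 : ℝ) ^ (K - 1) ≤ 2 ^ (K - 1) * d := le_mul_of_one_le_right (by positivity) hd1
    rw [le_div_iff₀ (by positivity), h2]
    have h6 : (2 : ℝ) ^ (K - 1) * θ ≤ 2 * Real.pi * (s * (G * h) * θ) := by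
      have : (2 : ℝ) ^ (K - 1) * θ ≤ (2 * Real.pi * s * G * h) * θ := by
        gcongr; linarith
      linarith
    have h7 : 2 * Real.pi * (s * (G * h) * θ) ≤ 2 * 3.15 * (G * r₁ / 12000) := by gcongr
    have hGr : 0 < G * r₁ := by positivity
    have h8 : (2 : ℝ) ^ (K - 1) * θ * ρ ≤ (2 : ℝ) ^ (K - 1) * θ :=
      mul_le_of_le_one_right (by positivity) hρ1
    nlinarith

/-- Take M = ⌈10000 log Z⌉ with Z = 8(K + 1)d/ρ, so that each exponential is at most 1/Z. -/
theorem exists_repetitions {d : ℕ} {ρ : ℝ} (hd : 0 < d) (K : ℕ) (hρ : 0 < ρ) (hρ1 : ρ ≤ 1) :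
    ∃ M : ℕ, 0 < M ∧ K * (4 * d * Real.exp (-M / 10000)) ≤ ρ / 2 ∧
      M ≤ 10000 * Real.log (8 * (K + 1) * d / ρ) + 1 := by
  have hd1 : (1 : ℝ) ≤ d := by exact_mod_cast hd
  have hdρ : 1 ≤ d / ρ := by rw [one_le_div hρ]; linarith
  set Z := 8 * (K + 1) * d / ρ with hZ
  have hZ8 : 8 ≤ Z := by
    rw [hZ, mul_div_assoc]
    have : (0 : ℝ) ≤ K := Nat.cast_nonneg K
    nlinarith
  have hZ0 : 0 < Z := by linarith
  have hlogZ : 0 < Real.log Z := Real.log_pos (by linarith)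
  refine ⟨⌈10000 * Real.log Z⌉₊, Nat.ceil_pos.2 (by positivity), ?_,
    (Nat.ceil_lt_add_one (by positivity)).le⟩
  have h2 : Real.exp (-(⌈10000 * Real.log Z⌉₊ : ℝ) / 10000) ≤ 1 / Z := by
    rw [one_div, ← Real.exp_log hZ0, ← Real.exp_neg]
    refine Real.exp_le_exp.2 ?_
    rw [Real.exp_log hZ0, div_le_iff₀ (by norm_num)]
    have := Nat.le_ceil (10000 * Real.log Z)
    linarith
  calc _ ≤ (K + 1 : ℝ) * (4 * d * (1 / Z)) := by gcongr; linarith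
    _ = ρ / 2 := by rw [hZ]; field_simp; norm_num

/-- Set Q = Gr₁/(θρ). The bound 4^a ≥ 4Q makes Markov's inequality fail with probability at most
ρ/2, while 4^a ≤ 16Q keeps the spacing h = r₁/2^a large. The scale 2^e is the largest power of two
with 2^e θ ≤ 1/12000. The number of stages K is the first with 2^K ≥ 2π 2^e Gh/d: earlier stages fit
into the linear region, and K of them reach the resolution. Repetitions use up the other ρ/2. -/
theorem exists_estimator_parameters {d : ℕ} {G θ r₁ ρ : ℝ} (hd : 0 < d) (hG : 0 < G) (hθ : 0 < θ)
    (hr : 0 < r₁) (hρ : 0 < ρ) (hρ1 : ρ ≤ 1) (hQ : θ * ρ ≤ G * r₁) :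
    ∃ (a K M : ℕ) (h : ℝ) (e : ℤ), 0 < h ∧ h * 2 ^ a = r₁ ∧ 0 < M ∧ 2 ^ e * θ ≤ 1 / 12000 ∧
      (∀ k < K, d * (2 ^ k / (2 * Real.pi * 2 ^ e * G)) ≤ h) ∧
      √d * (G / 2 ^ K) ≤ 16000 * (d : ℝ) ^ 2 * √(θ * G / (ρ * r₁)) ∧
      2 * G * h / (2 ^ a * θ) + K * (4 * d * Real.exp (-M / 10000)) ≤ ρ ∧
      a ≤ Real.log (16 * (G * r₁ / (θ * ρ)) * d / ρ) ∧
      K ≤ 2 * Real.log (16 * (G * r₁ / (θ * ρ)) * d / ρ) ∧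
      M ≤ 10001 * Real.log (16 * (G * r₁ / (θ * ρ)) * d / ρ) := by
  have hd1 : (1 : ℝ) ≤ d := by exact_mod_cast hd
  have hd0 : (0 : ℝ) < d := by linarith
  set Q := G * r₁ / (θ * ρ) with hQdef
  have hQ1 : 1 ≤ Q := by rw [hQdef, one_le_div (by positivity)]; exact hQ
  have hQ0 : 0 < Q := by linarith
  have hdρ : 1 ≤ d / ρ := by rw [one_le_div hρ]; linarith
  have hW : 16 * Q ≤ 16 * Q * d / ρ := by
    rw [mul_div_assoc]; exact le_mul_of_one_le_right (by positivity) hdρ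
  set W := 16 * Q * d / ρ with hWdef
  have hW0 : 0 < W := by positivity
  have hW1 : 1 ≤ Real.log W := one_le_log_of_three_le (by linarith)
  obtain ⟨a, ha1, ha2⟩ := exists_four_pow_bounds hQ1
  have h4 : (4 : ℝ) ^ a = 2 ^ a * 2 ^ a := by rw [← mul_pow]; norm_num
  set h := r₁ / 2 ^ a with hh
  have hh0 : 0 < h := by positivity
  have hhr : h ≤ r₁ := div_le_self hr.le (one_le_pow₀ one_le_two)
  have hsq : h ^ 2 * 4 ^ a = r₁ ^ 2 := by
    rw [h4, hh]; field_simp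
  have hhQ : r₁ * (θ * ρ) ≤ 16 * G * h ^ 2 := by
    have e2 : Q * (θ * ρ) = G * r₁ := by rw [hQdef]; field_simp
    have e1 : r₁ * (r₁ * (θ * ρ)) ≤ r₁ * (16 * G * h ^ 2) := by
      calc r₁ * (r₁ * (θ * ρ)) = h ^ 2 * 4 ^ a * (θ * ρ) := by rw [hsq]; ring
        _ ≤ h ^ 2 * (16 * Q) * (θ * ρ) := by gcongr
        _ = 16 * h ^ 2 * (Q * (θ * ρ)) := by ring
        _ = _ := by rw [e2]; ring
    exact le_of_mul_le_mul_left e1 hr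
  obtain ⟨e, he1, he2⟩ := exists_mem_Ico_zpow (show 0 < 1 / (12000 * θ) by positivity) one_lt_two
  have he0 : (0 : ℝ) < 2 ^ e := by positivity
  have heθ : 2 ^ e * θ ≤ 1 / 12000 := by
    rw [le_div_iff₀ (by positivity)] at he1 ⊢; linarith
  have heθ' : 1 / 24000 ≤ 2 ^ e * θ := by
    rw [zpow_add_one₀ two_ne_zero, div_lt_iff₀ (by positivity)] at he2
    linarith
  obtain ⟨K, hK1, hK2⟩ := exists_two_pow_bounds (y := 2 * Real.pi * 2 ^ e * G * h / d)
  have hKQ : (2 : ℝ) ^ K ≤ Q := two_pow_stages_le hd hG hθ hρ hρ1 hh0 hhr he0 heθ hK2 hQ1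
  have hK3 : (K + 1 : ℝ) ≤ Q := by
    have : ((K + 1 : ℕ) : ℝ) ≤ ((2 ^ K : ℕ) : ℝ) := by exact_mod_cast Nat.lt_two_pow_self
    push_cast at this
    linarith
  obtain ⟨M, hM0, hM1, hM2⟩ := exists_repetitions hd K hρ hρ1
  refine ⟨a, K, M, h, e, hh0, ?_, hM0, heθ, ?_, ?_, ?_,
    ?_, ?_, ?_⟩
  · rw [hh]; field_simp
  · intro k hk
    have := (hK2 k hk).le
    rw [le_div_iff₀ hd0] at this
    rw [← mul_div_assoc, div_le_iff₀ (by positivity)]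
    linarith
  · exact resolution_le hd hG hθ hr hρ hh0 hhQ heθ' hK1
  · have h1 : 2 * G * h / (2 ^ a * θ) ≤ ρ / 2 := by
      have e2 : Q * (θ * ρ) = G * r₁ := by rw [hQdef]; field_simp
      rw [div_le_iff₀ (by positivity), hh, mul_div_assoc', div_le_iff₀ (by positivity)]
      have : 4 * Q * (θ * ρ) ≤ 4 ^ a * (θ * ρ) := by gcongr
      rw [h4] at this
      linarith
    linarith
  · have h1 : (a : ℝ) * Real.log 4 ≤ Real.log W := by
      rw [← Real.log_pow]
      exact Real.log_le_log (by positivity) (by linarith)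
    have h2 : 1 ≤ Real.log 4 := one_le_log_of_three_le (by norm_num)
    have : (0 : ℝ) ≤ a := Nat.cast_nonneg a
    nlinarith
  · exact nat_le_two_mul_log_of_two_pow_le (by linarith)
  · have h2 : Real.log (8 * (K + 1) * d / ρ) ≤ Real.log W :=
      Real.log_le_log (by positivity) (by rw [hWdef]; gcongr; linarith)
    linarith

/-! ### Closed forms for the prescribed oracle accuracy and the error budget -/

theorem rpow_four_point_five {x : ℝ} (hx : 0 < x) : x ^ (4.5 : ℝ) = x ^ 4 * √x := by
  rw [Real.sqrt_eq_rpow, ← Real.rpow_natCast, ← Real.rpow_add hx]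
  norm_num

/-- The half power of d in θ cancels the √d of r₁. The remaining d⁴ in the denominator is what the
squared factor (d²)² of the slope error removes. -/
theorem oracle_ratio_eq {c ε G R x T : ℝ} (hε : 0 < ε) (hG : 0 < G) (hR : 0 < R)
    (hx : 0 < x) (hT : 0 < T) :
    c * (ε ^ 5 / (G ^ 4 * R ^ 4 * x ^ (4.5 : ℝ))) * G / (1 / (3 * T) * (ε / (6 * G * √x)))
      = 18 * c * T * ε ^ 4 / (G ^ 2 * R ^ 4 * x ^ 4) := by
  have : 0 < √x := Real.sqrt_pos.2 hx
  rw [rpow_four_point_five hx]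
  field_simp
  ring

theorem grid_ratio_eq {c ε G R x T : ℝ} (hc : 0 < c) (hε : 0 < ε) (hG : 0 < G) (hR : 0 < R)
    (hx : 0 < x) (hT : 0 < T) :
    16 * (G * (ε / (6 * G * √x)) /
      (c * (ε ^ 5 / (G ^ 4 * R ^ 4 * x ^ (4.5 : ℝ))) * (1 / (3 * T)))) * x / (1 / (3 * T))
      = 24 * T ^ 2 * x ^ 5 * (G * R / ε) ^ 4 / c := by
  have : 0 < √x := Real.sqrt_pos.2 hx
  rw [rpow_four_point_five hx]
  field_simp
  norm_num

theorem log_grid_ratio_le {c q x T : ℝ} (hc : 0 < c) (hq : 0 < q) (hx : 1 ≤ x) (hT : 0 < T)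
    (hTq : T ≤ 37 * max 1 (q ^ 2)) :
    Real.log (24 * T ^ 2 * x ^ 5 * q ^ 4 / c)
      ≤ (|Real.log (32856 / c)| + 13) * Real.log (2 + x + q) := by
  set Y := 2 + x + q with hY
  have hY3 : 3 ≤ Y := by linarith
  have hL := one_le_log_of_three_le hY3
  have hTY : T ≤ 37 * Y ^ 2 := by
    refine hTq.trans ?_
    gcongr
    exact max_le (by nlinarith) (by gcongr; linarith)
  -- The exponent 13 is 4 + 5 + 4, and 32856 = 24 · 37².
  have h1 : 24 * T ^ 2 * x ^ 5 * q ^ 4 / c ≤ 32856 / c * Y ^ 13 := by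
    calc 24 * T ^ 2 * x ^ 5 * q ^ 4 / c ≤ 24 * (37 * Y ^ 2) ^ 2 * Y ^ 5 * Y ^ 4 / c := by
          gcongr <;> linarith
      _ = _ := by ring
  have h2 := Real.log_le_log (by positivity) h1
  rw [Real.log_mul (by positivity) (by positivity), Real.log_pow] at h2
  have h3 := le_abs_self (Real.log (32856 / c))
  have h4 := abs_nonneg (Real.log (32856 / c))
  push_cast at h2
  nlinarith

/-- The error of the projected subgradient method is at most `ε`. -/
theorem error_budget {c ε G R δ T : ℝ} (hc : 0 < c) (hc' : c ≤ 1 / 10 ^ 14) (hε : 0 < ε) (hG : 0 < G)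
    (hR : 0 < R) (hT : 36 * (G * R / ε) ^ 2 ≤ T) (hT' : T ≤ 37 * (G * R / ε) ^ 2) (hεGR : ε ≤ G * R)
    (hδ : 0 ≤ δ) (hδ2 : δ ^ 2 = 16000 ^ 2 * (18 * c * T * ε ^ 4 / (G ^ 2 * R ^ 4))) :
    δ * R + ε / 3 + R ^ 2 / (2 * (R / (G * √T)) * T) + R / (G * √T) * (G + δ) ^ 2 / 2 ≤ ε := by
  have hq0 : 0 < G * R / ε := by positivity
  have hT0 : 0 < T := by nlinarith
  have hs0 : 0 < √T := Real.sqrt_pos.2 hT0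
  have hs2 : √T ^ 2 = T := Real.sq_sqrt hT0.le
  have h1 : δ * R ≤ ε / 12 := by
    refine le_of_sq_le_sq ?_ (by positivity)
    have e1 : (δ * R) ^ 2 = 16000 ^ 2 * 18 * c * ε ^ 2 * (T / (G * R / ε) ^ 2) := by
      rw [mul_pow, hδ2]; field_simp
    rw [e1]
    have e2 : T / (G * R / ε) ^ 2 ≤ 37 := by rw [div_le_iff₀ (by positivity)]; exact hT'
    calc _ ≤ 16000 ^ 2 * 18 * (1 / 10 ^ 14) * ε ^ 2 * 37 := by gcongr
      _ ≤ (ε / 12) ^ 2 := by nlinarith [sq_nonneg ε]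
  have h2 : δ ≤ G / 12 := by
    have : δ * R ≤ G / 12 * R := by linarith
    exact le_of_mul_le_mul_right this hR
  have h3 : 6 * (G * R) ≤ ε * √T := by
    have : 6 * (G * R / ε) ≤ √T := Real.le_sqrt_of_sq_le (by linarith [mul_pow 6 (G * R / ε) 2])
    calc 6 * (G * R) = ε * (6 * (G * R / ε)) := by field_simp
      _ ≤ _ := by gcongr
  have h4 : G * R / √T ≤ ε / 6 := by rw [div_le_iff₀ hs0]; linarith
  have h5 : R ^ 2 / (2 * (R / (G * √T)) * T) = 1 / 2 * (G * R / √T) := by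
    nth_rewrite 2 [← hs2]
    field_simp
  have h6 : R / (G * √T) * (G + δ) ^ 2 / 2 ≤ R / (G * √T) * (13 / 12 * G) ^ 2 / 2 := by
    gcongr; linarith
  have h7 : R / (G * √T) * (13 / 12 * G) ^ 2 / 2 = 169 / 288 * (G * R / √T) := by
    field_simp
    norm_num
  rw [h5]
  -- The four terms are at most ε/12, ε/3, ε/12 and 169ε/1728, since GR/√T ≤ ε/6.
  linarith

end Parameters

/-! ### The main theorem -/

section Main

/-- The subgradient estimator for given parameters, its cost and its guarantee. -/
theorem exists_estimator {c : ℝ} (hc : 0 < c) {d : ℕ} {G R ε : ℝ} (m p : ℕ) (hd : 0 < d) (hG : 0 < G)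
    (hR : 0 < R) (hε : 0 < ε) {T : ℕ} (hT : 0 < T) (hTq : T ≤ 37 * max 1 ((G * R / ε) ^ 2))
    {θ r₁ ρ L : ℝ} (hθ : θ = c * (ε ^ 5 / (G ^ 4 * R ^ 4 * (d : ℝ) ^ (4.5 : ℝ))))
    (hr : r₁ = ε / (6 * G * √d)) (hρ : ρ = 1 / (3 * T))
    (hL : L = (|Real.log (32856 / c)| + 13) * Real.log (2 + d + G * R / ε)) :
    ∃ E : Program d m (d + 1 + m), queries E ≤ 80008 * L ^ 2 ∧
      (∀ τ, gates τ E ≤ 840171 * d * L ^ 2) ∧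
      ∀ (X : Set (EuclideanSpace ℝ (Fin d))) (f : EuclideanSpace ℝ (Fin d) → ℝ)
        (F : EuclideanSpace ℝ (Fin d) → BitVec m), ConvexOn ℝ Set.univ f →
        LipschitzWith G.toNNReal f → IsApproxOracle p f (boxNhd X (2 * r₁)) θ F →
        IsSubgradientEstimator F X f ρ (16000 * (d : ℝ) ^ 2 * √(θ * G / (ρ * r₁)))
          (2 * G * √d * r₁) E := by
  have hd1 : (1 : ℝ) ≤ d := by exact_mod_cast hd
  have hd0 : (0 : ℝ) < d := by linarith
  have hT1 : (1 : ℝ) ≤ T := by exact_mod_cast hT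
  have hT0 : (0 : ℝ) < T := by linarith
  have hq : 0 < G * R / ε := by positivity
  have hθ0 : 0 < θ := by rw [hθ]; positivity
  have hr0 : 0 < r₁ := by
    have : 0 < √(d : ℝ) := Real.sqrt_pos.2 hd0
    rw [hr]; positivity
  have hρ0 : 0 < ρ := by rw [hρ]; positivity
  have hρ1 : ρ ≤ 1 := by rw [hρ, div_le_one (by positivity)]; linarith
  have hL1 : 1 ≤ L := by
    have h1 : 1 ≤ Real.log (2 + d + G * R / ε) := one_le_log_of_three_le (by linarith)
    have h2 := abs_nonneg (Real.log (32856 / c))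
    rw [hL]
    nlinarith
  set S := √(θ * G / (ρ * r₁)) with hS
  -- If the admitted slope error is at least G, the zero vector already qualifies. Otherwise θρ ≤
  -- Gr₁, which the choice of parameters needs.
  by_cases hδ : G ≤ 16000 * (d : ℝ) ^ 2 * S
  · refine ⟨fillProg d 0, ?_, fun τ => ?_, fun X f F _ hLip _ =>
      isSubgradientEstimator_fillProg hG hρ0.le hδ (by positivity) hLip⟩
    · have : queries (fillProg d 0 : Program d m (d + 1 + m)) = d * 0 :=
        cost_fillProg (fun _ _ => rfl) _ _
      rw [this]
      norm_num
      positivity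
    · have : gates τ (fillProg d 0 : Program d m (d + 1 + m)) = d * 1 :=
        cost_fillProg (fun _ _ => rfl) _ _
      rw [this]
      push_cast
      have : 1 ≤ L ^ 2 := one_le_pow₀ hL1
      calc (d : ℝ) * 1 ≤ d * (840171 * L ^ 2) := by gcongr; linarith
        _ = _ := by ring
  · have hQ : θ * ρ ≤ G * r₁ := by
      push Not at hδ
      have hS0 : 0 ≤ S := Real.sqrt_nonneg _
      have hS2 : S ^ 2 = θ * G / (ρ * r₁) := Real.sq_sqrt (by positivity)
      have h1 : S ≤ G := by
        have : 1 ≤ 16000 * (d : ℝ) ^ 2 := by nlinarith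
        exact (le_mul_of_one_le_left hS0 this).trans hδ.le
      have h2 : θ * G ≤ G ^ 2 * (ρ * r₁) := by
        rw [← div_le_iff₀ (by positivity), ← hS2]; gcongr
      have h3 : G * θ ≤ G * (G * (ρ * r₁)) := by linarith
      have h4 := le_of_mul_le_mul_left h3 hG
      calc θ * ρ ≤ G * (ρ * r₁) * ρ := by gcongr
        _ = G * r₁ * (ρ * ρ) := by ring
        _ ≤ G * r₁ * (1 * 1) := by gcongr
        _ = _ := by ring
    obtain ⟨a, K, M, h, e, hh, hha, hM, he, hK, hδ', hρ', ha', hK', hM'⟩ :=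
      exists_estimator_parameters hd hG hθ0 hr0 hρ0 hρ1 hQ
    have hlog : Real.log (16 * (G * r₁ / (θ * ρ)) * d / ρ) ≤ L := by
      rw [hL, hθ, hr, hρ, grid_ratio_eq hc hε hG hR hd0 hT0]
      exact log_grid_ratio_le hc hq hd1 hT0 hTq
    have haL : (a : ℝ) ≤ L := by linarith
    have hKL : (K : ℝ) ≤ 2 * L := by linarith
    have hML : (M : ℝ) ≤ 10001 * L := by linarith
    refine ⟨estimatorProg p a h e G M K, ?_, fun τ => ?_, fun X f F hf hLip hF =>
      isSubgradientEstimator_estimatorProg hd hG hθ0 hh hha hM he hK hδ' hρ' hf hLip hF⟩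
    · rw [queries_estimatorProg]
      push_cast
      calc (K : ℝ) * (4 * M) ≤ 2 * L * (4 * (10001 * L)) := by gcongr
        _ = _ := by ring
    · have h1 : ((gates τ (estimatorProg p a h e G M K : Program d m (d + 1 + m)) : ℕ) : ℝ)
          ≤ ((4 * d + 1 + 6 * a * d + K * (37 * d + 1 + 2 * M * (4 * d + 17)) : ℕ) : ℝ) := by
        exact_mod_cast gates_estimatorProg_le τ p a h e G M K
      push_cast at h1
      refine h1.trans ?_
      calc (4 * d + 1 + 6 * a * d + K * (37 * d + 1 + 2 * M * (4 * d + 17)) : ℝ)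
          ≤ 4 * d + d + 6 * L * d
            + 2 * L * (37 * d + d + 2 * (10001 * L) * (4 * d + 17 * d)) := by
            gcongr
            linarith
        _ = d * (5 + 82 * L + 840084 * L ^ 2) := by ring
        _ ≤ d * (840171 * L ^ 2) := by gcongr; nlinarith
        _ = _ := by ring

end Main

end QPSM

end

/-! ### Assembly of the main theorem -/

theorem mainTheorem1 :
    ∃ (A c₀ : ℝ) (k : ℕ), 0 < A ∧ 0 < c₀ ∧ ∀ c : ℝ, 0 < c → c ≤ c₀ → ∃ C : ℝ, 0 < C ∧
      ∀ (d : ℕ) (G R ε : ℝ) (m p : ℕ), 0 < d → 0 < G → 0 < R → 0 < ε →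
        ∃ (T n : ℕ) (E : QPSM.Program d m n), 0 < T ∧
          (QPSM.queries (QPSM.qpsm T (R / (G * √T)) E) : ℝ)
            ≤ C * max 1 ((G * R / ε) ^ 2) * Real.log (2 + d + G * R / ε) ^ k ∧
          (∀ τ : ℕ, (QPSM.gates τ (QPSM.qpsm T (R / (G * √T)) E) : ℝ)
            ≤ C * (d + τ) * max 1 ((G * R / ε) ^ 2) * Real.log (2 + d + G * R / ε) ^ k) ∧
          ∀ (X : Set (EuclideanSpace ℝ (Fin d))) (f : EuclideanSpace ℝ (Fin d) → ℝ)
            (x₁ xstar : EuclideanSpace ℝ (Fin d)) (θ r₁ ρ : ℝ)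
            (F : EuclideanSpace ℝ (Fin d) → BitVec m),
            IsClosed X → Convex ℝ X →
            ConvexOn ℝ Set.univ f → LipschitzWith G.toNNReal f →
            x₁ ∈ X → xstar ∈ X → (∀ x ∈ X, f xstar ≤ f x) → (∀ x ∈ X, ‖x - xstar‖ ≤ R) →
            θ = c * (ε ^ 5 / (G ^ 4 * R ^ 4 * (d : ℝ) ^ (4.5 : ℝ))) →
            r₁ = ε / (6 * G * √d) → ρ = 1 / (3 * T) →
            QPSM.IsApproxOracle p f (QPSM.boxNhd X (2 * r₁)) θ F →
            QPSM.IsSubgradientEstimator F X f ρ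
              (A * (d : ℝ) ^ 2 * √(θ * G / (ρ * r₁))) (2 * G * √d * r₁) E ∧
            2 / 3 ≤ QPSM.prob F X (QPSM.qpsm T (R / (G * √T)) E) (QPSM.initConfig n x₁)
              {μ | QPSM.readVec d μ (2 * d) ∈ X ∧
                f (QPSM.readVec d μ (2 * d)) - f xstar ≤ ε} := by
  -- The bound on c makes the slope error satisfy δR ≤ ε/12. Both cost bounds carry two logarithms:
  -- stages times repetitions.
  refine ⟨16000, 1 / 10 ^ 14, 2, by norm_num, by norm_num, fun c hc hc' => ?_⟩
  set B := |Real.log (32856 / c)| + 13 with hB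
  have hB0 : 0 < B := by positivity
  refine ⟨40000000 * B ^ 2, by positivity, fun d G R ε m p hd hG hR hε => ?_⟩
  have hd1 : (1 : ℝ) ≤ d := by exact_mod_cast hd
  have hd0 : (0 : ℝ) < d := by linarith
  set q := G * R / ε with hq
  have hq0 : 0 < q := by positivity
  set l := Real.log (2 + d + q) with hl
  have hl1 : 1 ≤ l := QPSM.one_le_log_of_three_le (by linarith)
  have hmx : 1 ≤ max 1 (q ^ 2) := le_max_left _ _
  set mx := max 1 (q ^ 2) with hmxdef
  -- Rounding 36 mx up adds at most 1 ≤ mx.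
  obtain ⟨T, hT36, hT37⟩ : ∃ T : ℕ, 36 * mx ≤ T ∧ T ≤ 37 * mx :=
    ⟨⌈36 * mx⌉₊, Nat.le_ceil _, by
      have := (Nat.ceil_lt_add_one (show 0 ≤ 36 * mx by positivity)).le
      linarith⟩
  have hT0 : (0 : ℝ) < T := by linarith
  have hT : 0 < T := by exact_mod_cast hT0
  have hBl : 1 ≤ B * l := by
    have : 13 ≤ B := by rw [hB]; linarith [abs_nonneg (Real.log (32856 / c))]
    nlinarith
  obtain ⟨E, hEq, hEg, hE⟩ := QPSM.exists_estimator hc m p hd hG hR hε hT hT37 rfl rfl rfl rfl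
  rw [← hq, ← hB, ← hl] at hEq hEg
  refine ⟨T, d + 1 + m, E, hT, ?_, fun τ => ?_, ?_⟩
  · rw [QPSM.queries_qpsm]
    push_cast
    calc (T : ℝ) * QPSM.queries E ≤ 37 * mx * (80008 * (B * l) ^ 2) := by gcongr
      _ = 2960296 * (B ^ 2 * mx * l ^ 2) := by ring
      _ ≤ 40000000 * (B ^ 2 * mx * l ^ 2) := by gcongr; norm_num
      _ = _ := by ring
  · rw [QPSM.gates_qpsm]
    push_cast
    have hE' := hEg τ
    have hτ : (0 : ℝ) ≤ τ := Nat.cast_nonneg τ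
    have hT1 : (1 : ℝ) ≤ T := by exact_mod_cast hT
    have hs1 : 1 ≤ (B * l) ^ 2 := one_le_pow₀ hBl
    have h1 : (2 * d + 2 : ℝ) ≤ T * (4 * d) := by nlinarith
    have h2 : 4 * (d : ℝ) + (3 * d + 840171 * d * (B * l) ^ 2 + τ)
        ≤ 840178 * (d + τ) * (B * l) ^ 2 := by nlinarith
    calc (2 * d + 2 + T * (3 * d + QPSM.gates τ E + τ) : ℝ)
        ≤ T * (4 * d) + T * (3 * d + 840171 * d * (B * l) ^ 2 + τ) := by gcongr
      _ = T * (4 * d + (3 * d + 840171 * d * (B * l) ^ 2 + τ)) := by ring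
      _ ≤ 37 * mx * (840178 * (d + τ) * (B * l) ^ 2) := by gcongr
      _ = 31086586 * (B ^ 2 * (d + τ) * mx * l ^ 2) := by ring
      _ ≤ 40000000 * (B ^ 2 * (d + τ) * mx * l ^ 2) := by gcongr; norm_num
      _ = _ := by ring
  · intro X f x₁ xs θ r₁ ρ F hX hXc hf hL hx₁ hxs hmin hXR hθ hr hρ hF
    have hsd : 0 < √(d : ℝ) := Real.sqrt_pos.2 hd0
    have hest := hE X f F hf hL (by rw [← hr, ← hθ]; exact hF)
    rw [← hθ, ← hr, ← hρ] at hest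
    refine ⟨hest, ?_⟩
    have hρ0 : 0 < ρ := by rw [hρ]; positivity
    have hr0 : 0 < r₁ := by rw [hr]; positivity
    have hθ0 : 0 < θ := by rw [hθ]; positivity
    have hsT : 0 < √(T : ℝ) := Real.sqrt_pos.2 hT0
    refine QPSM.two_thirds_le_prob_qpsm hd hT hX hXc hf hL hx₁ hxs hXR (by positivity) hG
      (by positivity) (by positivity) hρ0.le (le_of_eq (by rw [hρ]; field_simp)) hest ?_
    intro v hv hreg
    -- For GR ≤ ε the Lipschitz bound makes every point of `X` an ε-minimizer; only for GR > ε is mx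
    -- = (GR/ε)² and the regret bound needed.
    rcases le_or_gt (G * R) ε with hGR | hGR
    · have h1 := QPSM.sub_le_of_lipschitz hG hL v xs
      have h2 : G * ‖v - xs‖ ≤ G * R := by gcongr; exact hXR v hv
      linarith
    · refine hreg.trans ?_
      have hq1 : 1 ≤ q := by rw [hq, one_le_div hε]; exact hGR.le
      have hmq : mx = q ^ 2 := max_eq_right (one_le_pow₀ hq1)
      have hγ : 2 * G * √d * r₁ = ε / 3 := by rw [hr]; field_simp; norm_num
      rw [hγ]
      refine QPSM.error_budget hc hc' hε hG hR (by rw [← hq, ← hmq]; exact hT36)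
        (by rw [← hq, ← hmq]; exact hT37) hGR.le (by positivity) ?_
      rw [mul_pow, Real.sq_sqrt (by positivity), hθ, hr, hρ,
        QPSM.oracle_ratio_eq hε hG hR hd0 hT0]
      field_simp
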